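/- **Definitions.** Links are polygonal links in $\mathbb{R}^3$, up to isotopy (the equivalence generated by triangle moves). A standard dyadic (s.d.) interval is $[k/2^m,(k+1)/2^m]\subseteq[0,1]$; an s.d. $n$-partition $\mathcal I$ is $0=a_0<\dots<a_n=1$ with every $[a_i,a_{i+1}]$ an s.d. interval; $\mathcal S(\mathcal I)$ is the set of s.d. intervals with both endpoints among the $a_i$, i.e. the set of edges of the binary tree $F_{\mathcal I}$ of $\mathcal I$. *Thompson links.* Replace each trivalent vertex of $F_{\mathcal I}$ (the midpoint splitting of an interval $A$) by a crossing in which the strand joining the edges of the two halves of $A$ passes over the strand that comes from the edge of $A$ and runs vertically down to the midpoint of $A$; add a trivial strand on the left and cap it off with the top edge. This gives a $(0,2n)$-tangle $\widehat{T_{\mathcal I}}$. For s.d. $n$-partitions $\mathcal I,\mathcal J$, the unoriented link $L_{(\mathcal I,\mathcal J)}$ is $\widehat{T_{\mathcal I}}$ glued on top of the vertical mirror image of $\widehat{T_{\mathcal J}}$. Each $g$ in Thompson's group $F$ is represented by a unique reduced pair $(\mathcal I,\mathcal J)$ of s.d. $n$-partitions ($g$ is linear on each subinterval of $\mathcal I$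 and maps it onto the corresponding one of $\mathcal J$); $n$ is the leaf number of $g$ and $L_g=L_{(\mathcal I,\mathcal J)}$. The Thompson index $ind_F(L)$ is the least leaf number of a $g\in F$ with $L_g=L$ as unoriented links. *Grids.* An unoriented $m\times m$ grid diagram has exactly two marked squares in each row and column; its unoriented link joins the two markings in each row and in each column, horizontal segments over vertical ones. $grid(L)$ is the least $m$ for which some $m\times m$ grid diagram represents the unoriented link $L$. Define signs of s.d. intervals by: $[0,1]$ is $+$, a left half has the sign of the whole, a right half the opposite sign. For an s.d. $n$-partition $\mathcal I$, let $\mathbb H_{\mathcal I}$ be the $n\times 2n$ diagram with an $O$ at column $1$, row $n$, and for each $A\in\mathcal S(\mathcal I)$ a marking ($X$ if $A$ is $+$, $O$ if $A$ is $-$) in column $1+{}$(rank of $A$ in $\mathcal S(\mathcal I)$ ordered by midpoint) and in the row equal to the rank, among the positive intervals of $\mathcal S(\mathcal I)$ ordered by length and then by midpoint, of $A$ if $A$ is $+$, and of the other half of the interval of which $A$ is a half if $A$ is $-$. Let $(\mathbb H_{\mathcal I},\mathbb H_{\mathcal J})$ be the $2n\times 2n$ diagram obtained by stacking $\mathbb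 H_{\mathcal I}$ over $\mathbb H_{\mathcal J}$ turned upside down and forgetting the distinction between $X$ and $O$; $\mathcal L(\mathbb H_{\mathcal I},\mathbb H_{\mathcal J})$ is its unoriented link. *Classical invariants.* $bridge(L)$ is the least number of local maxima of a height function over all polygonal representatives without horizontal edges; $braid(\vec L)$ is the least number of strands of a closed braid isotopic to the oriented link $\vec L$. All minima take values in $\mathbb N\cup\{\infty\}$, with $\min\emptyset=\infty$. **Theorem.** 1. For any two s.d. $n$-partitions $\mathcal I,\mathcal J$ (not necessarily compatible), $(\mathbb H_{\mathcal I},\mathbb H_{\mathcal J})$ is a $2n\times2n$ unoriented grid diagram and $\mathcal L(\mathbb H_{\mathcal I},\mathbb H_{\mathcal J})=L_{(\mathcal I,\mathcal J)}$ as unoriented links. 2. For any link $L$, $$grid(L)\le 2\cdot ind_F(L).$$ 3. For any link $L$ and every orientation $\vec L$ of $L$, $$bridge(L)\le braid(\vec L)\le grid(L)/2\le ind_F(L).$$ -/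

import Mathlib

open scoped ENNReal

noncomputable section

/-! ## Polygonal links in three-space and their equivalence

Points are triples `(x, y, z)`; diagrams are drawn in the `(x, y)`-plane and seen from `z = +∞`. -/

/-- Three-dimensional space; only its affine structure is used. -/
abbrev Pt : Type := ℝ × ℝ × ℝ

/-- The straight segment spanned by an unordered pair of points. -/
def seg (e : Sym2 Pt) : Set Pt := convexHull ℝ {p | p ∈ e}

/-- The union of the segments in a set of edges. -/
def carrier (E : Set (Sym2 Pt)) : Set Pt := ⋃ e ∈ E, seg e

/-- An (unoriented) polygonal link, given by its set of edges: finitely many nondegenerate segments,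
every vertex lies on exactly two edges, and distinct edges meet at most in common endpoints. Thus
the carrier is a finite disjoint union of simple closed polygons. -/
structure IsLink (E : Set (Sym2 Pt)) : Prop where
  finite : E.Finite
  nondegenerate : ∀ e ∈ E, ¬ e.IsDiag
  two_edges : ∀ e ∈ E, ∀ v ∈ e, {f | f ∈ E ∧ v ∈ f}.ncard = 2
  embedded : ∀ e ∈ E, ∀ f ∈ E, e ≠ f → ∀ p ∈ seg e ∩ seg f, p ∈ e ∧ p ∈ f

/-- Elementary triangle move: an edge `ab` is replaced by the edges `ac`, `cb`, where the triangle
`abc` meets the link exactly in `ab`. (A point `c` inside `ab` gives a subdivision.) -/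
def TriangleMove (E E' : Set (Sym2 Pt)) : Prop :=
  IsLink E ∧ IsLink E' ∧ ∃ a b c : Pt, s(a, b) ∈ E ∧
    convexHull ℝ {a, b, c} ∩ carrier E = segment ℝ a b ∧
    E' = (E \ {s(a, b)}) ∪ {s(a, c), s(c, b)}

/-- Equivalence (isotopy) of unoriented polygonal links, generated by triangle moves. -/
def LinkEquiv : Set (Sym2 Pt) → Set (Sym2 Pt) → Prop := Relation.EqvGen TriangleMove

/-- The unoriented edges underlying a set of directed edges. -/
def forget (D : Set (Pt × Pt)) : Set (Sym2 Pt) := (fun e => s(e.1, e.2)) '' D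

/-- An oriented polygonal link, given by its set of directed edges `(start, end)`. -/
structure IsOrientedLink (D : Set (Pt × Pt)) : Prop where
  finite : D.Finite
  nondegenerate : ∀ e ∈ D, e.1 ≠ e.2
  next : ∀ e ∈ D, ∃! f, f ∈ D ∧ f.1 = e.2
  prev : ∀ e ∈ D, ∃! f, f ∈ D ∧ f.2 = e.1
  embedded : ∀ e ∈ D, ∀ f ∈ D, e ≠ f → ∀ p ∈ segment ℝ e.1 e.2 ∩ segment ℝ f.1 f.2,
    (p = e.1 ∨ p = e.2) ∧ (p = f.1 ∨ p = f.2)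

/-- Elementary triangle move for oriented links. -/
def OrientedTriangleMove (D D' : Set (Pt × Pt)) : Prop :=
  IsOrientedLink D ∧ IsOrientedLink D' ∧ ∃ a b c : Pt, (a, b) ∈ D ∧
    convexHull ℝ {a, b, c} ∩ carrier (forget D) = segment ℝ a b ∧
    D' = (D \ {(a, b)}) ∪ {(a, c), (c, b)}

/-- Equivalence (isotopy) of oriented polygonal links. -/
def OrientedLinkEquiv : Set (Pt × Pt) → Set (Pt × Pt) → Prop :=
  Relation.EqvGen OrientedTriangleMove

/-! ## Bridge number and braid index -/

/-- The vertices of a polygonal link that are local maxima of the height function `y`. -/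
def localMaxima (E : Set (Sym2 Pt)) : Set Pt :=
  {v | (∃ e ∈ E, v ∈ e) ∧ ∀ e ∈ E, v ∈ e → ∀ w ∈ e, w.2.1 ≤ v.2.1}

/-- The bridge number: the least number of local maxima of the height function `y` over all
polygons without horizontal edges that are equivalent to the link. -/
def bridgeNumber (E : Set (Sym2 Pt)) : ℕ∞ :=
  sInf {k | ∃ E', LinkEquiv E E' ∧
    (∀ v w : Pt, s(v, w) ∈ E' → v.2.1 ≠ w.2.1) ∧ k = (localMaxima E').encard}

/-- The oriented area spanned by the `(y, z)`-projections of `p - c` and `q - c`; it is positive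
(negative) iff the segment from `p` to `q` misses the line `{y = c.1, z = c.2}` and turns around it
strictly in the positive (negative) direction. -/
def turning (c : ℝ × ℝ) (p q : Pt) : ℝ :=
  (p.2.1 - c.1) * (q.2.2 - c.2) - (p.2.2 - c.2) * (q.2.1 - c.1)

/-- `D` is a closed braid with axis the line `{y = c.1, z = c.2}`: it runs around the axis
strictly monotonically, always in the same direction. -/
def IsClosedBraid (c : ℝ × ℝ) (D : Set (Pt × Pt)) : Prop :=
  (∀ e ∈ D, 0 < turning c e.1 e.2) ∨ (∀ e ∈ D, turning c e.1 e.2 < 0)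

/-- The strands of a closed braid: its intersection with a half-plane bounded by the axis. (All
half-planes give the same number of points.) -/
def strands (c : ℝ × ℝ) (D : Set (Pt × Pt)) : Set Pt :=
  {p | p ∈ carrier (forget D) ∧ c.1 < p.2.1 ∧ p.2.2 = c.2}

/-- The braid index: the least number of strands of a closed braid equivalent to the link. -/
def braidIndex (D : Set (Pt × Pt)) : ℕ∞ :=
  sInf {k | ∃ D' c, OrientedLinkEquiv D D' ∧ IsClosedBraid c D' ∧ k = (strands c D').encard}

/-! ## Unoriented grid diagrams -/

/-- `G` is (the set of marked squares of) an unoriented `m × m` grid diagram; the square in column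
`x` and row `y`, counted from the lower left corner `(1, 1)`, is `(x, y)`. -/
structure IsGridDiagram (m : ℕ) (G : Set (ℕ × ℕ)) : Prop where
  bounds : ∀ p ∈ G, p.1 ∈ Set.Icc 1 m ∧ p.2 ∈ Set.Icc 1 m
  row : ∀ y ∈ Set.Icc 1 m, {x | (x, y) ∈ G}.ncard = 2
  column : ∀ x ∈ Set.Icc 1 m, {y | (x, y) ∈ G}.ncard = 2

/-- The unoriented link of a grid diagram: the markings of each row are joined at level `z = 1` and
those of each column at level `z = 0` (so horizontal segments are above vertical ones), and at
each marking the two levels are joined. -/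
def gridLink (G : Set (ℕ × ℕ)) : Set (Sym2 Pt) :=
  {e | ∃ x x' y : ℕ, (x, y) ∈ G ∧ (x', y) ∈ G ∧ x ≠ x' ∧ e = s((↑x, ↑y, 1), (↑x', ↑y, 1))} ∪
  {e | ∃ x y y' : ℕ, (x, y) ∈ G ∧ (x, y') ∈ G ∧ y ≠ y' ∧ e = s((↑x, ↑y, 0), (↑x, ↑y', 0))} ∪
  {e | ∃ x y : ℕ, (x, y) ∈ G ∧ e = s((↑x, ↑y, 0), (↑x, ↑y, 1))}

/-- The minimal grid number. -/
def gridNumber (E : Set (Sym2 Pt)) : ℕ∞ :=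
  sInf {k | ∃ (m : ℕ) (G : Set (ℕ × ℕ)), IsGridDiagram m G ∧ LinkEquiv E (gridLink G) ∧ k = m}

/-! ## Standard dyadic intervals and partitions, Thompson's group -/

/-- The pair `(m, k)` with `k < 2 ^ m` encodes the s.d. interval `[k / 2 ^ m, (k + 1) / 2 ^ m]`. -/
abbrev SDInterval : Type := {A : ℕ × ℕ // A.2 < 2 ^ A.1}

namespace SDInterval

def lo (A : SDInterval) : ℝ := (A.1.2 : ℝ) / 2 ^ A.1.1

def hi (A : SDInterval) : ℝ := ((A.1.2 : ℝ) + 1) / 2 ^ A.1.1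

def mid (A : SDInterval) : ℝ := (A.lo + A.hi) / 2

def len (A : SDInterval) : ℝ := A.hi - A.lo

/-- The interval `[0, 1]`. -/
def unit : SDInterval := ⟨(0, 0), by simp⟩

/-- `A` is one of the two halves of `B`. -/
def IsHalfOf (A B : SDInterval) : Prop := A.1.1 = B.1.1 + 1 ∧ A.1.2 / 2 = B.1.2

/-- The conjugate: the other half of the interval of which `A` is a half (`[0, 1]` is sent to
itself, by convention). -/
def conj (A : SDInterval) : SDInterval :=
  if h : A.1.1 = 0 then A else
    ⟨(A.1.1, if A.1.2 % 2 = 0 then A.1.2 + 1 else A.1.2 - 1), by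
      have hA := A.2
      obtain ⟨m, hm⟩ := Nat.exists_eq_succ_of_ne_zero h
      rw [hm, Nat.succ_eq_add_one, pow_succ] at hA
      simp only [hm, Nat.succ_eq_add_one, pow_succ]
      split_ifs <;> omega⟩

/-- `signAux m k` says that the interval encoded by `(m, k)` has sign `+`: `[0, 1]` is positive, a
left half has the same sign as the whole, a right half the opposite one. -/
def signAux : ℕ → ℕ → Prop
  | 0, _ => True
  | m + 1, k => if k % 2 = 0 then signAux m (k / 2) else ¬ signAux m (k / 2)

/-- The interval has sign `+`; otherwise it has sign `-`. -/
def Positive (A : SDInterval) : Prop := signAux A.1.1 A.1.2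

/-- The length order: first by length, then by midpoint. -/
def LenLE (A B : SDInterval) : Prop := A.len < B.len ∨ (A.len = B.len ∧ A.mid ≤ B.mid)

end SDInterval

/-- An s.d. `n`-partition `0 = a 0 < a 1 < ⋯ < a n = 1` of `[0, 1]`. -/
structure SDPartition (n : ℕ) where
  a : Fin (n + 1) → ℝ
  strictMono : StrictMono a
  first : a 0 = 0
  last : a (Fin.last n) = 1
  standard : ∀ i : Fin n, ∃ A : SDInterval, A.lo = a i.castSucc ∧ A.hi = a i.succ

namespace SDPartition

/-- The collection `𝒮(I)` of all s.d. intervals whose endpoints are breakpoints of `I`. -/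
def intervals {n : ℕ} (I : SDPartition n) : Set SDInterval :=
  {A | A.lo ∈ Set.range I.a ∧ A.hi ∈ Set.range I.a}

/-- The midpoint of the `i`-th subinterval. -/
def midpt {n : ℕ} (I : SDPartition n) (i : Fin n) : ℝ := (I.a i.castSucc + I.a i.succ) / 2

/-- `I` is a refinement of `K`. -/
def Refines {n k : ℕ} (I : SDPartition n) (K : SDPartition k) : Prop :=
  Set.range K.a ⊆ Set.range I.a

end SDPartition

/-- A dyadic rational number. -/
def IsDyadic (x : ℝ) : Prop := ∃ (k : ℤ) (m : ℕ), x = k / 2 ^ m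

/-- Thompson's group `F`, as a set of homeomorphisms of `[0, 1]`: orientation-preserving, and
piecewise linear with dyadic breakpoints and with powers of `2` as slopes. -/
def thompsonF : Set (unitInterval ≃ₜ unitInterval) :=
  {g | Monotone g ∧ ∃ (m : ℕ) (t : Fin (m + 1) → unitInterval), StrictMono t ∧ t 0 = 0 ∧
    t (Fin.last m) = 1 ∧ (∀ i, IsDyadic (t i)) ∧ ∀ i : Fin m, ∃ k : ℤ,
      ∀ x ∈ Set.Icc (t i.castSucc) (t i.succ),
        (g x : ℝ) = g (t i.castSucc) + (2 : ℝ) ^ k * ((x : ℝ) - t i.castSucc)}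

/-- The pair `(I, J)` represents `g`: `g` maps the `i`-th breakpoint of `I` to that of `J` and is
linear on the subintervals of `I`. -/
def Represents {n : ℕ} (I J : SDPartition n) (g : unitInterval ≃ₜ unitInterval) : Prop :=
  ∀ (i : Fin n) (x : unitInterval), I.a i.castSucc ≤ x → (x : ℝ) ≤ I.a i.succ →
    (g x : ℝ) = J.a i.castSucc +
      (J.a i.succ - J.a i.castSucc) / (I.a i.succ - I.a i.castSucc) * (x - I.a i.castSucc)

/-- `(I, J)` is a reduced pair representing `g`: it is not a refinement of another pair that
represents `g`. (Every `g` in `F` has exactly one.) -/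
def IsReducedPair {n : ℕ} (I J : SDPartition n) (g : unitInterval ≃ₜ unitInterval) : Prop :=
  Represents I J g ∧ ∀ (k : ℕ) (I' J' : SDPartition k), Represents I' J' g →
    I.Refines I' → J.Refines J' → k = n

/-! ## Thompson links -/

namespace SDInterval

/-- The trivalent vertex at which the edge `A` of the tree splits is drawn above the midpoint of
`A`, at a height increasing with the length of `A`. The crossing put there has an upper point,
joined to the edges of the two halves of `A`, and a lower point, joined to the edge coming from
above and to the vertical strand below the vertex. -/
def upper (A : SDInterval) : Pt := (A.mid, 1 + A.len, 1)

def lower (A : SDInterval) : Pt := (A.mid, 1 + A.len, 0)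

end SDInterval

/-- The `(0, 2n)`-tangle of an s.d. partition `I`, with endpoints on the line `y = 1`, `z = 0`:
every trivalent vertex of the binary tree of `I` is replaced by a crossing, the strand joining the
edges of the two halves passing over the strand that comes from above and goes straight down to
the corresponding breakpoint. A trivial strand is added on the left, above `0`, and joined to the
uppermost edge of the tree. -/
def tangle {n : ℕ} (I : SDPartition n) : Set (Sym2 Pt) :=
  {e | ∃ A ∈ I.intervals, e = s(A.lower, (A.mid, 1, 0))} ∪
  {e | ∃ A ∈ I.intervals, ∃ B ∈ I.intervals, A.IsHalfOf B ∧ e = s(B.upper, A.lower)} ∪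
  {s((0, 3, 0), SDInterval.unit.lower), s((0, 3, 0), (0, 1, 0))}

/-- The link `L_(I,J)`: the tangle of `I`, the vertical mirror image of the tangle of `J`, and
straight strands joining their endpoints in order from left to right. -/
def thompsonLink {n : ℕ} (I J : SDPartition n) : Set (Sym2 Pt) :=
  tangle I ∪ Sym2.map (fun p : Pt => (p.1, -p.2.1, p.2.2)) '' tangle J ∪
  {e | ∃ i : Fin n, e = s((I.a i.castSucc, 1, 0), (J.a i.castSucc, -1, 0))} ∪
  {e | ∃ i : Fin n, e = s((I.midpt i, 1, 0), (J.midpt i, -1, 0))}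

/-- The Thompson index: the least leaf number of a `g` in `F` with `L_g` equivalent to the link,
where `L_g = L_(I,J)` and the leaf number is `n` for the reduced pair `(I, J)` of s.d.
`n`-partitions representing `g`. -/
def thompsonIndex (E : Set (Sym2 Pt)) : ℕ∞ :=
  sInf {k | ∃ g ∈ thompsonF, ∃ (n : ℕ) (I J : SDPartition n),
    IsReducedPair I J g ∧ LinkEquiv E (thompsonLink I J) ∧ k = n}

/-! ## The half grid diagram of an s.d. partition -/

/-- The markings of a grid or half grid diagram: the squares with an `X`, and those with an `O`. -/
structure Markings where
  X : Set (ℕ × ℕ)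
  O : Set (ℕ × ℕ)

namespace SDPartition

/-- The column of `A`: the intervals in `𝒮(I)` get the columns `2, …, 2n` in midpoint order. -/
def posX {n : ℕ} (I : SDPartition n) (A : SDInterval) : ℕ :=
  1 + {B | B ∈ I.intervals ∧ B.mid ≤ A.mid}.ncard

open Classical in
/-- The row of `A`: the positive intervals in `𝒮(I)` get the rows `1, …, n` in length order, and a
negative interval gets the row of its conjugate. -/
def posY {n : ℕ} (I : SDPartition n) (A : SDInterval) : ℕ :=
  {B | B ∈ I.intervals ∧ B.Positive ∧ B.LenLE (if A.Positive then A else A.conj)}.ncard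

/-- The `n × 2n` half grid diagram `ℍ_I`. -/
def halfGrid {n : ℕ} (I : SDPartition n) : Markings where
  X := {p | ∃ A ∈ I.intervals, A.Positive ∧ p = (I.posX A, I.posY A)}
  O := {(1, n)} ∪ {p | ∃ A ∈ I.intervals, ¬ A.Positive ∧ p = (I.posX A, I.posY A)}

end SDPartition

/-- The unoriented `2n × 2n` diagram `(H₊, H₋)`: the `n × 2n` diagram `H₊` is stacked over `H₋`
turned upside down, and the distinction between `X` and `O` is forgotten. -/
def stack (n : ℕ) (H H' : Markings) : Set (ℕ × ℕ) :=
  {p | ∃ x y : ℕ, (x, y) ∈ H.X ∪ H.O ∧ p = (x, n + y)} ∪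
  {p | ∃ x y : ℕ, (x, y) ∈ H'.X ∪ H'.O ∧ p = (x, n + 1 - y)}

end

open scoped ENNReal

noncomputable section

/-! ## Oriented links -/

namespace IsOrientedLink

variable {D : Set (Pt × Pt)}

/-! All isotopies rest on one principle: if the finitely many vertices of a polygonal link move
continuously and the polygons stay embedded throughout, the equivalence class does not change
(`orientedLinkEquiv_of_motion`). A grid link is first turned into a tent link, in which every row is
bent up to an apex (`IsGridFrame.equiv_gridOrientation`). Columns then lie at or below a fixed level
and rows at or above it, so crossings need no attention, and embeddedness becomes a question about
columns among themselves and rows among themselves (`TentFrame.embedded_of_bands`,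
`TentFrame.embedded_of_planar`).

Grid versus Thompson link: an interval gives a column at its midpoint and a row shared with its
conjugate, and the apex of that row belongs to the tree vertex of the parent. Interpolate linearly
between the grid picture and the tree picture. Rows of intervals of different lengths are in the
same vertical order in both pictures; rows of intervals of equal length are in the same horizontal
order. Strict inequalities survive convex combinations, so tents never collide
(`HalfDiagram.planar_sep`). At the end only the apex next to each root has to be flattened
(`HalfDiagram.equiv_treeLink`). The bound of the grid number by the Thompson index follows at once.

Braid index versus grid number: orientations can be carried along unoriented equivalences
(`LinkEquiv.lift`), so one may start from an oriented grid link. Take a horizontal axis deep below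
the diagram, tilt all rows so that they increase the vertical coordinate, and pull the columns that
run downwards below the axis. The result is a closed braid with at most one strand for each such
column (`IsGridFrame.braidIndex_le`). Reversing the orientation bounds the braid index by the number
of the other columns, and there are `m` columns altogether (`IsGridDiagram.two_mul_braidIndex_le`).

Bridge number versus braid index: squeeze space towards the level of the axis by a projective map on
each side. After a strong squeeze the height is governed by the angle around the axis, which is
monotone along a closed braid; local maxima then occur only where strands cross one half-plane
(`bridgeNumber_le_strands`). -/

theorem swap_notMem (h : IsOrientedLink D) {a b : Pt} (hab : (a, b) ∈ D) : (b, a) ∉ D := by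
  intro hba
  have hne := h.nondegenerate _ hab
  have := (h.embedded _ hab _ hba (by simp only [ne_eq, Prod.mk.injEq]; tauto) (midpoint ℝ a b)
    ⟨midpoint_mem_segment a b, segment_symm ℝ a b ▸ midpoint_mem_segment a b⟩).1
  simp only [midpoint_eq_left_iff, midpoint_eq_right_iff] at this
  tauto

theorem eq_of_fst (h : IsOrientedLink D) {e f : Pt × Pt} (he : e ∈ D) (hf : f ∈ D)
    (hef : e.1 = f.1) : e = f := by
  obtain ⟨g, ⟨hg, hge⟩, -⟩ := h.prev e he
  exact (h.next g hg).unique ⟨he, hge.symm⟩ ⟨hf, by rw [← hef, hge]⟩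

theorem eq_of_snd (h : IsOrientedLink D) {e f : Pt × Pt} (he : e ∈ D) (hf : f ∈ D)
    (hef : e.2 = f.2) : e = f := by
  obtain ⟨g, ⟨hg, hge⟩, -⟩ := h.next e he
  exact (h.prev g hg).unique ⟨he, hge.symm⟩ ⟨hf, by rw [← hef, hge]⟩

theorem exists_next (h : IsOrientedLink D) {a b : Pt} (he : (a, b) ∈ D) : ∃ c, (b, c) ∈ D := by
  obtain ⟨⟨x, c⟩, ⟨hf, rfl⟩, -⟩ := h.next _ he
  exact ⟨c, hf⟩

theorem exists_prev (h : IsOrientedLink D) {a b : Pt} (he : (a, b) ∈ D) : ∃ c, (c, a) ∈ D := by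
  obtain ⟨⟨c, x⟩, ⟨hf, rfl⟩, -⟩ := h.prev _ he
  exact ⟨c, hf⟩

/-- Existence of neighbouring edges together with injectivity of both endpoints replaces the `∃!`
fields; this form is easier to check by cases for a modified set of edges. -/
theorem of_injective (fin : D.Finite) (nd : ∀ a b, (a, b) ∈ D → a ≠ b)
    (nx : ∀ a b, (a, b) ∈ D → ∃ c, (b, c) ∈ D) (pr : ∀ a b, (a, b) ∈ D → ∃ c, (c, a) ∈ D)
    (fst : ∀ a b c, (a, b) ∈ D → (a, c) ∈ D → b = c)
    (snd : ∀ a b c, (b, a) ∈ D → (c, a) ∈ D → b = c)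
    (emb : ∀ a b c d, (a, b) ∈ D → (c, d) ∈ D → (a, b) ≠ (c, d) → ∀ p ∈ segment ℝ a b,
      p ∈ segment ℝ c d → (p = a ∨ p = b) ∧ (p = c ∨ p = d)) : IsOrientedLink D where
  finite := fin
  nondegenerate := fun ⟨a, b⟩ h => nd a b h
  next := by
    rintro ⟨a, b⟩ h
    obtain ⟨c, hc⟩ := nx a b h
    refine ⟨(b, c), ⟨hc, rfl⟩, ?_⟩
    rintro ⟨x, y⟩ ⟨hy, rfl⟩
    rw [fst _ _ _ hy hc]
  prev := by
    rintro ⟨a, b⟩ h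
    obtain ⟨c, hc⟩ := pr a b h
    refine ⟨(c, a), ⟨hc, rfl⟩, ?_⟩
    rintro ⟨x, y⟩ ⟨hy, rfl⟩
    rw [snd _ _ _ hy hc]
  embedded := by
    rintro ⟨a, b⟩ h ⟨c, d⟩ h' hne p ⟨hp, hp'⟩
    exact emb a b c d h h' hne p hp hp'

theorem emb (h : IsOrientedLink D) {a b c d p : Pt} (h1 : (a, b) ∈ D) (h2 : (c, d) ∈ D)
    (hne : (a, b) ≠ (c, d)) (hp : p ∈ segment ℝ a b) (hp' : p ∈ segment ℝ c d) :
    (p = a ∨ p = b) ∧ (p = c ∨ p = d) :=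
  h.embedded _ h1 _ h2 hne p ⟨hp, hp'⟩

theorem fst_unique (h : IsOrientedLink D) {a b c : Pt} (h1 : (a, b) ∈ D) (h2 : (a, c) ∈ D) :
    b = c := congrArg Prod.snd (h.eq_of_fst h1 h2 rfl)

theorem snd_unique (h : IsOrientedLink D) {a b c : Pt} (h1 : (b, a) ∈ D) (h2 : (c, a) ∈ D) :
    b = c := congrArg Prod.fst (h.eq_of_snd h1 h2 rfl)

end IsOrientedLink

theorem mem_carrier_forget {D : Set (Pt × Pt)} {p : Pt} :
    p ∈ carrier (forget D) ↔ ∃ a b, (a, b) ∈ D ∧ p ∈ segment ℝ a b := by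
  have key : ∀ a b : Pt, seg s(a, b) = segment ℝ a b := by
    intro a b
    rw [seg, ← convexHull_pair]
    congr 1
    ext x
    simp
  simp only [carrier, forget, Set.mem_iUnion, Set.mem_image, exists_prop]
  constructor
  · rintro ⟨_, ⟨⟨a, b⟩, h, rfl⟩, hp⟩
    exact ⟨a, b, h, by rwa [key] at hp⟩
  · rintro ⟨a, b, h, hp⟩
    exact ⟨_, ⟨(a, b), h, rfl⟩, by rwa [key]⟩

theorem seg_mk (a b : Pt) : seg s(a, b) = segment ℝ a b := by
  rw [seg, ← convexHull_pair]
  congr 1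
  ext x
  simp

theorem mem_forget {D : Set (Pt × Pt)} {a b : Pt} :
    s(a, b) ∈ forget D ↔ (a, b) ∈ D ∨ (b, a) ∈ D := by
  simp only [forget, Set.mem_image, Sym2.eq_iff]
  constructor
  · rintro ⟨⟨x, y⟩, h, ⟨rfl, rfl⟩ | ⟨rfl, rfl⟩⟩
    · exact Or.inl h
    · exact Or.inr h
  · rintro (h | h)
    · exact ⟨_, h, by simp⟩
    · exact ⟨_, h, by simp⟩

theorem segment_subset_hull_left (a b c : Pt) : segment ℝ a c ⊆ convexHull ℝ {a, b, c} := by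
  rw [← convexHull_pair]
  exact convexHull_mono (by intro x; simp; tauto)

theorem segment_subset_hull_right (a b c : Pt) : segment ℝ c b ⊆ convexHull ℝ {a, b, c} := by
  rw [← convexHull_pair]
  exact convexHull_mono (by intro x; simp; tauto)

theorem segment_subset_hull_base (a b c : Pt) : segment ℝ a b ⊆ convexHull ℝ {a, b, c} := by
  rw [← convexHull_pair]
  exact convexHull_mono (by intro x; simp; tauto)

/-! ### Free triangles and triangle moves -/

/-- The triangle `abc` is nondegenerate enough for a triangle move, and meets the edges in `F` only
in `a` and `b`. -/
structure FreeTriangle (F : Set (Pt × Pt)) (a b c : Pt) : Prop where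
  off : ∀ x y, (x, y) ∈ F → ∀ p ∈ segment ℝ x y, p ∈ convexHull ℝ {a, b, c} → p = a ∨ p = b
  ne : a ≠ b
  ne_left : c ≠ a
  ne_right : c ≠ b
  tip : ∀ p ∈ segment ℝ a c, p ∈ segment ℝ c b → p = c

namespace FreeTriangle

variable {F : Set (Pt × Pt)} {a b c : Pt}

theorem notMem_left (h : FreeTriangle F a b c) (x : Pt) : (c, x) ∉ F := by
  intro hx
  rcases h.off _ _ hx c (left_mem_segment ℝ _ _)
    (segment_subset_hull_left a b c (right_mem_segment ℝ _ _)) with e | e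
  · exact h.ne_left e
  · exact h.ne_right e

theorem notMem_right (h : FreeTriangle F a b c) (x : Pt) : (x, c) ∉ F := by
  intro hx
  rcases h.off _ _ hx c (right_mem_segment ℝ _ _)
    (segment_subset_hull_left a b c (right_mem_segment ℝ _ _)) with e | e
  · exact h.ne_left e
  · exact h.ne_right e

/-- A point common to a new edge and an edge of `F` lies in the triangle, so `off` makes it `a` or
`b`, and `tip` excludes the end not on the new edge. What remains is an end of the old edge `ab`,
where the embeddedness of the old link applies. -/
theorem isOrientedLink_insert (h : FreeTriangle F a b c) (hD : IsOrientedLink (insert (a, b) F))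
    (hab : (a, b) ∉ F) : IsOrientedLink (insert (a, c) (insert (c, b) F)) := by
  have hF : ∀ {x y}, (x, y) ∈ F → (x, y) ∈ insert (a, b) F := fun h => Or.inr h
  have h0 : (a, b) ∈ insert (a, b) F := Or.inl rfl
  have nl := h.notMem_left
  have nr := h.notMem_right
  have hne := h.ne
  have hca := h.ne_left
  have hcb := h.ne_right
  have nota : ∀ x, (a, x) ∉ F := fun x hx => hab (by rw [hD.fst_unique h0 (hF hx)]; exact hx)
  have notb : ∀ x, (x, b) ∉ F := fun x hx => hab (by rw [hD.snd_unique h0 (hF hx)]; exact hx)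
  have e1 : ∀ x y, (x, y) ∈ F → ∀ p ∈ segment ℝ a c, p ∈ segment ℝ x y → p = a ∧ (p = x ∨ p = y) := by
    intro x y hxy p hp hp'
    rcases h.off x y hxy p hp' (segment_subset_hull_left a b c hp) with rfl | rfl
    · refine ⟨rfl, (hD.emb h0 (hF hxy) (by rintro ⟨⟩; exact hab hxy) (left_mem_segment ℝ _ _) hp').2⟩
    · exact absurd (h.tip _ hp (right_mem_segment ℝ _ _)) (Ne.symm hcb)
  have e2 : ∀ x y, (x, y) ∈ F → ∀ p ∈ segment ℝ c b, p ∈ segment ℝ x y → p = b ∧ (p = x ∨ p = y) := by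
    intro x y hxy p hp hp'
    rcases h.off x y hxy p hp' (segment_subset_hull_right a b c hp) with rfl | rfl
    · exact absurd (h.tip _ (left_mem_segment ℝ _ _) hp) (Ne.symm hca)
    · refine ⟨rfl, (hD.emb h0 (hF hxy) (by rintro ⟨⟩; exact hab hxy) (right_mem_segment ℝ _ _) hp').2⟩
  have tip := h.tip
  apply IsOrientedLink.of_injective
  · exact ((hD.finite.subset (Set.subset_insert _ _)).insert _).insert _
  · rintro x y (⟨⟨⟩⟩ | ⟨⟨⟩⟩ | hxy)
    · exact hca.symm
    · exact hcb
    · exact hD.nondegenerate _ (hF hxy)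
  · rintro x y (⟨⟨⟩⟩ | ⟨⟨⟩⟩ | hxy)
    · exact ⟨b, by simp⟩
    · obtain ⟨z, hz⟩ := hD.exists_next h0
      refine ⟨z, ?_⟩
      rcases hz with ⟨⟨⟩⟩ | hz
      · exact absurd rfl hne
      · exact Or.inr (Or.inr hz)
    · obtain ⟨z, hz⟩ := hD.exists_next (hF hxy)
      rcases hz with ⟨⟨⟩⟩ | hz
      · exact ⟨c, by simp⟩
      · exact ⟨z, Or.inr (Or.inr hz)⟩
  · rintro x y (⟨⟨⟩⟩ | ⟨⟨⟩⟩ | hxy)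
    · obtain ⟨z, hz⟩ := hD.exists_prev h0
      refine ⟨z, ?_⟩
      rcases hz with ⟨⟨⟩⟩ | hz
      · exact absurd rfl hne
      · exact Or.inr (Or.inr hz)
    · exact ⟨a, by simp⟩
    · obtain ⟨z, hz⟩ := hD.exists_prev (hF hxy)
      rcases hz with ⟨⟨⟩⟩ | hz
      · exact ⟨c, by simp⟩
      · exact ⟨z, Or.inr (Or.inr hz)⟩
  · rintro x y z (⟨⟨⟩⟩ | ⟨⟨⟩⟩ | hxy) (⟨⟨⟩⟩ | ⟨⟨⟩⟩ | hxz)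
    all_goals first | rfl | exact absurd rfl hca | exact absurd hxz (nota _) |
      exact absurd hxy (nota _) | exact absurd hxz (nl _) | exact absurd hxy (nl _) |
      exact hD.fst_unique (hF hxy) (hF hxz)
  · rintro x y z (⟨⟨⟩⟩ | ⟨⟨⟩⟩ | hxy) (⟨⟨⟩⟩ | ⟨⟨⟩⟩ | hxz)
    all_goals first | rfl | exact absurd rfl hcb | exact absurd hxz (notb _) |
      exact absurd hxy (notb _) | exact absurd hxz (nr _) | exact absurd hxy (nr _) |
      exact hD.snd_unique (hF hxy) (hF hxz)
  · rintro x y z w (⟨⟨⟩⟩ | ⟨⟨⟩⟩ | hxy) (⟨⟨⟩⟩ | ⟨⟨⟩⟩ | hzw) hn p hp hp'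
    · exact absurd rfl hn
    · have := tip p hp hp'
      tauto
    · have := e1 _ _ hzw p hp hp'
      tauto
    · have := tip p hp' hp
      tauto
    · exact absurd rfl hn
    · have := e2 _ _ hzw p hp hp'
      tauto
    · have := e1 _ _ hxy p hp' hp
      tauto
    · have := e2 _ _ hxy p hp' hp
      tauto
    · exact hD.emb (hF hxy) (hF hzw) hn hp hp'

/-- The tip lies in the triangle but is neither `a` nor `b`, so no edge of `F` ends there, and
deleting it affects no other adjacency. -/
theorem isOrientedLink_remove (h : FreeTriangle F a b c)
    (hD : IsOrientedLink (insert (a, c) (insert (c, b) F))) : IsOrientedLink (insert (a, b) F) := by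
  have hF : ∀ {x y}, (x, y) ∈ F → (x, y) ∈ insert (a, c) (insert (c, b) F) :=
    fun h => Or.inr (Or.inr h)
  have h1 : (a, c) ∈ insert (a, c) (insert (c, b) F) := Or.inl rfl
  have h2 : (c, b) ∈ insert (a, c) (insert (c, b) F) := Or.inr (Or.inl rfl)
  have nl := h.notMem_left
  have nr := h.notMem_right
  have hne := h.ne
  have hca := h.ne_left
  have hcb := h.ne_right
  have nota : ∀ x, (a, x) ∉ F := fun x hx => by
    have := hD.fst_unique h1 (hF hx)
    subst this
    exact nr _ hx
  have notb : ∀ x, (x, b) ∉ F := fun x hx => by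
    have := hD.snd_unique h2 (hF hx)
    subst this
    exact nl _ hx
  have e1 : ∀ x y, (x, y) ∈ F → ∀ p ∈ segment ℝ a b, p ∈ segment ℝ x y →
      (p = a ∨ p = b) ∧ (p = x ∨ p = y) := by
    intro x y hxy p hp hp'
    rcases h.off x y hxy p hp' (segment_subset_hull_base a b c hp) with rfl | rfl
    · exact ⟨Or.inl rfl, (hD.emb h1 (hF hxy) (by rintro ⟨⟩; exact nr _ hxy)
        (left_mem_segment ℝ _ _) hp').2⟩
    · exact ⟨Or.inr rfl, (hD.emb h2 (hF hxy) (by rintro ⟨⟩; exact nl _ hxy)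
        (right_mem_segment ℝ _ _) hp').2⟩
  apply IsOrientedLink.of_injective
  · exact (hD.finite.subset fun x hx => Or.inr (Or.inr hx)).insert _
  · rintro x y (⟨⟨⟩⟩ | hxy)
    · exact hne
    · exact hD.nondegenerate _ (hF hxy)
  · rintro x y (⟨⟨⟩⟩ | hxy)
    · obtain ⟨z, hz⟩ := hD.exists_next h2
      rcases hz with ⟨⟨⟩⟩ | ⟨⟨⟩⟩ | hz
      · exact absurd rfl hne
      · exact absurd rfl hcb
      · exact ⟨z, Or.inr hz⟩
    · obtain ⟨z, hz⟩ := hD.exists_next (hF hxy)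
      rcases hz with ⟨⟨⟩⟩ | ⟨⟨⟩⟩ | hz
      · exact ⟨b, by simp⟩
      · exact absurd hxy (nr _)
      · exact ⟨z, Or.inr hz⟩
  · rintro x y (⟨⟨⟩⟩ | hxy)
    · obtain ⟨z, hz⟩ := hD.exists_prev h1
      rcases hz with ⟨⟨⟩⟩ | ⟨⟨⟩⟩ | hz
      · exact absurd rfl hca
      · exact absurd rfl hne
      · exact ⟨z, Or.inr hz⟩
    · obtain ⟨z, hz⟩ := hD.exists_prev (hF hxy)
      rcases hz with ⟨⟨⟩⟩ | ⟨⟨⟩⟩ | hz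
      · exact absurd hxy (nl _)
      · exact ⟨a, by simp⟩
      · exact ⟨z, Or.inr hz⟩
  · rintro x y z (⟨⟨⟩⟩ | hxy) (⟨⟨⟩⟩ | hxz)
    · rfl
    · exact absurd hxz (nota _)
    · exact absurd hxy (nota _)
    · exact hD.fst_unique (hF hxy) (hF hxz)
  · rintro x y z (⟨⟨⟩⟩ | hxy) (⟨⟨⟩⟩ | hxz)
    · rfl
    · exact absurd hxz (notb _)
    · exact absurd hxy (notb _)
    · exact hD.snd_unique (hF hxy) (hF hxz)
  · rintro x y z w (⟨⟨⟩⟩ | hxy) (⟨⟨⟩⟩ | hzw) hn p hp hp'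
    · exact absurd rfl hn
    · exact e1 _ _ hzw p hp hp'
    · exact (e1 _ _ hxy p hp' hp).symm
    · exact hD.emb (hF hxy) (hF hzw) hn hp hp'

theorem orientedTriangleMove (h : FreeTriangle F a b c) (hD : IsOrientedLink (insert (a, b) F))
    (hD' : IsOrientedLink (insert (a, c) (insert (c, b) F))) (hab : (a, b) ∉ F) :
    OrientedTriangleMove (insert (a, b) F) (insert (a, c) (insert (c, b) F)) := by
  refine ⟨hD, hD', a, b, c, Or.inl rfl, ?_, ?_⟩
  · ext p
    simp only [Set.mem_inter_iff, mem_carrier_forget]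
    constructor
    · rintro ⟨hp, x, y, ⟨⟨⟩⟩ | hxy, hp'⟩
      · exact hp'
      · rcases h.off x y hxy p hp' hp with rfl | rfl
        · exact left_mem_segment ℝ _ _
        · exact right_mem_segment ℝ _ _
    · exact fun hp => ⟨segment_subset_hull_base a b c hp, a, b, Or.inl rfl, hp⟩
  · rw [Set.insert_sdiff_of_mem _ (Set.mem_singleton _), Set.sdiff_singleton_eq_self hab]
    ext x
    simp only [Set.mem_insert_iff, Set.mem_union, Set.mem_singleton_iff]
    tauto

end FreeTriangle

theorem OrientedLinkEquiv.symm {D D' : Set (Pt × Pt)} (h : OrientedLinkEquiv D D') :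
    OrientedLinkEquiv D' D := Relation.EqvGen.symm _ _ h

theorem OrientedLinkEquiv.trans {D D' D'' : Set (Pt × Pt)} (h : OrientedLinkEquiv D D')
    (h' : OrientedLinkEquiv D' D'') : OrientedLinkEquiv D D'' := Relation.EqvGen.trans _ _ _ h h'

theorem OrientedLinkEquiv.refl (D : Set (Pt × Pt)) : OrientedLinkEquiv D D :=
  Relation.EqvGen.refl _

theorem LinkEquiv.symm {E E' : Set (Sym2 Pt)} (h : LinkEquiv E E') : LinkEquiv E' E :=
  Relation.EqvGen.symm _ _ h

theorem LinkEquiv.trans {E E' E'' : Set (Sym2 Pt)} (h : LinkEquiv E E') (h' : LinkEquiv E' E'') :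
    LinkEquiv E E'' := Relation.EqvGen.trans _ _ _ h h'

theorem convexHull_triple_swap (a b c : Pt) :
    convexHull ℝ {a, b, c} = convexHull ℝ ({b, a, c} : Set Pt) := by
  rw [Set.insert_comm]

/-- Removing the tips of a finite family of disjoint free triangles. -/
theorem IsOrientedLink.remove_tips {ι : Type*} {D : Set (Pt × Pt)} (hD : IsOrientedLink D)
    (a b c : ι → Pt) (s : Finset ι) (h1 : ∀ i ∈ s, (a i, c i) ∈ D) (h2 : ∀ i ∈ s, (c i, b i) ∈ D)
    (hne : ∀ i ∈ s, a i ≠ b i)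
    (off : ∀ i ∈ s, ∀ x y, (x, y) ∈ D → (x, y) ≠ (a i, c i) → (x, y) ≠ (c i, b i) →
      ∀ p ∈ segment ℝ x y, p ∈ convexHull ℝ {a i, b i, c i} → p = a i ∨ p = b i)
    (disj : ∀ i ∈ s, ∀ j ∈ s, i ≠ j → ∀ p ∈ convexHull ℝ {a i, b i, c i},
      p ∈ convexHull ℝ {a j, b j, c j} → p = a i ∨ p = b i) :
    IsOrientedLink ({f | f ∈ D ∧ ∀ i ∈ s, f ≠ (a i, c i) ∧ f ≠ (c i, b i)} ∪
        {f | ∃ i ∈ s, f = (a i, b i)}) ∧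
      OrientedLinkEquiv D ({f | f ∈ D ∧ ∀ i ∈ s, f ≠ (a i, c i) ∧ f ≠ (c i, b i)} ∪
        {f | ∃ i ∈ s, f = (a i, b i)}) := by
  classical
  induction s using Finset.induction_on with
  | empty =>
    have : ({f | f ∈ D ∧ ∀ i ∈ (∅ : Finset ι), f ≠ (a i, c i) ∧ f ≠ (c i, b i)} ∪
        {f | ∃ i ∈ (∅ : Finset ι), f = (a i, b i)}) = D := by
      ext f
      simp
    rw [this]
    exact ⟨hD, OrientedLinkEquiv.refl D⟩
  | insert i s his ih =>
    obtain ⟨l1, eq1⟩ := ih (fun j hj => h1 j (Finset.mem_insert_of_mem hj))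
      (fun j hj => h2 j (Finset.mem_insert_of_mem hj))
      (fun j hj => hne j (Finset.mem_insert_of_mem hj))
      (fun j hj => off j (Finset.mem_insert_of_mem hj))
      (fun j hj k hk => disj j (Finset.mem_insert_of_mem hj) k (Finset.mem_insert_of_mem hk))
    have hi : i ∈ insert i s := Finset.mem_insert_self i s
    have hca : c i ≠ a i := (hD.nondegenerate _ (h1 i hi)).symm
    have hcb : c i ≠ b i := hD.nondegenerate _ (h2 i hi)
    have mc : ∀ j, c j ∈ convexHull ℝ {a j, b j, c j} := fun j =>
      segment_subset_hull_left _ _ _ (right_mem_segment ℝ _ _)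
    have ma : ∀ j, a j ∈ convexHull ℝ {a j, b j, c j} := fun j =>
      segment_subset_hull_left _ _ _ (left_mem_segment ℝ _ _)
    have mb : ∀ j, b j ∈ convexHull ℝ {a j, b j, c j} := fun j =>
      segment_subset_hull_right _ _ _ (right_mem_segment ℝ _ _)
    -- The new tip lies outside the earlier triangles, so its two edges have survived the earlier
    -- removals.
    have cnot : ∀ j ∈ s, c i ∉ convexHull ℝ {a j, b j, c j} := by
      intro j hj hc
      rcases disj i hi j (Finset.mem_insert_of_mem hj) (by rintro rfl; exact his hj) _ (mc i) hc
        with e | e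
      · exact hca e
      · exact hcb e
    -- The edges common to the links before and after the removal of the tip `c i`.
    set F : Set (Pt × Pt) :=
      {f | f ∈ D ∧ ∀ j ∈ insert i s, f ≠ (a j, c j) ∧ f ≠ (c j, b j)} ∪
        {f | ∃ j ∈ s, f = (a j, b j)} with hF
    have E1 : ({f | f ∈ D ∧ ∀ j ∈ s, f ≠ (a j, c j) ∧ f ≠ (c j, b j)} ∪
        {f | ∃ j ∈ s, f = (a j, b j)}) = insert (a i, c i) (insert (c i, b i) F) := by
      ext f
      simp only [hF, Set.mem_union, Set.mem_ofPred_eq, Set.mem_insert_iff, Finset.mem_insert,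
        forall_eq_or_imp]
      constructor
      · rintro (⟨hf, h⟩ | h)
        · tauto
        · exact Or.inr (Or.inr (Or.inr h))
      · rintro (rfl | rfl | ⟨hf, -, h⟩ | h)
        · refine Or.inl ⟨h1 i hi, fun j hj => ⟨?_, ?_⟩⟩
          · intro e
            rw [Prod.mk.injEq] at e
            exact cnot j hj (e.2 ▸ mc j)
          · intro e
            rw [Prod.mk.injEq] at e
            exact cnot j hj (e.2 ▸ mb j)
        · refine Or.inl ⟨h2 i hi, fun j hj => ⟨?_, ?_⟩⟩
          · intro e
            rw [Prod.mk.injEq] at e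
            exact cnot j hj (e.1 ▸ ma j)
          · intro e
            rw [Prod.mk.injEq] at e
            exact cnot j hj (e.1 ▸ mc j)
        · exact Or.inl ⟨hf, h⟩
        · exact Or.inr h
    have E2 : ({f | f ∈ D ∧ ∀ j ∈ insert i s, f ≠ (a j, c j) ∧ f ≠ (c j, b j)} ∪
        {f | ∃ j ∈ insert i s, f = (a j, b j)}) = insert (a i, b i) F := by
      ext f
      simp only [hF, Set.mem_union, Set.mem_ofPred_eq, Set.mem_insert_iff, Finset.mem_insert,
        exists_eq_or_imp]
      tauto
    have free : FreeTriangle F (a i) (b i) (c i) := by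
      refine ⟨?_, hne i hi, hca, hcb, ?_⟩
      · rintro x y (⟨hxy, h⟩ | ⟨j, hj, h⟩) p hp hp'
        · exact off i hi x y hxy (h i hi).1 (h i hi).2 p hp hp'
        · rw [Prod.mk.injEq] at h
          rw [h.1, h.2] at hp
          exact disj i hi j (Finset.mem_insert_of_mem hj) (by rintro rfl; exact his hj) p hp'
            (segment_subset_hull_base _ _ _ hp)
      · intro p hp hp'
        have := hD.emb (h1 i hi) (h2 i hi) (by simp [hca.symm]) hp hp'
        have hn := hne i hi
        rcases this with ⟨h | h, h' | h'⟩
        all_goals first | assumption | exact absurd (h.symm.trans h') hn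
    rw [E1] at l1 eq1
    rw [E2]
    have l2 := free.isOrientedLink_remove l1
    have hab : (a i, b i) ∉ F := by
      rintro (⟨h, -⟩ | ⟨j, hj, h⟩)
      · exact hcb (hD.fst_unique (h1 i hi) h)
      · have := l1.fst_unique (Or.inl rfl) (show (a i, b i) ∈ _ from Or.inr (Or.inr (Or.inr ⟨j, hj, h⟩)))
        exact hcb this
    exact ⟨l2, eq1.trans (Relation.EqvGen.symm _ _
      (Relation.EqvGen.rel _ _ (free.orientedTriangleMove l2 l1 hab)))⟩

/-! ## Forgetting and lifting orientations -/

/-- At each vertex precisely one edge arrives and one leaves. They stay different as unordered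
pairs, since no edge occurs in both directions. -/
theorem IsOrientedLink.isLink {D : Set (Pt × Pt)} (h : IsOrientedLink D) : IsLink (forget D) where
  finite := h.finite.image _
  nondegenerate := by
    rintro _ ⟨⟨a, b⟩, hab, rfl⟩
    simpa using h.nondegenerate _ hab
  two_edges := by
    have key : ∀ u v w, (u, v) ∈ D → (v, w) ∈ D → {f | f ∈ forget D ∧ v ∈ f}.ncard = 2 := by
      intro u v w huv hvw
      have : {f | f ∈ forget D ∧ v ∈ f} = {s(u, v), s(v, w)} := by
        ext f
        induction f using Sym2.ind with
        | _ x y =>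
          simp only [Set.mem_ofPred_eq, mem_forget, Sym2.mem_iff, Set.mem_insert_iff,
            Set.mem_singleton_iff]
          constructor
          · rintro ⟨hx | hx, rfl | rfl⟩
            · rw [h.fst_unique hx hvw]; simp
            · rw [h.snd_unique hx huv]; simp
            · rw [h.snd_unique hx huv]; simp [Sym2.eq_swap]
            · rw [h.fst_unique hx hvw]; simp [Sym2.eq_swap]
          · rintro (e | e) <;> rw [Sym2.eq_iff] at e <;> aesop
      rw [this, Set.ncard_pair]
      intro e
      rw [Sym2.eq_iff] at e
      rcases e with ⟨rfl, rfl⟩ | ⟨rfl, -⟩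
      · exact h.nondegenerate _ huv rfl
      · exact h.swap_notMem huv hvw
    rintro _ ⟨⟨a, b⟩, hab, rfl⟩ v hv
    simp only [Sym2.mem_iff] at hv
    rcases hv with rfl | rfl
    · obtain ⟨u, hu⟩ := h.exists_prev hab
      exact key _ _ _ hu hab
    · obtain ⟨u, hu⟩ := h.exists_next hab
      exact key _ _ _ hab hu
  embedded := by
    rintro _ ⟨⟨a, b⟩, hab, rfl⟩ _ ⟨⟨c, d⟩, hcd, rfl⟩ hne p ⟨hp, hp'⟩
    simp only [seg_mk] at hp hp'
    simp only [Sym2.mem_iff]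
    exact h.emb hab hcd (by rintro ⟨⟩; exact hne rfl) hp hp'

theorem OrientedLinkEquiv.linkEquiv {D D' : Set (Pt × Pt)} (h : OrientedLinkEquiv D D') :
    LinkEquiv (forget D) (forget D') := by
  induction h with
  | rel D D' h =>
    obtain ⟨l, l', a, b, c, hab, hull, rfl⟩ := h
    refine Relation.EqvGen.rel _ _ ⟨l.isLink, l'.isLink, a, b, c, mem_forget.2 (Or.inl hab), hull, ?_⟩
    ext f
    induction f using Sym2.ind with
    | _ x y =>
      have := l.swap_notMem hab
      simp only [mem_forget, Set.mem_union, Set.mem_sdiff, Set.mem_singleton_iff, Set.mem_insert_iff,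
        Prod.mk.injEq, Sym2.eq_iff]
      constructor
      · rintro ((⟨h1, h2⟩ | h1) | (⟨h1, h2⟩ | h1))
        · left; refine ⟨Or.inl h1, ?_⟩
          rintro (h3 | ⟨rfl, rfl⟩) <;> tauto
        · tauto
        · left; refine ⟨Or.inr h1, ?_⟩
          rintro (⟨rfl, rfl⟩ | ⟨rfl, rfl⟩) <;> tauto
        · tauto
      · rintro (⟨h1 | h1, h2⟩ | h1)
        all_goals tauto
  | refl => exact Relation.EqvGen.refl _
  | symm _ _ _ ih => exact ih.symm
  | trans _ _ _ _ _ ih ih' => exact ih.trans ih'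

theorem forget_insert (D : Set (Pt × Pt)) (a b : Pt) :
    forget (insert (a, b) D) = insert s(a, b) (forget D) := by
  simp [forget, Set.image_insert_eq]

/-- The new edges inherit the direction of the edge they replace. -/
theorem TriangleMove.lift_forward {E E' : Set (Sym2 Pt)} (h : TriangleMove E E')
    {D : Set (Pt × Pt)} (hD : IsOrientedLink D) (hDE : forget D = E) :
    ∃ D', IsOrientedLink D' ∧ forget D' = E' ∧ OrientedLinkEquiv D D' := by
  subst hDE
  obtain ⟨l, l', a, b, c, hab, hull, rfl⟩ := h
  -- If the edge is directed from `b` to `a`, the same move can be read with `a` and `b` exchanged.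
  wlog H : (a, b) ∈ D generalizing a b
  · have H' := (mem_forget.1 hab).resolve_left H
    have e : (forget D \ {s(a, b)}) ∪ {s(a, c), s(c, b)} =
        (forget D \ {s(b, a)}) ∪ {s(b, c), s(c, a)} := by
      rw [Sym2.eq_swap (a := a) (b := b), Sym2.eq_swap (a := a) (b := c),
        Sym2.eq_swap (a := c) (b := b), Set.pair_comm]
    rw [e] at l' ⊢
    exact this b a (Sym2.eq_swap ▸ hab) (by rw [convexHull_triple_swap, hull, segment_symm]) l' H'
  set F := D \ {(a, b)} with hF
  have hDF : insert (a, b) F = D := by rw [hF, Set.insert_sdiff_singleton, Set.insert_eq_of_mem H]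
  have hnF : (a, b) ∉ F := by simp [hF]
  have hsF : s(a, b) ∉ forget F := by
    rw [mem_forget]
    rintro (h | h)
    · exact hnF h
    · exact hD.swap_notMem H h.1
  have hfF : forget D \ {s(a, b)} = forget F := by
    rw [← hDF, forget_insert, Set.insert_sdiff_of_mem _ (Set.mem_singleton _),
      Set.sdiff_singleton_eq_self hsF]
  rw [hfF] at l' ⊢
  have hac : s(a, c) ∈ forget F ∪ {s(a, c), s(c, b)} := by simp
  have hcb : s(c, b) ∈ forget F ∪ {s(a, c), s(c, b)} := by simp
  have nac : a ≠ c := by simpa using l'.nondegenerate _ hac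
  have ncb : c ≠ b := by simpa using l'.nondegenerate _ hcb
  have nab : a ≠ b := hD.nondegenerate _ H
  have free : FreeTriangle F a b c := by
    refine ⟨?_, nab, nac.symm, ncb, ?_⟩
    · intro x y hxy p hp hp'
      have : p ∈ segment ℝ a b := hull ▸ ⟨hp', mem_carrier_forget.2 ⟨x, y, hxy.1, hp⟩⟩
      exact (hD.emb H hxy.1 (fun e => hnF (e ▸ hxy)) this hp).1
    · intro p hp hp'
      have := l'.embedded _ hac _ hcb (by rw [Ne, Sym2.eq_iff]; tauto) p
        ⟨by rwa [seg_mk], by rwa [seg_mk]⟩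
      simp only [Sym2.mem_iff] at this
      rcases this with ⟨rfl | h, h' | h'⟩
      all_goals first | assumption | exact absurd h' nab
  rw [← hDF] at hD ⊢
  have hD' := free.isOrientedLink_insert hD hnF
  refine ⟨_, hD', ?_, Relation.EqvGen.rel _ _ (free.orientedTriangleMove hD hD' hnF)⟩
  rw [forget_insert, forget_insert]
  ext f
  simp only [Set.mem_insert_iff, Set.mem_union, Set.mem_singleton_iff]
  tauto

/-- The tip has only its two edges, so an orientation must run straight through it, and the single
replacing edge gets a consistent direction. -/
theorem TriangleMove.lift_backward {E E' : Set (Sym2 Pt)} (h : TriangleMove E' E)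
    {D : Set (Pt × Pt)} (hD : IsOrientedLink D) (hDE : forget D = E) :
    ∃ D', IsOrientedLink D' ∧ forget D' = E' ∧ OrientedLinkEquiv D D' := by
  obtain ⟨l, l', a, b, c, hab, hull, hE⟩ := h
  subst hDE
  have hac : s(a, c) ∈ forget D := by rw [hE]; simp
  have hcb : s(c, b) ∈ forget D := by rw [hE]; simp
  have nac : a ≠ c := by simpa using l'.nondegenerate _ hac
  have ncb : c ≠ b := by simpa using l'.nondegenerate _ hcb
  have nab : a ≠ b := by simpa using l.nondegenerate _ hab
  have off : ∀ f ∈ E' \ {s(a, b)}, ∀ p ∈ seg f, p ∈ convexHull ℝ {a, b, c} → p = a ∨ p = b := by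
    intro f hf p hp hp'
    have : p ∈ segment ℝ a b := hull ▸ ⟨hp', Set.mem_biUnion hf.1 hp⟩
    have := (l.embedded _ hab f hf.1 (fun e => hf.2 e.symm) p ⟨by rwa [seg_mk], hp⟩).1
    simpa using this
  have cE : ∀ f ∈ E' \ {s(a, b)}, c ∉ f := by
    intro f hf hc
    rcases off f hf c (subset_convexHull ℝ _ hc)
      (segment_subset_hull_left a b c (right_mem_segment ℝ _ _)) with e | e
    · exact nac e.symm
    · exact ncb e
  have mem_c : ∀ x y, (x, y) ∈ D → c = x ∨ c = y → s(x, y) = s(a, c) ∨ s(x, y) = s(c, b) := by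
    intro x y hxy hc
    have : s(x, y) ∈ forget D := mem_forget.2 (Or.inl hxy)
    rw [hE] at this
    rcases this with h | h
    · exact absurd (by simpa using hc) (cE _ h)
    · simpa using h
  wlog H : (a, c) ∈ D generalizing a b
  · have H' := (mem_forget.1 hac).resolve_left H
    obtain ⟨x, hx⟩ := hD.exists_prev H'
    have hxb : (b, c) ∈ D := by
      rcases mem_c _ _ hx (Or.inr rfl) with e | e <;> rw [Sym2.eq_iff] at e
      · rcases e with ⟨rfl, -⟩ | ⟨rfl, -⟩
        · exact absurd hx H
        · exact absurd rfl (hD.nondegenerate _ hx)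
      · rcases e with ⟨rfl, -⟩ | ⟨rfl, -⟩
        · exact absurd rfl (hD.nondegenerate _ hx)
        · exact hx
    refine this b a (Sym2.eq_swap ▸ hab) (by rw [convexHull_triple_swap, hull, segment_symm]) ?_
      (Sym2.eq_swap ▸ hcb) (Sym2.eq_swap ▸ hac) ncb.symm nac.symm nab.symm ?_ ?_ ?_ hxb
    · rw [hE, Sym2.eq_swap (a := a) (b := b), Sym2.eq_swap (a := a) (b := c),
        Sym2.eq_swap (a := c) (b := b), Set.pair_comm]
    · intro f hf p hp hp'
      rw [Sym2.eq_swap] at hf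
      rw [convexHull_triple_swap] at hp'
      exact (off f hf p hp hp').symm
    · intro f hf
      rw [Sym2.eq_swap] at hf
      exact cE f hf
    · intro x y hxy hc
      have := mem_c x y hxy hc
      rw [Sym2.eq_swap (a := b) (b := c), Sym2.eq_swap (a := c) (b := a)]
      tauto
  -- The orientation arrives at `c` from `a`; the only other edge there leads to `b`.
  have Hcb : (c, b) ∈ D := by
    obtain ⟨x, hx⟩ := hD.exists_next H
    rcases mem_c _ _ hx (Or.inl rfl) with e | e <;> rw [Sym2.eq_iff] at e
    · rcases e with ⟨-, rfl⟩ | ⟨-, rfl⟩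
      · exact absurd rfl (hD.nondegenerate _ hx)
      · exact absurd hx (hD.swap_notMem H)
    · rcases e with ⟨-, rfl⟩ | ⟨-, rfl⟩
      · exact hx
      · exact absurd rfl (hD.nondegenerate _ hx)
  set F := D \ {(a, c), (c, b)} with hF
  have hDF : insert (a, c) (insert (c, b) F) = D := by
    ext f
    simp only [hF, Set.mem_insert_iff, Set.mem_sdiff, Set.mem_singleton_iff]
    by_cases h1 : f = (a, c)
    · simp [h1, H]
    · by_cases h2 : f = (c, b)
      · simp [h2, Hcb]
      · simp [h1, h2]
  have hfF : forget F = E' \ {s(a, b)} := by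
    have h1 : forget D = insert s(a, c) (insert s(c, b) (forget F)) := by
      rw [← hDF, forget_insert, forget_insert]
    have key : ∀ f, f ∈ forget F → f ≠ s(a, c) ∧ f ≠ s(c, b) := by
      intro f
      induction f using Sym2.ind with
      | _ x y =>
        rw [mem_forget, hF]
        have n1 := hD.swap_notMem H
        have n2 := hD.swap_notMem Hcb
        simp only [Set.mem_sdiff, Set.mem_insert_iff, Set.mem_singleton_iff, Prod.mk.injEq, Ne,
          Sym2.eq_iff]
        rintro (⟨h, h'⟩ | ⟨h, h'⟩)
        · constructor
          · rintro (⟨rfl, rfl⟩ | ⟨rfl, rfl⟩) <;> tauto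
          · rintro (⟨rfl, rfl⟩ | ⟨rfl, rfl⟩) <;> tauto
        · constructor
          · rintro (⟨rfl, rfl⟩ | ⟨rfl, rfl⟩) <;> tauto
          · rintro (⟨rfl, rfl⟩ | ⟨rfl, rfl⟩) <;> tauto
    ext f
    constructor
    · intro hf
      have : f ∈ forget D := by rw [h1]; exact Or.inr (Or.inr hf)
      rw [hE] at this
      rcases this with h | h
      · exact h
      · have := key f hf
        simp only [Set.mem_insert_iff, Set.mem_singleton_iff] at h
        tauto
    · intro hf
      have : f ∈ forget D := by rw [hE]; exact Or.inl hf
      rw [h1] at this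
      have hc := cE f hf
      rcases this with rfl | rfl | h
      · simp at hc
      · simp at hc
      · exact h
  have free : FreeTriangle F a b c := by
    refine ⟨?_, nab, nac.symm, ncb, ?_⟩
    · intro x y hxy p hp hp'
      exact off s(x, y) (hfF ▸ mem_forget.2 (Or.inl hxy)) p (by rwa [seg_mk]) hp'
    · intro p hp hp'
      have := hD.emb H Hcb (by simp [nac]) hp hp'
      rcases this with ⟨rfl | h, h' | h'⟩
      all_goals first | assumption | exact absurd h' nab
  rw [← hDF] at hD ⊢
  have hD' := free.isOrientedLink_remove hD
  refine ⟨_, hD', ?_, Relation.EqvGen.symm _ _ (Relation.EqvGen.rel _ _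
    (free.orientedTriangleMove hD' hD ?_))⟩
  · rw [forget_insert, hfF, Set.insert_sdiff_singleton, Set.insert_eq_of_mem hab]
  · intro h
    have : s(a, b) ∈ forget F := mem_forget.2 (Or.inl h)
    rw [hfF] at this
    exact this.2 rfl

/-- Both directions are proved together because the symmetric case of the induction exchanges them.
-/
theorem LinkEquiv.lift {E E' : Set (Sym2 Pt)} (h : LinkEquiv E E') :
    (∀ D : Set (Pt × Pt), IsOrientedLink D → forget D = E →
      ∃ D', IsOrientedLink D' ∧ forget D' = E' ∧ OrientedLinkEquiv D D') ∧
    (∀ D : Set (Pt × Pt), IsOrientedLink D → forget D = E' →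
      ∃ D', IsOrientedLink D' ∧ forget D' = E ∧ OrientedLinkEquiv D D') := by
  induction h with
  | rel E E' h =>
    exact ⟨fun D h1 h2 => h.lift_forward h1 h2, fun D h1 h2 => h.lift_backward h1 h2⟩
  | refl E => exact ⟨fun D h1 h2 => ⟨D, h1, h2, .refl D⟩, fun D h1 h2 => ⟨D, h1, h2, .refl D⟩⟩
  | symm _ _ _ ih => exact ih.symm
  | trans _ _ _ _ _ ih ih' =>
    constructor
    · intro D h1 h2
      obtain ⟨D', h3, h4, h5⟩ := ih.1 D h1 h2
      obtain ⟨D'', h6, h7, h8⟩ := ih'.1 D' h3 h4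
      exact ⟨D'', h6, h7, h5.trans h8⟩
    · intro D h1 h2
      obtain ⟨D', h3, h4, h5⟩ := ih'.2 D h1 h2
      obtain ⟨D'', h6, h7, h8⟩ := ih.2 D' h3 h4
      exact ⟨D'', h6, h7, h5.trans h8⟩

section Motion

/-! ## Moving the vertices of a link -/

theorem mem_hull_triple {a b c q : Pt} : q ∈ convexHull ℝ {a, b, c} ↔
    ∃ α β γ : ℝ, 0 ≤ α ∧ 0 ≤ β ∧ 0 ≤ γ ∧ α + β + γ = 1 ∧ q = α • a + β • b + γ • c := by
  rw [convexHull_insert (by simp), convexHull_pair]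
  simp only [mem_convexJoin, Set.mem_singleton_iff, exists_eq_left]
  constructor
  · rintro ⟨x, ⟨s, t, hs, ht, hst, rfl⟩, ⟨u, v, hu, hv, huv, rfl⟩⟩
    refine ⟨u, v * s, v * t, hu, by positivity, by positivity, ?_, by module⟩
    rw [add_assoc, ← mul_add, hst, mul_one, huv]
  · rintro ⟨α, β, γ, hα, hβ, hγ, h, rfl⟩
    -- If `β + γ = 0` the point is `a`, and the weights on `bc` cannot be normalised; any point of
    -- `bc` will do.
    rcases (add_nonneg hβ hγ).eq_or_lt with h0 | h0
    · have hb : β = 0 := by linarith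
      have hc : γ = 0 := by linarith
      subst hb hc
      exact ⟨b, left_mem_segment ℝ _ _, ⟨1, 0, by norm_num, by norm_num, by norm_num,
        by simp at h; subst h; module⟩⟩
    · refine ⟨_, ⟨β / (β + γ), γ / (β + γ), by positivity, by positivity, by field_simp, rfl⟩,
        ⟨α, β + γ, hα, h0.le, by linarith, ?_⟩⟩
      match_scalars <;> field_simp

/-- `z` does not lie in the affine span of `a`, `b`, `c`. -/
def Generic (z a b c : Pt) : Prop := ∀ α β γ : ℝ, α + β + γ = 1 → z ≠ α • a + β • b + γ • c

/-- The way genericity is used: when two barycentric expressions of one point are compared, the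
weights of `z` must agree. -/
theorem Generic.eq_zero {z a b c : Pt} (h : Generic z a b c) {α β γ δ : ℝ}
    (hs : α + β + γ + δ = 0) (h0 : α • a + β • b + γ • c + δ • z = 0) : δ = 0 := by
  by_contra hd
  refine h (-α / δ) (-β / δ) (-γ / δ) (by field_simp; linarith) ?_
  have : δ⁻¹ • (α • a + β • b + γ • c + δ • z) = 0 := by rw [h0, smul_zero]
  rw [← sub_eq_zero, ← this]
  match_scalars <;> field_simp

/-- Each triple spans a proper affine subspace, hence a null set, so the complement of the two is
dense. Two triples occur because one auxiliary point has to be generic for both ends of a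
displacement. -/
theorem exists_generic (a b c a' b' c' x : Pt) {ε : ℝ} (hε : 0 < ε) :
    ∃ z, dist z x < ε ∧ Generic z a b c ∧ Generic z a' b' c' := by
  have key : ∀ a b c : Pt,
      (MeasureTheory.Measure.addHaar : MeasureTheory.Measure Pt) (affineSpan ℝ {a, b, c} : Set Pt) = 0 := by
    intro a b c
    apply MeasureTheory.Measure.addHaar_affineSubspace
    intro h
    have h2 := (coplanar_iff_finrank_le_two.1 (coplanar_triple ℝ a b c))
    rw [← direction_affineSpan, h, AffineSubspace.direction_top, finrank_top] at h2
    simp at h2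
  have gen : ∀ z a b c : Pt, z ∉ affineSpan ℝ {a, b, c} → Generic z a b c := by
    intro z a b c hz α β γ h e
    apply hz
    have e' : z = β • (b - a) + (γ • (c - a) + a) := by
      rw [e]
      have : α = 1 - β - γ := by linarith
      subst this
      module
    rw [e']
    have ha : a ∈ affineSpan ℝ {a, b, c} := subset_affineSpan ℝ _ (by simp)
    have hb : b ∈ affineSpan ℝ {a, b, c} := subset_affineSpan ℝ _ (by simp)
    have hc : c ∈ affineSpan ℝ {a, b, c} := subset_affineSpan ℝ _ (by simp)
    exact (affineSpan ℝ {a, b, c}).smul_vsub_vadd_mem β hb ha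
      ((affineSpan ℝ {a, b, c}).smul_vsub_vadd_mem γ hc ha ha)
  have hn : (MeasureTheory.Measure.addHaar : MeasureTheory.Measure Pt)
      ((affineSpan ℝ {a, b, c} : Set Pt) ∪ affineSpan ℝ {a', b', c'}) = 0 :=
    MeasureTheory.measure_union_null (key a b c) (key a' b' c')
  have hd := MeasureTheory.Measure.interior_eq_empty_of_null hn
  rw [interior_eq_empty_iff_dense_compl] at hd
  obtain ⟨z, hz, hz'⟩ := hd.exists_dist_lt x hε
  rw [Set.mem_compl_iff, Set.mem_union, not_or] at hz
  exact ⟨z, by rwa [dist_comm], gen _ _ _ _ hz.1, gen _ _ _ _ hz.2⟩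

/-! ### Polygons with moving vertices -/

variable {V : Type*}

/-- The oriented polygons whose vertices have the positions `p`, in the cyclic orders given by the
permutation `σ`. -/
def poly (σ : Equiv.Perm V) (p : V → Pt) : Set (Pt × Pt) := Set.range fun v => (p v, p (σ v))

/-- The polygons `poly σ p` form an oriented link with distinct vertices. -/
structure IsGoodPosition (σ : Equiv.Perm V) (p : V → Pt) : Prop where
  inj : Function.Injective p
  link : IsOrientedLink (poly σ p)

namespace IsGoodPosition

variable {σ : Equiv.Perm V} {p : V → Pt}

theorem mk' [Finite V] (hp : Function.Injective p) (h1 : ∀ v, σ v ≠ v)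
    (h2 : ∀ v w, v ≠ w → ∀ x ∈ segment ℝ (p v) (p (σ v)), x ∈ segment ℝ (p w) (p (σ w)) →
      (x = p v ∨ x = p (σ v)) ∧ (x = p w ∨ x = p (σ w))) : IsGoodPosition σ p where
  inj := hp
  link := by
    apply IsOrientedLink.of_injective
    · exact Set.finite_range _
    · rintro _ _ ⟨v, ⟨⟩⟩ e
      exact h1 v (hp e).symm
    · rintro _ _ ⟨v, ⟨⟩⟩
      exact ⟨_, σ v, rfl⟩
    · rintro _ _ ⟨v, ⟨⟩⟩
      exact ⟨p (σ.symm v), σ.symm v, by simp⟩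
    · rintro _ _ _ ⟨v, ⟨⟩⟩ ⟨w, h⟩
      rw [Prod.mk.injEq] at h
      rw [← h.2, hp h.1]
    · rintro _ _ _ ⟨v, ⟨⟩⟩ ⟨w, h⟩
      rw [Prod.mk.injEq] at h
      rw [← h.1, σ.injective (hp h.2)]
    · rintro _ _ _ _ ⟨v, ⟨⟩⟩ ⟨w, ⟨⟩⟩ hne x hx hx'
      exact h2 v w (by rintro rfl; exact hne rfl) x hx hx'

theorem ne_self (h : IsGoodPosition σ p) (v : V) : σ v ≠ v := fun e =>
  h.link.nondegenerate _ ⟨v, rfl⟩ (by simp [e])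

theorem ne_self_two (h : IsGoodPosition σ p) (v : V) : σ (σ v) ≠ v := fun e =>
  h.link.swap_notMem ⟨v, rfl⟩ ⟨σ v, by simp [e]⟩

theorem emb (h : IsGoodPosition σ p) {v w : V} (hvw : v ≠ w) {x : Pt}
    (hx : x ∈ segment ℝ (p v) (p (σ v))) (hx' : x ∈ segment ℝ (p w) (p (σ w))) :
    (x = p v ∨ x = p (σ v)) ∧ (x = p w ∨ x = p (σ w)) :=
  h.link.emb ⟨v, rfl⟩ ⟨w, rfl⟩ (fun e => hvw (h.inj (congrArg Prod.fst e))) hx hx'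

end IsGoodPosition

open Filter Topology

/-- Disjointness is an open condition at every pair of parameters, and the square of parameters is
compact. -/
theorem eventually_disjoint_segments {p₀ : V → Pt} {a b c d : V}
    (h : ∀ x ∈ segment ℝ (p₀ a) (p₀ b), x ∉ segment ℝ (p₀ c) (p₀ d)) :
    ∀ᶠ p in 𝓝 p₀, ∀ x ∈ segment ℝ (p a) (p b), x ∉ segment ℝ (p c) (p d) := by
  have hK : IsCompact (Set.Icc (0 : ℝ) 1 ×ˢ Set.Icc (0 : ℝ) 1) := isCompact_Icc.prod isCompact_Icc
  have := hK.eventually_forall_of_forall_eventually (x₀ := p₀)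
    (P := fun p s => (1 - s.1) • p a + s.1 • p b ≠ (1 - s.2) • p c + s.2 • p d) ?_
  · filter_upwards [this] with p hp x hx hx'
    rw [segment_eq_image] at hx hx'
    obtain ⟨s, hs, rfl⟩ := hx
    obtain ⟨t, ht, e⟩ := hx'
    exact hp (s, t) ⟨hs, ht⟩ e.symm
  · rintro ⟨s, t⟩ ⟨hs, ht⟩
    have c1 : Continuous fun z : (V → Pt) × ℝ × ℝ => (1 - z.2.1) • z.1 a + z.2.1 • z.1 b := by
      fun_prop
    have c2 : Continuous fun z : (V → Pt) × ℝ × ℝ => (1 - z.2.2) • z.1 c + z.2.2 • z.1 d := by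
      fun_prop
    refine (isOpen_ne_fun c1 c2).mem_nhds ?_
    intro e
    refine h ((1 - s) • p₀ a + s • p₀ b) ?_ ?_
    · rw [segment_eq_image]; exact ⟨s, hs, rfl⟩
    · rw [segment_eq_image]; exact ⟨t, ht, e.symm⟩

/-- Segments leaving `b` meet elsewhere only if they point in the same direction, that is, if `(1 -
s)(a - b) = s(c - b)` for some `s` in `[0, 1]`. Stated this way the condition excludes the trivial
intersection at `b`, and compactness of the interval makes it open. -/
theorem eventually_adjacent_segments {p₀ : V → Pt} {a b c : V} (hab : p₀ a ≠ p₀ b)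
    (hcb : p₀ c ≠ p₀ b) (h : ∀ x ∈ segment ℝ (p₀ a) (p₀ b), x ∈ segment ℝ (p₀ b) (p₀ c) → x = p₀ b) :
    ∀ᶠ p in 𝓝 p₀, ∀ x ∈ segment ℝ (p a) (p b), x ∈ segment ℝ (p b) (p c) → x = p b := by
  have := (isCompact_Icc (a := (0 : ℝ)) (b := 1)).eventually_forall_of_forall_eventually (x₀ := p₀)
    (P := fun p s => (1 - s) • (p a - p b) ≠ s • (p c - p b)) ?_
  · filter_upwards [this] with p hp x hx hx'
    rw [segment_symm, segment_eq_image] at hx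
    rw [segment_eq_image] at hx'
    obtain ⟨s, hs, rfl⟩ := hx
    obtain ⟨t, ht, e⟩ := hx'
    have e' : s • (p a - p b) = t • (p c - p b) := by
      rw [← sub_eq_zero] at e ⊢
      rw [← neg_eq_zero, ← e]
      module
    rcases (add_nonneg hs.1 ht.1).eq_or_lt with h0 | h0
    · have : s = 0 := by linarith [hs.1, ht.1]
      subst this
      module
    -- Rescaling the two parameters to have sum one gives the forbidden coincidence.
    · refine absurd ?_ (hp (t / (s + t)) ⟨div_nonneg ht.1 h0.le, (div_le_one h0).2 (by linarith [hs.1])⟩)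
      have : (s + t)⁻¹ • (s • (p a - p b)) = (s + t)⁻¹ • (t • (p c - p b)) := by rw [e']
      rw [smul_smul, smul_smul] at this
      rw [show 1 - t / (s + t) = (s + t)⁻¹ * s by field_simp; ring, this]
      congr 1
      field_simp
  · intro s hs
    have c1 : Continuous fun z : (V → Pt) × ℝ => (1 - z.2) • (z.1 a - z.1 b) := by fun_prop
    have c2 : Continuous fun z : (V → Pt) × ℝ => z.2 • (z.1 c - z.1 b) := by fun_prop
    refine (isOpen_ne_fun c1 c2).mem_nhds ?_
    intro e
    simp only at e
    have h0 := h (p₀ b + (1 - s) • (p₀ a - p₀ b))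
      ⟨1 - s, s, by linarith [hs.2], hs.1, by ring, by module⟩
      (by rw [e]; exact ⟨1 - s, s, by linarith [hs.2], hs.1, by ring, by module⟩)
    rw [add_eq_left, smul_eq_zero, sub_eq_zero (a := p₀ a)] at h0
    rcases h0 with h0 | h0
    · rw [h0, zero_smul, eq_comm, smul_eq_zero, sub_eq_zero (a := p₀ c)] at e
      exact e.elim (fun e => by linarith) hcb
    · exact hab h0

/-- There are finitely many pairs of vertices and of edges, and each pair imposes an open condition;
adjacent edges need a separate condition because they do meet. -/
theorem IsGoodPosition.eventually [Finite V] {σ : Equiv.Perm V} {p₀ : V → Pt}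
    (h : IsGoodPosition σ p₀) : ∀ᶠ p in 𝓝 p₀, IsGoodPosition σ p := by
  have e1 : ∀ᶠ p : V → Pt in 𝓝 p₀, ∀ v w, v ≠ w → p v ≠ p w := by
    refine eventually_all.2 fun v => eventually_all.2 fun w => ?_
    by_cases hvw : v = w
    · simp [hvw]
    · have c1 : Continuous fun z : V → Pt => z v := by fun_prop
      have c2 : Continuous fun z : V → Pt => z w := by fun_prop
      filter_upwards [(isOpen_ne_fun c1 c2).mem_nhds (h.inj.ne hvw)] with p hp _
      exact hp
  have e2 : ∀ᶠ p : V → Pt in 𝓝 p₀, ∀ v w, v ≠ w → σ v ≠ w → σ w ≠ v →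
      ∀ x ∈ segment ℝ (p v) (p (σ v)), x ∉ segment ℝ (p w) (p (σ w)) := by
    refine eventually_all.2 fun v => eventually_all.2 fun w => ?_
    by_cases hc : v ≠ w ∧ σ v ≠ w ∧ σ w ≠ v
    · refine (eventually_disjoint_segments (p₀ := p₀) (a := v) (b := σ v) (c := w) (d := σ w)
        fun x hx hx' => ?_).mono fun p hp _ _ _ => hp
      have hn : σ v ≠ σ w := fun e => hc.1 (σ.injective e)
      rcases h.emb hc.1 hx hx' with ⟨rfl | rfl, e | e⟩
      · exact hc.1 (h.inj e)
      · exact hc.2.2 (h.inj e).symm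
      · exact hc.2.1 (h.inj e)
      · exact hn (h.inj e)
    · exact Eventually.of_forall fun p a b c => absurd ⟨a, b, c⟩ hc
  have e3 : ∀ᶠ p : V → Pt in 𝓝 p₀, ∀ v, ∀ x ∈ segment ℝ (p v) (p (σ v)),
      x ∈ segment ℝ (p (σ v)) (p (σ (σ v))) → x = p (σ v) := by
    refine eventually_all.2 fun v => eventually_adjacent_segments ?_ ?_ ?_
    · exact h.inj.ne (h.ne_self v).symm
    · exact h.inj.ne (h.ne_self (σ v))
    · intro x hx hx'
      rcases h.emb (h.ne_self v).symm hx hx' with ⟨h1 | h1, h2 | h2⟩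
      · exact absurd (h.inj (h1.symm.trans h2)).symm (h.ne_self v)
      · exact absurd (h.inj (h1.symm.trans h2)).symm (h.ne_self_two v)
      · exact h1
      · exact h1
  filter_upwards [e1, e2, e3] with p h1 h2 h3
  refine IsGoodPosition.mk' (fun v w e => by_contra fun hn => h1 v w hn e) h.ne_self ?_
  intro v w hvw x hx hx'
  by_cases c1 : σ v = w
  · subst c1
    rw [h3 v x hx hx']
    simp
  by_cases c2 : σ w = v
  · subst c2
    rw [h3 w x hx' hx]
    simp
  exact absurd hx' (h2 v w hvw c1 c2 x hx)

/-- Isolates the two edges at `v`, the only ones affected when `v` is displaced. -/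
theorem poly_eq_insert (σ : Equiv.Perm V) (p q : V → Pt) (v : V) (hq : ∀ x, x ≠ v → q x = p x)
    (hs : σ v ≠ v) :
    poly σ q = insert (p (σ.symm v), q v) (insert (q v, p (σ v))
      {e | ∃ x, x ≠ v ∧ σ x ≠ v ∧ e = (p x, p (σ x))}) := by
  have hu : σ.symm v ≠ v := fun e => hs (by rw [Equiv.symm_apply_eq] at e; exact e.symm)
  ext e
  simp only [poly, Set.mem_range, Set.mem_insert_iff, Set.mem_ofPred_eq]
  constructor
  · rintro ⟨x, rfl⟩
    by_cases hx : x = v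
    · subst hx
      rw [hq _ hs]
      simp
    by_cases hx' : σ x = v
    · subst hx'
      left
      simp [hq _ hx]
    · rw [hq _ hx, hq _ hx']
      exact Or.inr (Or.inr ⟨x, hx, hx', rfl⟩)
  · rintro (rfl | rfl | ⟨x, hx, hx', rfl⟩)
    · exact ⟨σ.symm v, by rw [hq _ hu]; simp⟩
    · exact ⟨v, by rw [hq _ hs]⟩
    · exact ⟨x, by rw [hq _ hx, hq _ hx']⟩

/-- Moving one vertex to a point in general position. -/
theorem move_generic_vertex [DecidableEq V] {σ : Equiv.Perm V} {p : V → Pt} {v : V} {z : Pt}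
    (hg : ∀ x ∈ segment ℝ (p v) z, IsGoodPosition σ (Function.update p v x))
    (hz : Generic z (p (σ.symm v)) (p v) (p (σ v))) :
    OrientedLinkEquiv (poly σ p) (poly σ (Function.update p v z)) := by
  have gp : IsGoodPosition σ p := by
    have := hg (p v) (left_mem_segment ℝ _ _)
    rwa [Function.update_eq_self] at this
  have gz := hg z (right_mem_segment ℝ _ _)
  have hs := gp.ne_self v
  have hu : σ.symm v ≠ v := fun e => hs (by rw [Equiv.symm_apply_eq] at e; exact e.symm)
  have huw : σ.symm v ≠ σ v := fun e => gp.ne_self_two v (by rw [← e]; simp)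
  have E1 := poly_eq_insert σ p p v (fun _ _ => rfl) hs
  have E2 := poly_eq_insert σ p (Function.update p v z) v
    (fun x hx => Function.update_of_ne hx _ _) hs
  rw [Function.update_self] at E2
  set F : Set (Pt × Pt) := {e | ∃ x, x ≠ v ∧ σ x ≠ v ∧ e = (p x, p (σ x))} with hF
  set u := σ.symm v with hu'
  set w := σ v with hw'
  have hσu : σ u = v := by simp [hu']
  have zne : ∀ x, x ≠ v → z ≠ p x := by
    intro x hx e
    have := gz.inj.ne hx
    rw [Function.update_self, Function.update_of_ne hx] at this
    exact this e.symm
  have nuv : p u ≠ p v := gp.inj.ne hu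
  have nwv : p w ≠ p v := gp.inj.ne hs
  have nuw : p u ≠ p w := gp.inj.ne huw
  have zv : z ≠ p v := fun e => hz 0 1 0 (by norm_num) (by rw [e]; module)
  -- The triangle is the union of the segments from the neighbour `p b` to the points `y` between `p
  -- v` and `z`. Each of these is an edge of the good position with `v` moved to `y`, so it avoids
  -- the fixed edges except at its ends.
  have offF : ∀ x y, (x, y) ∈ F → ∀ b, (b = u ∨ b = w) → ∀ q ∈ segment ℝ x y,
      q ∈ convexHull ℝ {p b, p v, z} → q = p b := by
    rintro _ _ ⟨x, hx, hx', ⟨⟩⟩ b hb q hq hq'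
    rw [convexHull_insert (by simp), convexHull_pair] at hq'
    simp only [mem_convexJoin, Set.mem_singleton_iff, exists_eq_left] at hq'
    obtain ⟨y, hy, hq'⟩ := hq'
    have gy := hg y hy
    have hbv : b ≠ v := by rcases hb with rfl | rfl <;> assumption
    have r : q = p b ∨ q = y → q = p x ∨ q = p (σ x) → q = p b := by
      rintro (h | rfl) h'
      · exact h
      · exfalso
        have n1 := gy.inj.ne hx
        have n2 := gy.inj.ne hx'
        rw [Function.update_self, Function.update_of_ne hx] at n1
        rw [Function.update_self, Function.update_of_ne hx'] at n2
        rcases h' with h' | h'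
        · exact n1 h'.symm
        · exact n2 h'.symm
    rcases hb with rfl | rfl
    · have := gy.emb (v := u) (w := x) (x := q) (by rintro rfl; exact hx' hσu)
        (by rw [hσu, Function.update_self, Function.update_of_ne hu]; exact hq')
        (by rw [Function.update_of_ne hx, Function.update_of_ne hx']; exact hq)
      rw [hσu, Function.update_self, Function.update_of_ne hu, Function.update_of_ne hx,
        Function.update_of_ne hx'] at this
      exact r this.1 this.2
    · have := gy.emb (v := v) (w := x) (x := q) (Ne.symm hx)
        (by rw [Function.update_self, Function.update_of_ne hs, segment_symm]; exact hq')
        (by rw [Function.update_of_ne hx, Function.update_of_ne hx']; exact hq)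
      rw [Function.update_self, Function.update_of_ne hs, Function.update_of_ne hx,
        Function.update_of_ne hx'] at this
      exact r this.1.symm this.2
  -- First move: the edge into `p v` takes a detour through `z`. Genericity keeps the triangle away
  -- from the edge that leaves `p v`.
  have f1 : FreeTriangle (insert (p v, p w) F) (p u) (p v) z := by
    refine ⟨?_, nuv, zne u hu, zv, ?_⟩
    · rintro x y (⟨⟨⟩⟩ | hxy) q hq hq'
      · obtain ⟨α, β, γ, h1, h2, h3, h4, rfl⟩ := mem_hull_triple.1 hq'
        obtain ⟨s, t, hs, ht, hst, e⟩ := hq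
        have := hz.eq_zero (α := α) (β := β - s) (γ := -t) (δ := γ) (by linarith)
          (by rw [← sub_eq_zero] at e; rw [← neg_eq_zero, ← e]; module)
        subst this
        refine ((gp.emb hu (x := α • p u + β • p v + (0 : ℝ) • z) ?_ ?_).1).imp id fun h => by rw [h, hσu]
        · rw [hσu]
          exact ⟨α, β, h1, h2, by linarith, by module⟩
        · exact ⟨s, t, hs, ht, hst, e⟩
      · exact Or.inl (offF x y hxy u (Or.inl rfl) q hq hq')
    · rintro _ ⟨s, t, h1, h2, h3, rfl⟩ ⟨s', t', h1', h2', h3', e⟩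
      have := hz.eq_zero (α := -s) (β := t') (γ := 0) (δ := s' - t) (by linarith)
          (by rw [← sub_eq_zero] at e; rw [← e]; module)
      have e1 : s' = t := by linarith
      have e2 : t' = s := by linarith
      subst e1 e2
      rw [add_comm, add_left_inj] at e
      rcases h1.eq_or_lt with h0 | h0
      · rw [← h0] at h3 ⊢
        rw [zero_add] at h3
        rw [h3]; module
      · exact absurd (smul_right_injective Pt h0.ne' e) nuv.symm
  -- Second move, applied backwards: the corner at `p v` between `z` and `p w` is cut off.
  have f2 : FreeTriangle (insert (p u, z) F) z (p w) (p v) := by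
    refine ⟨?_, zne w hs, zv.symm, nwv.symm, ?_⟩
    · rintro x y (⟨⟨⟩⟩ | hxy) q hq hq'
      · obtain ⟨α, β, γ, h1, h2, h3, h4, rfl⟩ := mem_hull_triple.1 hq'
        obtain ⟨s, t, hs', ht, hst, e⟩ := hq
        have := hz.eq_zero (α := -s) (β := γ) (γ := β) (δ := α - t) (by linarith)
          (by rw [← sub_eq_zero] at e; rw [← neg_eq_zero, ← e]; module)
        have e1 : α = t := by linarith
        subst e1
        have e3 : s = β + γ := by linarith
        rw [← sub_eq_zero] at e
        rcases hs'.eq_or_lt with h0 | h0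
        · left
          have hb : β = 0 := by linarith
          have hc : γ = 0 := by linarith
          have ha : α = 1 := by linarith
          rw [ha, hb, hc]; module
        · exfalso
          -- Solving the relation for `p u` puts this vertex on the edge from `p v` to `p w`, which
          -- is impossible in a link.
          have hmem : p u ∈ segment ℝ (p v) (p w) := by
            refine ⟨γ / s, β / s, by positivity, by positivity, by rw [← add_div, add_comm, ← e3, div_self h0.ne'], ?_⟩
            have : s⁻¹ • (s • p u + α • z - (α • z + β • p w + γ • p v)) = 0 := by rw [e, smul_zero]
            rw [← sub_eq_zero, ← neg_eq_zero, ← this]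
            match_scalars <;> field_simp
            ring
          have := (gp.emb hu (by rw [hσu]; exact left_mem_segment ℝ _ _) hmem).2
          rcases this with h | h
          · exact nuv h
          · exact nuw h
      · right
        refine offF x y hxy w (Or.inr rfl) q hq ?_
        convert hq' using 2
        ext; simp; tauto
    · rintro _ ⟨s, t, h1, h2, h3, rfl⟩ ⟨s', t', h1', h2', h3', e⟩
      have := hz.eq_zero (α := 0) (β := t - s') (γ := - t') (δ := s) (by linarith)
          (by rw [← sub_eq_zero] at e; rw [← neg_eq_zero, ← e]; module)
      subst this
      rw [zero_add] at h3
      rw [h3]; module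
  have nF : ∀ y, (p u, y) ∉ F := by
    rintro _ ⟨x, hx, hx', e⟩
    rw [Prod.mk.injEq] at e
    rw [← gp.inj e.1] at hx'
    exact hx' hσu
  have nF' : ∀ y, (y, p w) ∉ F := by
    rintro _ ⟨x, hx, hx', e⟩
    rw [Prod.mk.injEq] at e
    exact hx (σ.injective (gp.inj e.2)).symm
  have n1 : (p u, p v) ∉ insert (p v, p w) F := by
    rintro (e | e)
    · exact nuv (congrArg Prod.fst e)
    · exact nF _ e
  have n2 : (z, p w) ∉ insert (p u, z) F := by
    rintro (e | e)
    · exact zne u hu (congrArg Prod.fst e)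
    · exact nF' _ e
  have l1 := gp.link
  have l2 := gz.link
  rw [E1] at l1 ⊢
  rw [E2] at l2 ⊢
  have l3 := f1.isOrientedLink_insert l1 n1
  have m1 := f1.orientedTriangleMove l1 l3 n1
  rw [Set.insert_comm (p u, z)] at l2 ⊢
  have l4 := f2.isOrientedLink_insert l2 n2
  have m2 := f2.orientedTriangleMove l2 l4 n2
  have : insert (p u, z) (insert (z, p v) (insert (p v, p w) F)) =
      insert (z, p v) (insert (p v, p w) (insert (p u, z) F)) := by
    ext; simp only [Set.mem_insert_iff]; tauto
  rw [this] at m1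
  exact OrientedLinkEquiv.trans (Relation.EqvGen.rel _ _ m1) (Relation.EqvGen.rel _ _ m2).symm

theorem IsGoodPosition.eventually_equiv [Finite V] {σ : Equiv.Perm V} {p₀ : V → Pt}
    (h : IsGoodPosition σ p₀) : ∀ᶠ p in 𝓝 p₀, OrientedLinkEquiv (poly σ p₀) (poly σ p) := by
  classical
  have := Fintype.ofFinite V
  obtain ⟨ε, hε, H⟩ := Metric.eventually_nhds_iff.1 h.eventually
  have upd : ∀ r : V → Pt, dist r p₀ < ε → ∀ v x, dist x (p₀ v) < ε →
      dist (Function.update r v x) p₀ < ε := by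
    intro r hr v x hx
    rw [dist_pi_lt_iff hε] at hr ⊢
    intro w
    by_cases hw : w = v
    · subst hw; simpa using hx
    · rw [Function.update_of_ne hw]; exact hr w
  have step : ∀ r : V → Pt, dist r p₀ < ε → ∀ v z, dist z (p₀ v) < ε →
      OrientedLinkEquiv (poly σ r) (poly σ (Function.update r v z)) := by
    intro r hr v z hz
    have gr := H hr
    have hrv : dist (r v) (p₀ v) < ε := (dist_pi_lt_iff hε).1 hr v
    have hu : σ.symm v ≠ v := fun e => gr.ne_self v (by rw [Equiv.symm_apply_eq] at e; exact e.symm)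
    -- The displacement from `r v` to `z` need not be generic. Both ends are therefore moved to a
    -- common nearby point `z'` that is generic for both.
    obtain ⟨z', hz', g1, g2⟩ := exists_generic (r (σ.symm v)) (r v) (r (σ v)) (r (σ.symm v)) z (r (σ v))
      (r v) (ε := ε - dist (r v) (p₀ v)) (by linarith)
    have hz'' : dist z' (p₀ v) < ε := by
      linarith [dist_triangle z' (r v) (p₀ v)]
    have m1 := move_generic_vertex (σ := σ) (p := r) (v := v) (z := z') (fun x hx => H (upd r hr v x
      ((convex_ball (p₀ v) ε).segment_subset hrv hz'' hx))) g1
    have m2 := move_generic_vertex (σ := σ) (p := Function.update r v z) (v := v) (z := z')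
      (fun x hx => by
        rw [Function.update_self] at hx
        rw [Function.update_idem]
        exact H (upd r hr v x ((convex_ball (p₀ v) ε).segment_subset hz hz'' hx)))
      (by rwa [Function.update_self, Function.update_of_ne hu, Function.update_of_ne (gr.ne_self v)])
    rw [Function.update_idem] at m2
    exact m1.trans m2.symm
  refine Metric.eventually_nhds_iff.2 ⟨ε, hε, fun p hp => ?_⟩
  -- The vertices are moved one at a time; in the sup metric all intermediate positions stay in the
  -- ball.
  have ind : ∀ s : Finset V, OrientedLinkEquiv (poly σ p₀) (poly σ (s.piecewise p p₀)) := by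
    intro s
    induction s using Finset.induction_on with
    | empty => rw [Finset.piecewise_empty]; exact OrientedLinkEquiv.refl _
    | insert v s hv ih =>
      rw [Finset.piecewise_insert]
      refine ih.trans (step _ ?_ _ _ ((dist_pi_lt_iff hε).1 hp v))
      rw [dist_pi_lt_iff hε]
      intro w
      by_cases hw : w ∈ s
      · rw [Finset.piecewise_eq_of_mem _ _ _ hw]; exact (dist_pi_lt_iff hε).1 hp w
      · rw [Finset.piecewise_eq_of_notMem _ _ _ hw, dist_self]; exact hε
  simpa using ind Finset.univ

/-- Links that are joined by a continuous motion of the vertices through links are equivalent. -/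
theorem orientedLinkEquiv_of_motion [Finite V] (σ : Equiv.Perm V) (p : ℝ → V → Pt)
    (hc : ∀ v, ContinuousOn (fun t => p t v) (Set.Icc 0 1))
    (hg : ∀ t ∈ Set.Icc (0 : ℝ) 1, IsGoodPosition σ (p t)) :
    OrientedLinkEquiv (poly σ (p 0)) (poly σ (p 1)) := by
  have hc' : ContinuousOn p (Set.Icc 0 1) := continuousOn_pi.2 hc
  -- The equivalence class is locally constant in time, and the time interval is connected.
  refine (isPreconnected_Icc (a := (0 : ℝ)) (b := 1)).induction₂'
    (fun s t => OrientedLinkEquiv (poly σ (p s)) (poly σ (p t))) ?_ ?_ (by simp) (by simp)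
  · intro t ht
    filter_upwards [hc' t ht (hg t ht).eventually_equiv] with s hs
    exact ⟨hs, hs.symm⟩
  · intro x y z _ _ _ h1 h2
    exact h1.trans h2

end Motion

/-! ## Tent links

The columns of a diagram are drawn at or below the level of the markings, the rows as tents above
that level. -/

/-- Markings with the other marking of the same column, the other marking of the same row, the row,
and the set `S` of markings at which an orientation runs from the column into the row. -/
structure TentFrame (W R : Type) where
  κ : W → W
  π : W → W
  row : W → R
  S : W → Prop
  κ_κ : ∀ w, κ (κ w) = w
  row_eq_iff : ∀ w w', row w = row w' ↔ w' = w ∨ w' = π w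
  row_surj : ∀ r, ∃ w, row w = r
  S_κ : ∀ w, S (κ w) ↔ ¬ S w
  S_π : ∀ w, S (π w) ↔ ¬ S w

/-- The vertices of a tent link: at each marking, in the column below it, and on top of a row. -/
inductive TentVertex (W R : Type)
  | L (w : W)
  | M (w : W)
  | U (r : R)

namespace TentFrame

open TentVertex

variable {W R : Type} (f : TentFrame W R)

instance [Finite W] [Finite R] : Finite (TentVertex W R) := by
  refine Finite.of_injective (β := W ⊕ W ⊕ R)
    (fun v => match v with | L w => .inl w | M w => .inr (.inl w) | U r => .inr (.inr r)) ?_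
  intro v v' h
  cases v <;> cases v' <;> simp_all

theorem π_ne (w : W) : f.π w ≠ w := fun h => by
  have := f.S_π w
  rw [h] at this
  tauto

theorem κ_ne (w : W) : f.κ w ≠ w := fun h => by
  have := f.S_κ w
  rw [h] at this
  tauto

theorem row_π (w : W) : f.row (f.π w) = f.row w := ((f.row_eq_iff _ _).2 (Or.inr rfl)).symm

theorem π_π (w : W) : f.π (f.π w) = w := by
  rcases (f.row_eq_iff _ _).1 (f.row_π w) with h | h
  · exact absurd h.symm (f.π_ne w)
  · exact h.symm

theorem eq_of_row {w w' : W} (h : f.row w = f.row w') (hS : f.S w ↔ f.S w') : w = w' := by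
  rcases (f.row_eq_iff _ _).1 h with rfl | rfl
  · rfl
  · have := f.S_π w
    tauto

theorem exists_out (r : R) : ∃ w, f.row w = r ∧ ¬ f.S w := by
  obtain ⟨w, rfl⟩ := f.row_surj r
  by_cases h : f.S w
  · exact ⟨f.π w, f.row_π w, by rw [f.S_π]; tauto⟩
  · exact ⟨w, rfl, h⟩

theorem exists_inn (r : R) : ∃ w, f.row w = r ∧ f.S w := by
  obtain ⟨w, h, h'⟩ := f.exists_out r
  exact ⟨f.π w, by rw [f.row_π, h], by rwa [f.S_π]⟩

def out (r : R) : W := (f.exists_out r).choose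
def inn (r : R) : W := (f.exists_inn r).choose

theorem row_out (r : R) : f.row (f.out r) = r := (f.exists_out r).choose_spec.1
theorem not_S_out (r : R) : ¬ f.S (f.out r) := (f.exists_out r).choose_spec.2
theorem row_inn (r : R) : f.row (f.inn r) = r := (f.exists_inn r).choose_spec.1
theorem S_inn (r : R) : f.S (f.inn r) := (f.exists_inn r).choose_spec.2

theorem out_row {w : W} (h : ¬ f.S w) : f.out (f.row w) = w :=
  f.eq_of_row (f.row_out _) (by have := f.not_S_out (f.row w); tauto)

theorem inn_row {w : W} (h : f.S w) : f.inn (f.row w) = w :=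
  f.eq_of_row (f.row_inn _) (by have := f.S_inn (f.row w); tauto)

open Classical in
/-- The cyclic order of the vertices. -/
def perm : Equiv.Perm (TentVertex W R) where
  toFun v := match v with
    | L w => if f.S w then U (f.row w) else M w
    | M w => if f.S w then L w else M (f.κ w)
    | U r => L (f.out r)
  invFun v := match v with
    | L w => if f.S w then M w else U (f.row w)
    | M w => if f.S w then M (f.κ w) else L w
    | U r => L (f.inn r)
  left_inv v := by
    rcases v with w | w | r
    · by_cases h : f.S w
      · simp [h, f.inn_row]
      · simp [h]
    · by_cases h : f.S w
      · simp [h]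
      · simp [h, f.S_κ, f.κ_κ]
    · simp [f.not_S_out, f.row_out]
  right_inv v := by
    rcases v with w | w | r
    · by_cases h : f.S w
      · simp [h]
      · simp [h, f.out_row]
    · by_cases h : f.S w
      · simp [h, f.S_κ, f.κ_κ]
      · simp [h]
    · simp [f.S_inn, f.row_inn]

theorem perm_L_pos {w : W} (h : f.S w) : f.perm (L w) = U (f.row w) := if_pos h
theorem perm_L_neg {w : W} (h : ¬ f.S w) : f.perm (L w) = M w := if_neg h
theorem perm_M_pos {w : W} (h : f.S w) : f.perm (M w) = L w := if_pos h
theorem perm_M_neg {w : W} (h : ¬ f.S w) : f.perm (M w) = M (f.κ w) := if_neg h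
theorem perm_U (r : R) : f.perm (U r) = L (f.out r) := rfl

/-- The position of the vertices of a tent link. -/
def pos (L M : W → Pt) (U : R → Pt) : TentVertex W R → Pt
  | .L w => L w
  | .M w => M w
  | .U r => U r

variable {L M : W → Pt} {U : R → Pt}

theorem mem_poly {e : Pt × Pt} : e ∈ poly f.perm (pos L M U) ↔
    ∃ w, (f.S w ∧ (e = (M w, L w) ∨ e = (L w, U (f.row w)))) ∨
      (¬ f.S w ∧ (e = (U (f.row w), L w) ∨ e = (L w, M w) ∨ e = (M w, M (f.κ w)))) := by
  simp only [poly, Set.mem_range]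
  constructor
  · rintro ⟨w | w | r, rfl⟩
    · by_cases h : f.S w
      · exact ⟨w, Or.inl ⟨h, Or.inr (by rw [f.perm_L_pos h]; rfl)⟩⟩
      · exact ⟨w, Or.inr ⟨h, Or.inr (Or.inl (by rw [f.perm_L_neg h]; rfl))⟩⟩
    · by_cases h : f.S w
      · exact ⟨w, Or.inl ⟨h, Or.inl (by rw [f.perm_M_pos h]; rfl)⟩⟩
      · exact ⟨w, Or.inr ⟨h, Or.inr (Or.inr (by rw [f.perm_M_neg h]; rfl))⟩⟩
    · exact ⟨f.out r, Or.inr ⟨f.not_S_out r, Or.inl (by rw [f.perm_U, f.row_out]; rfl)⟩⟩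
  · rintro ⟨w, ⟨h, rfl | rfl⟩ | ⟨h, rfl | rfl | rfl⟩⟩
    · exact ⟨.M w, by rw [f.perm_M_pos h]; rfl⟩
    · exact ⟨.L w, by rw [f.perm_L_pos h]; rfl⟩
    · exact ⟨.U (f.row w), by rw [f.perm_U, f.out_row h]; rfl⟩
    · exact ⟨.L w, by rw [f.perm_L_neg h]; rfl⟩
    · exact ⟨.M w, by rw [f.perm_M_neg h]; rfl⟩

/-- Sufficient conditions for a tent link to be embedded. -/
structure Embedded (L M : W → Pt) (U : R → Pt) : Prop where
  inj : Function.Injective (pos L M U)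
  AA : ∀ w w' x, w ≠ w' → x ∈ segment ℝ (L w) (M w) → x ∉ segment ℝ (L w') (M w')
  AB : ∀ w w' x, x ∈ segment ℝ (L w) (M w) → x ∈ segment ℝ (L w') (U (f.row w')) → x = L w ∧ w = w'
  AK : ∀ w w' x, x ∈ segment ℝ (L w) (M w) → x ∈ segment ℝ (M w') (M (f.κ w')) →
    x = M w ∧ (w = w' ∨ w = f.κ w')
  BB : ∀ w w' x, w ≠ w' → x ∈ segment ℝ (L w) (U (f.row w)) →
    x ∈ segment ℝ (L w') (U (f.row w')) → x = U (f.row w) ∧ f.row w = f.row w'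
  BK : ∀ w w' x, x ∈ segment ℝ (L w) (U (f.row w)) → x ∉ segment ℝ (M w') (M (f.κ w'))
  KK : ∀ w w' x, w ≠ w' → w ≠ f.κ w' → x ∈ segment ℝ (M w) (M (f.κ w)) →
    x ∉ segment ℝ (M w') (M (f.κ w'))

/-- Up to direction an edge is a leg from `L` to `M`, a slope from `L` to an apex, or the bottom of
a column; these are the types `A`, `B`, `K` in the fields of `Embedded`. The orientation determines
which vertex is the start of the edge. -/
theorem edge_cases (L M : W → Pt) (U : R → Pt) (v : TentVertex W R) :
    let p := pos L M U
    (∃ w, segment ℝ (p v) (p (f.perm v)) = segment ℝ (L w) (M w) ∧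
      (∀ x, (x = p v ∨ x = p (f.perm v)) ↔ (x = L w ∨ x = M w)) ∧
      ((f.S w ∧ v = .M w) ∨ (¬ f.S w ∧ v = .L w))) ∨
    (∃ w, segment ℝ (p v) (p (f.perm v)) = segment ℝ (L w) (U (f.row w)) ∧
      (∀ x, (x = p v ∨ x = p (f.perm v)) ↔ (x = L w ∨ x = U (f.row w))) ∧
      ((f.S w ∧ v = .L w) ∨ (¬ f.S w ∧ v = .U (f.row w)))) ∨
    (∃ w, segment ℝ (p v) (p (f.perm v)) = segment ℝ (M w) (M (f.κ w)) ∧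
      (∀ x, (x = p v ∨ x = p (f.perm v)) ↔ (x = M w ∨ x = M (f.κ w))) ∧ ¬ f.S w ∧ v = .M w) := by
  intro p
  rcases v with w | w | r
  · by_cases h : f.S w
    · exact Or.inr (Or.inl ⟨w, by rw [f.perm_L_pos h]; rfl, by rw [f.perm_L_pos h]; exact fun x => Iff.rfl,
        Or.inl ⟨h, rfl⟩⟩)
    · exact Or.inl ⟨w, by rw [f.perm_L_neg h]; rfl, by rw [f.perm_L_neg h]; exact fun x => Iff.rfl,
        Or.inr ⟨h, rfl⟩⟩
  · by_cases h : f.S w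
    · exact Or.inl ⟨w, by rw [f.perm_M_pos h, segment_symm]; rfl,
        by rw [f.perm_M_pos h]; exact fun x => Or.comm, Or.inl ⟨h, rfl⟩⟩
    · exact Or.inr (Or.inr ⟨w, by rw [f.perm_M_neg h]; rfl,
        by rw [f.perm_M_neg h]; exact fun x => Iff.rfl, h, rfl⟩)
  · refine Or.inr (Or.inl ⟨f.out r, ?_, ?_, Or.inr ⟨f.not_S_out r, by rw [f.row_out]⟩⟩)
    · rw [f.perm_U, f.row_out, segment_symm]; rfl
    · rw [f.perm_U, f.row_out]; exact fun x => Or.comm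

theorem Embedded.isGoodPosition [Finite W] [Finite R] (h : f.Embedded L M U) :
    IsGoodPosition f.perm (pos L M U) := by
  refine IsGoodPosition.mk' h.inj ?_ ?_
  · rintro (w | w | r) e
    · by_cases hs : f.S w
      · simp [f.perm_L_pos hs] at e
      · simp [f.perm_L_neg hs] at e
    · by_cases hs : f.S w
      · simp [f.perm_M_pos hs] at e
      · rw [f.perm_M_neg hs, TentVertex.M.injEq] at e
        exact f.κ_ne w e
    · simp [f.perm_U] at e
  · intro v v' hvv x hx hx'
    rcases f.edge_cases L M U v with ⟨w, h1, h2, h3⟩ | ⟨w, h1, h2, h3⟩ | ⟨w, h1, h2, h3⟩ <;>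
    rcases f.edge_cases L M U v' with ⟨w', h1', h2', h3'⟩ | ⟨w', h1', h2', h3'⟩ | ⟨w', h1', h2', h3'⟩ <;>
    rw [h1] at hx <;> rw [h1'] at hx' <;> rw [h2, h2']
    · have hw : w ≠ w' := by
        rintro rfl
        apply hvv
        rcases h3 with ⟨s, rfl⟩ | ⟨s, rfl⟩ <;> rcases h3' with ⟨s', rfl⟩ | ⟨s', rfl⟩ <;> tauto
      exact absurd hx' (h.AA w w' x hw hx)
    · obtain ⟨rfl, rfl⟩ := h.AB w w' x hx hx'
      simp
    · obtain ⟨rfl, rfl | rfl⟩ := h.AK w w' x hx hx' <;> simp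
    · obtain ⟨rfl, rfl⟩ := h.AB w' w x hx' hx
      simp
    · have hw : w ≠ w' := by
        rintro rfl
        apply hvv
        rcases h3 with ⟨s, rfl⟩ | ⟨s, rfl⟩ <;> rcases h3' with ⟨s', rfl⟩ | ⟨s', rfl⟩ <;> tauto
      obtain ⟨rfl, e⟩ := h.BB w w' x hw hx hx'
      simp [e]
    · exact absurd hx' (h.BK w w' x hx)
    · obtain ⟨rfl, rfl | rfl⟩ := h.AK w' w x hx' hx <;> simp
    · exact absurd hx (h.BK w' w x hx')
    · refine absurd hx' (h.KK w w' x ?_ ?_ hx)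
      · rintro rfl
        exact hvv (h3.2.trans h3'.2.symm)
      · rintro rfl
        have := f.S_κ w'
        tauto

/-- The result of removing the tops of the rows in `P`. -/
theorem remove_tops [Finite W] [Finite R] (h : f.Embedded L M U) (P : R → Prop)
    (hA : ∀ w w' x, P (f.row w) → x ∈ convexHull ℝ {L w, L (f.π w), U (f.row w)} →
      x ∈ segment ℝ (L w') (M w') → x = L w ∨ x = L (f.π w))
    (hB : ∀ w w' x, P (f.row w) → f.row w ≠ f.row w' →
      x ∈ convexHull ℝ {L w, L (f.π w), U (f.row w)} →
      x ∈ segment ℝ (L w') (U (f.row w')) → x = L w ∨ x = L (f.π w))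
    (hK : ∀ w w' x, P (f.row w) → x ∈ convexHull ℝ {L w, L (f.π w), U (f.row w)} →
      x ∈ segment ℝ (M w') (M (f.κ w')) → x = L w ∨ x = L (f.π w))
    (hT : ∀ w w' x, P (f.row w) → P (f.row w') → f.row w ≠ f.row w' →
      x ∈ convexHull ℝ {L w, L (f.π w), U (f.row w)} →
      x ∈ convexHull ℝ {L w', L (f.π w'), U (f.row w')} → x = L w ∨ x = L (f.π w)) :
    ∃ D, IsOrientedLink D ∧ OrientedLinkEquiv (poly f.perm (pos L M U)) D ∧
      ∀ e, e ∈ D ↔ ∃ w, (f.S w ∧ (e = (M w, L w) ∨ (¬ P (f.row w) ∧ e = (L w, U (f.row w))) ∨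
          (P (f.row w) ∧ e = (L w, L (f.π w))))) ∨
        (¬ f.S w ∧ ((¬ P (f.row w) ∧ e = (U (f.row w), L w)) ∨ e = (L w, M w) ∨
          e = (M w, M (f.κ w)))) := by
  classical
  have := Fintype.ofFinite W
  have g := h.isGoodPosition
  have L_ne : ∀ {w w'}, w ≠ w' → L w ≠ L w' := fun hn e => by
    have := h.inj (a₁ := .L _) (a₂ := .L _) e
    simp at this; exact hn this
  have L_U : ∀ w r, L w ≠ U r := fun w r e => by
    have := h.inj (a₁ := .L _) (a₂ := .U _) e
    simp at this
  have M_U : ∀ w r, M w ≠ U r := fun w r e => by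
    have := h.inj (a₁ := .M _) (a₂ := .U _) e
    simp at this
  have U_inj : ∀ {r r'}, U r = U r' → r = r' := fun e => by
    have := h.inj (a₁ := .U _) (a₂ := .U _) e
    simpa using this
  -- Among the two markings of a row exactly one satisfies `S`, so these markings index every
  -- triangle once, directed along the orientation.
  have off : ∀ w ∈ (Finset.univ.filter fun w => f.S w ∧ P (f.row w)), ∀ x y,
      (x, y) ∈ poly f.perm (pos L M U) → (x, y) ≠ (L w, U (f.row w)) →
      (x, y) ≠ (U (f.row w), L (f.π w)) → ∀ p ∈ segment ℝ x y,
      p ∈ convexHull ℝ {L w, L (f.π w), U (f.row w)} → p = L w ∨ p = L (f.π w) := by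
    intro w hw x y hxy n1 n2 q hq hq'
    have hp := (Finset.mem_filter.1 hw).2
    obtain ⟨w', ⟨hs, e | e⟩ | ⟨hs, e | e | e⟩⟩ := f.mem_poly.1 hxy <;>
      obtain ⟨rfl, rfl⟩ := Prod.mk.inj e
    · exact hA w w' q hp.2 hq' (by rwa [segment_symm])
    · refine hB w w' q hp.2 ?_ hq' hq
      intro e
      rw [f.eq_of_row e (by tauto)] at n1
      exact n1 rfl
    · refine hB w w' q hp.2 ?_ hq' (by rwa [segment_symm])
      intro e
      rcases (f.row_eq_iff _ _).1 e with rfl | rfl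
      · exact hs hp.1
      · rw [f.row_π] at n2
        exact n2 rfl
    · exact hA w w' q hp.2 hq' hq
    · exact hK w w' q hp.2 hq' hq
  have disj : ∀ w ∈ (Finset.univ.filter fun w => f.S w ∧ P (f.row w)),
      ∀ w' ∈ (Finset.univ.filter fun w => f.S w ∧ P (f.row w)), w ≠ w' →
      ∀ p ∈ convexHull ℝ {L w, L (f.π w), U (f.row w)},
      p ∈ convexHull ℝ {L w', L (f.π w'), U (f.row w')} → p = L w ∨ p = L (f.π w) := by
    intro w hw w' hw' hn x hx hx'
    have hp := (Finset.mem_filter.1 hw).2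
    have hp' := (Finset.mem_filter.1 hw').2
    exact hT w w' x hp.2 hp'.2 (fun e => hn (f.eq_of_row e (by tauto))) hx hx'
  obtain ⟨h1, h2⟩ := g.link.remove_tips L (fun w => L (f.π w)) (fun w => U (f.row w))
    (Finset.univ.filter fun w => f.S w ∧ P (f.row w))
    (fun w hw => f.mem_poly.2 ⟨w, Or.inl ⟨(Finset.mem_filter.1 hw).2.1, Or.inr rfl⟩⟩)
    (fun w hw => f.mem_poly.2 ⟨f.π w, Or.inr ⟨by
      rw [f.S_π, not_not]; exact (Finset.mem_filter.1 hw).2.1, Or.inl (by rw [f.row_π])⟩⟩)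
    (fun w _ => L_ne (f.π_ne w).symm) off disj
  refine ⟨_, h1, h2, fun e => ?_⟩
  simp only [Set.mem_union, Set.mem_ofPred_eq, mem_poly, Finset.mem_filter, Finset.mem_univ,
    true_and]
  constructor
  · rintro (⟨⟨w, ⟨hs, rfl | rfl⟩ | ⟨hs, rfl | rfl | rfl⟩⟩, hn⟩ | ⟨w, ⟨hs, hp⟩, rfl⟩)
    · exact ⟨w, by tauto⟩
    · refine ⟨w, Or.inl ⟨hs, Or.inr (Or.inl ⟨fun hp => ?_, rfl⟩)⟩⟩
      exact (hn w ⟨hs, hp⟩).1 rfl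
    · refine ⟨w, Or.inr ⟨hs, Or.inl ⟨fun hp => ?_, rfl⟩⟩⟩
      exact (hn (f.π w) ⟨by rwa [f.S_π], by rwa [f.row_π]⟩).2 (by rw [f.row_π, f.π_π])
    · exact ⟨w, by tauto⟩
    · exact ⟨w, by tauto⟩
    · exact ⟨w, by tauto⟩
  · rintro ⟨w, ⟨hs, rfl | ⟨hp, rfl⟩ | ⟨hp, rfl⟩⟩ | ⟨hs, ⟨hp, rfl⟩ | rfl | rfl⟩⟩
    · refine Or.inl ⟨⟨w, by tauto⟩, fun w' _ => ⟨?_, ?_⟩⟩ <;> rw [Ne, Prod.mk.injEq]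
      · exact fun e => L_U _ _ e.2
      · exact fun e => M_U _ _ e.1
    · refine Or.inl ⟨⟨w, by tauto⟩, fun w' hw' => ⟨?_, ?_⟩⟩ <;> rw [Ne, Prod.mk.injEq]
      · exact fun e => hp (U_inj e.2 ▸ hw'.2)
      · exact fun e => L_U _ _ e.1
    · exact Or.inr ⟨w, ⟨hs, hp⟩, rfl⟩
    · refine Or.inl ⟨⟨w, by tauto⟩, fun w' hw' => ⟨?_, ?_⟩⟩ <;> rw [Ne, Prod.mk.injEq]
      · exact fun e => L_U _ _ e.2
      · exact fun e => hp (U_inj e.1 ▸ hw'.2)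
    · refine Or.inl ⟨⟨w, by tauto⟩, fun w' _ => ⟨?_, ?_⟩⟩ <;> rw [Ne, Prod.mk.injEq]
      · exact fun e => M_U _ _ e.2
      · exact fun e => L_U _ _ e.1
    · refine Or.inl ⟨⟨w, by tauto⟩, fun w' _ => ⟨?_, ?_⟩⟩ <;> rw [Ne, Prod.mk.injEq]
      · exact fun e => M_U _ _ e.2
      · exact fun e => M_U _ _ e.1

end TentFrame

/-! ## Two families of embedded tent links -/

theorem exists_of_mem_segment {a b x : Pt} (h : x ∈ segment ℝ a b) : ∃ t : ℝ, 0 ≤ t ∧ t ≤ 1 ∧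
    x.1 = (1 - t) * a.1 + t * b.1 ∧ x.2.1 = (1 - t) * a.2.1 + t * b.2.1 ∧
    x.2.2 = (1 - t) * a.2.2 + t * b.2.2 := by
  rw [segment_eq_image] at h
  obtain ⟨t, ht, rfl⟩ := h
  exact ⟨t, ht.1, ht.2, by simp, by simp, by simp⟩

theorem lerp_le {a b c t : ℝ} (h0 : 0 ≤ t) (h1 : t ≤ 1) (ha : a ≤ c) (hb : b ≤ c) :
    (1 - t) * a + t * b ≤ c := by nlinarith

theorem le_lerp {a b c t : ℝ} (h0 : 0 ≤ t) (h1 : t ≤ 1) (ha : c ≤ a) (hb : c ≤ b) :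
    c ≤ (1 - t) * a + t * b := by nlinarith

theorem lerp_lt {a b c t : ℝ} (h0 : 0 ≤ t) (h1 : t ≤ 1) (ha : a < c) (hb : b < c) :
    (1 - t) * a + t * b < c := by
  rcases h0.eq_or_lt with rfl | h
  · linarith
  · nlinarith

theorem lt_lerp {a b c t : ℝ} (h0 : 0 ≤ t) (h1 : t ≤ 1) (ha : c < a) (hb : c < b) :
    c < (1 - t) * a + t * b := by
  rcases h0.eq_or_lt with rfl | h
  · linarith
  · nlinarith

theorem lerp_lt_lerp {a b a' b' t : ℝ} (h0 : 0 ≤ t) (h1 : t ≤ 1) (ha : a < a') (hb : b < b') :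
    (1 - t) * a + t * b < (1 - t) * a' + t * b' := by
  have := lt_lerp (c := 0) h0 h1 (sub_pos.2 ha) (sub_pos.2 hb)
  linarith

theorem lerp_lt_lerp_of_lt {a b a' b' t : ℝ} (h0 : 0 ≤ t) (h1 : t < 1) (ha : a < a') (hb : b ≤ b') :
    (1 - t) * a + t * b < (1 - t) * a' + t * b' := by
  nlinarith

open TentVertex in
/-- Tent links whose rows lie in disjoint horizontal bands and whose columns lie in different
planes. -/
theorem TentFrame.embedded_of_bands {W R : Type} (f : TentFrame W R) (X y μ ζ : W → ℝ)
    (ξ η Y : R → ℝ) (hX : ∀ w w', X w = X w' → w' = w ∨ w' = f.κ w)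
    (hXκ : ∀ w, X (f.κ w) = X w) (hXπ : ∀ w, X (f.π w) ≠ X w) (hζ : ∀ w, ζ w < 1)
    (hζκ : ∀ w, ζ (f.κ w) = ζ w) (hy : ∀ w, y w ≠ y (f.κ w))
    (hμ : ∀ w, y w < y (f.κ w) → μ w < μ (f.κ w))
    (hyY : ∀ w, |y w - Y (f.row w)| < 1 / 2) (hηY : ∀ r, |η r - Y r| < 1 / 2)
    (hY : ∀ r r', r ≠ r' → 1 ≤ |Y r - Y r'|) :
    f.Embedded (fun w => (X w, y w, 1)) (fun w => (X w, μ w, ζ w)) (fun r => (ξ r, η r, 2)) := by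
  -- The legs of one column lie in one plane and are at equal heights at equal times; they stay
  -- apart because their vertical order is the same at both ends.
  have hyκ : ∀ w t, 0 ≤ t → t ≤ 1 → (1 - t) * y w + t * μ w ≠ (1 - t) * y (f.κ w) + t * μ (f.κ w) := by
    intro w t h0 h1
    rcases (hy w).lt_or_gt with h | h
    · exact (lerp_lt_lerp h0 h1 h (hμ w h)).ne
    · have := hμ (f.κ w) (by rwa [f.κ_κ])
      rw [f.κ_κ] at this
      exact (lerp_lt_lerp h0 h1 h this).ne'
  have band : ∀ w t, 0 ≤ t → t ≤ 1 →
      |(1 - t) * y w + t * η (f.row w) - Y (f.row w)| < 1 / 2 := by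
    intro w t h0 h1
    have a1 := abs_lt.1 (hyY w)
    have a2 := abs_lt.1 (hηY (f.row w))
    rw [abs_lt]
    have := lerp_lt (c := Y (f.row w) + 1 / 2) h0 h1 (by linarith [a1.2] : y w < _)
      (by linarith [a2.2] : η (f.row w) < _)
    have := lt_lerp (c := Y (f.row w) - 1 / 2) h0 h1 (by linarith [a1.1] : _ < y w)
      (by linarith [a2.1] : _ < η (f.row w))
    constructor <;> linarith
  -- Bands of radius `1/2` about centres at distance at least `1` are disjoint, so the vertical
  -- coordinate of a point on a slope determines the row.
  have rows : ∀ w w' t t', 0 ≤ t → t ≤ 1 → 0 ≤ t' → t' ≤ 1 →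
      (1 - t) * y w + t * η (f.row w) = (1 - t') * y w' + t' * η (f.row w') → f.row w = f.row w' := by
    intro w w' t t' h0 h1 h0' h1' e
    by_contra hn
    have a1 := abs_lt.1 (band w t h0 h1)
    have a2 := abs_lt.1 (band w' t' h0' h1')
    rcases le_abs.1 (hY _ _ hn) with h | h <;> linarith [a1.1, a1.2, a2.1, a2.2]
  have inj : ∀ {w w'}, X w = X w' → y w = y w' → w = w' := by
    intro w w' h1 h2
    rcases hX w w' h1 with rfl | rfl
    · rfl
    · exact absurd h2 (hy w)
  constructor
  · intro v v' h
    rcases v with w | w | r <;> rcases v' with w' | w' | r' <;>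
      simp only [TentFrame.pos, Prod.mk.injEq] at h
    · rw [inj h.1 h.2.1]
    · exact absurd h.2.2.symm (hζ w').ne
    · norm_num at h
    · exact absurd h.2.2 (hζ w).ne
    · congr 1
      rcases hX w w' h.1 with rfl | rfl
      · rfl
      · have := hyκ w 1 zero_le_one le_rfl
        rw [h.2.1] at this
        simp at this
    · have := hζ w; linarith [h.2.2]
    · norm_num at h
    · have := hζ w'; linarith [h.2.2]
    · congr 1
      obtain ⟨w, rfl⟩ := f.row_surj r
      obtain ⟨w', rfl⟩ := f.row_surj r'
      exact rows w w' 1 1 zero_le_one le_rfl zero_le_one le_rfl (by rw [h.2.1]; ring)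
  · intro w w' x hn hx hx'
    obtain ⟨t, h0, h1, e1, e2, e3⟩ := exists_of_mem_segment hx
    obtain ⟨t', h0', h1', e1', e2', e3'⟩ := exists_of_mem_segment hx'
    simp only at e1 e2 e3 e1' e2' e3'
    rcases hX w w' (by linarith) with rfl | rfl
    · exact hn rfl
    · rw [hζκ] at e3'
      have : t = t' := by
        have : (t - t') * (1 - ζ w) = 0 := by linarith
        rcases mul_eq_zero.1 this with h | h
        · linarith
        · linarith [hζ w]
      subst this
      exact hyκ w t h0 h1 (by linarith)
  · intro w w' x hx hx'
    obtain ⟨t, h0, h1, e1, e2, e3⟩ := exists_of_mem_segment hx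
    obtain ⟨t', h0', h1', e1', e2', e3'⟩ := exists_of_mem_segment hx'
    simp only at e1 e2 e3 e1' e2' e3'
    -- Legs descend from level `1` and slopes rise from it, so both parameters vanish.
    have a : t = 0 := by
      by_contra hne
      have : 0 < t := lt_of_le_of_ne h0 (Ne.symm hne)
      nlinarith [hζ w]
    have b : t' = 0 := by subst a; linarith
    subst a b
    have xL : x = (X w, y w, 1) := by
      ext <;> simp only <;> linarith
    exact ⟨xL, inj (by linarith) (by linarith)⟩
  · intro w w' x hx hx'
    obtain ⟨t, h0, h1, e1, e2, e3⟩ := exists_of_mem_segment hx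
    obtain ⟨t', h0', h1', e1', e2', e3'⟩ := exists_of_mem_segment hx'
    simp only [hXκ, hζκ] at e1 e2 e3 e1' e2' e3'
    have hw := hX w' w (by linarith)
    have hz : ζ w = ζ w' := by rcases hw with rfl | rfl; exacts [rfl, hζκ _]
    have a : t = 1 := by
      have : (1 - t) * (1 - ζ w) = 0 := by rw [hz] at e3 ⊢; linarith
      rcases mul_eq_zero.1 this with h | h
      · linarith
      · linarith [hζ w]
    subst a
    exact ⟨by ext <;> simp only <;> linarith, hw⟩
  · intro w w' x hn hx hx'
    obtain ⟨t, h0, h1, e1, e2, e3⟩ := exists_of_mem_segment hx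
    obtain ⟨t', h0', h1', e1', e2', e3'⟩ := exists_of_mem_segment hx'
    simp only at e1 e2 e3 e1' e2' e3'
    have : t = t' := by linarith
    subst this
    have hr := rows w w' t t h0 h1 h0 h1 (by linarith)
    have hw : w' = f.π w := ((f.row_eq_iff _ _).1 hr).resolve_left (Ne.symm hn)
    rw [← hr] at e1' e2'
    have a : t = 1 := by
      have : (1 - t) * (X (f.π w) - X w) = 0 := by rw [← hw]; linarith
      rcases mul_eq_zero.1 this with h | h
      · linarith
      · exact absurd (sub_eq_zero.1 h) (hXπ w)
    subst a
    exact ⟨by ext <;> simp only <;> linarith, hr⟩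
  · intro w w' x hx hx'
    obtain ⟨t, h0, h1, e1, e2, e3⟩ := exists_of_mem_segment hx
    obtain ⟨t', h0', h1', e1', e2', e3'⟩ := exists_of_mem_segment hx'
    simp only [hζκ] at e3 e3'
    linarith [hζ w']
  · intro w w' x n1 n2 hx hx'
    obtain ⟨t, h0, h1, e1, e2, e3⟩ := exists_of_mem_segment hx
    obtain ⟨t', h0', h1', e1', e2', e3'⟩ := exists_of_mem_segment hx'
    simp only [hXκ] at e1 e1'
    rcases hX w' w (by linarith) with rfl | rfl
    · exact n1 rfl
    · exact n2 rfl

/-- Tent links whose columns project to disjoint graphs over the vertical axis. -/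
theorem TentFrame.embedded_of_planar {W R : Type} (f : TentFrame W R) (side : W → Bool) (col : W → ℕ)
    (x y : W → ℝ) (μ : Bool → ℝ) (ξ η : R → ℝ) (ℓ : ℝ) (hℓ : 0 ≤ ℓ) (hμ : μ false < μ true)
    (hside : ∀ w, side (f.κ w) = !side w) (hcκ : ∀ w, col (f.κ w) = col w)
    (hcol : ∀ w w', col w = col w' → w' = w ∨ w' = f.κ w)
    (hx : ∀ w w', side w = side w' → col w < col w' → x w < x w')
    (ht : ∀ w, side w = true → μ true < y w ∧ μ true < η (f.row w))
    (hb : ∀ w, side w = false → y w < μ false ∧ η (f.row w) < μ false)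
    (sep : ∀ w w', w ≠ w' → side w = side w' → ∀ s, 0 ≤ s → s ≤ 1 →
      (1 - s) * x w + s * ξ (f.row w) = (1 - s) * x w' + s * ξ (f.row w') →
      (1 - s) * y w + s * η (f.row w) = (1 - s) * y w' + s * η (f.row w') →
      s = 1 ∧ f.row w = f.row w') :
    f.Embedded (fun w => (x w, y w, ℓ)) (fun w => (x w, μ (side w), 0))
      (fun r => (ξ r, η r, ℓ + 1)) := by
  have xinj : ∀ {w w'}, side w = side w' → x w = x w' → w = w' := by
    intro w w' h1 h2
    rcases lt_trichotomy (col w) (col w') with h | h | h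
    · exact absurd h2 (hx w w' h1 h).ne
    · rcases hcol w w' h with rfl | rfl
      · rfl
      · rw [hside] at h1; simp at h1
    · exact absurd h2 (hx w' w h1.symm h).ne'
  -- Upper legs stay at or above `μ true`, lower ones at or below `μ false`.
  have ysep : ∀ w w' t t', 0 ≤ t → t ≤ 1 → 0 ≤ t' → t' ≤ 1 →
      (1 - t) * y w + t * μ (side w) = (1 - t') * y w' + t' * μ (side w') → side w = side w' := by
    intro w w' t t' h0 h1 h0' h1' e
    rcases hs : side w <;> rcases hs' : side w'
    · rfl
    · rw [hs, hs'] at e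
      linarith [lerp_le h0 h1 (hb w hs).1.le le_rfl, le_lerp h0' h1' (ht w' hs').1.le le_rfl]
    · rw [hs, hs'] at e
      linarith [lerp_le h0' h1' (hb w' hs').1.le le_rfl, le_lerp h0 h1 (ht w hs).1.le le_rfl]
    · rfl
  have rsep : ∀ w w' t t', 0 ≤ t → t ≤ 1 → 0 ≤ t' → t' ≤ 1 →
      (1 - t) * y w + t * η (f.row w) = (1 - t') * y w' + t' * η (f.row w') → side w = side w' := by
    intro w w' t t' h0 h1 h0' h1' e
    rcases hs : side w <;> rcases hs' : side w'
    · rfl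
    · linarith [lerp_lt h0 h1 (hb w hs).1 (hb w hs).2, lt_lerp h0' h1' (ht w' hs').1 (ht w' hs').2]
    · linarith [lerp_lt h0' h1' (hb w' hs').1 (hb w' hs').2, lt_lerp h0 h1 (ht w hs).1 (ht w hs).2]
    · rfl
  have yne : ∀ w, y w ≠ μ (side w) := by
    intro w
    rcases hs : side w
    · exact (hb w hs).1.ne
    · exact (ht w hs).1.ne'
  have mid : ∀ w t, 0 ≤ t → t ≤ 1 → (1 - t) * μ (side w) + t * μ (side (f.κ w)) ≤ μ true ∧
      μ false ≤ (1 - t) * μ (side w) + t * μ (side (f.κ w)) := by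
    intro w t h0 h1
    rw [hside]
    rcases hs : side w
    · exact ⟨lerp_le h0 h1 hμ.le le_rfl, le_lerp h0 h1 le_rfl hμ.le⟩
    · exact ⟨lerp_le h0 h1 le_rfl hμ.le, le_lerp h0 h1 hμ.le le_rfl⟩
  have κflip : ∀ {w w'}, side w = side w' ↔ side (f.κ w) = side (f.κ w') := by
    intro w w'
    rw [hside, hside]
    simp
  constructor
  · intro v v' h
    rcases v with w | w | r <;> rcases v' with w' | w' | r' <;>
      simp only [TentFrame.pos, Prod.mk.injEq] at h
    · rw [xinj (ysep w w' 0 0 le_rfl zero_le_one le_rfl zero_le_one (by linarith [h.2.1])) h.1]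
    · have hs := ysep w w' 0 1 le_rfl zero_le_one zero_le_one le_rfl (by linarith [h.2.1])
      rw [← hs] at h
      exact absurd h.2.1 (yne w)
    · linarith [h.2.2]
    · have hs := ysep w w' 1 0 zero_le_one le_rfl le_rfl zero_le_one (by linarith [h.2.1])
      rw [hs] at h
      exact absurd h.2.1.symm (yne w')
    · rw [xinj (ysep w w' 1 1 zero_le_one le_rfl zero_le_one le_rfl (by linarith [h.2.1])) h.1]
    · linarith [h.2.2]
    · linarith [h.2.2]
    · linarith [h.2.2]
    · congr 1
      obtain ⟨w, rfl⟩ := f.row_surj r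
      obtain ⟨w', rfl⟩ := f.row_surj r'
      by_cases hw : w = w'
      · rw [hw]
      exact (sep w w' hw (rsep w w' 1 1 zero_le_one le_rfl zero_le_one le_rfl
        (by linarith [h.2.1])) 1 zero_le_one le_rfl (by linarith [h.1]) (by linarith [h.2.1])).2
  · intro w w' p hn hp hp'
    obtain ⟨t, h0, h1, e1, e2, e3⟩ := exists_of_mem_segment hp
    obtain ⟨t', h0', h1', e1', e2', e3'⟩ := exists_of_mem_segment hp'
    simp only at e1 e2 e3 e1' e2' e3'
    exact hn (xinj (ysep w w' t t' h0 h1 h0' h1' (by linarith)) (by linarith))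
  · intro w w' p hp hp'
    obtain ⟨t, h0, h1, e1, e2, e3⟩ := exists_of_mem_segment hp
    obtain ⟨t', h0', h1', e1', e2', e3'⟩ := exists_of_mem_segment hp'
    simp only at e1 e2 e3 e1' e2' e3'
    have a : t' = 0 := by nlinarith
    subst a
    have hs := ysep w w' t 0 h0 h1 le_rfl zero_le_one (by linarith)
    have hw := xinj hs (by linarith)
    subst hw
    have b : t = 0 := by
      have : t * (y w - μ (side w)) = 0 := by linarith
      exact (mul_eq_zero.1 this).resolve_right (sub_ne_zero.2 (yne w))
    subst b
    exact ⟨by ext <;> simp only <;> linarith, rfl⟩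
  · intro w w' p hp hp'
    obtain ⟨t, h0, h1, e1, e2, e3⟩ := exists_of_mem_segment hp
    obtain ⟨t', h0', h1', e1', e2', e3'⟩ := exists_of_mem_segment hp'
    simp only at e1 e2 e3 e1' e2' e3'
    have b : t = 1 := by
      have m := mid w' t' h0' h1'
      have : (1 - t) * (y w - μ (side w)) = 0 := by
        rcases hs : side w
        · rw [hs] at e2
          nlinarith [mul_nonneg (sub_nonneg.2 h1) (sub_nonneg.2 (hb w hs).1.le)]
        · rw [hs] at e2
          nlinarith [mul_nonneg (sub_nonneg.2 h1) (sub_nonneg.2 (ht w hs).1.le)]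
      rcases mul_eq_zero.1 this with h | h
      · linarith
      · exact absurd (sub_eq_zero.1 h) (yne w)
    subst b
    refine ⟨by ext <;> simp only <;> linarith, ?_⟩
    by_cases hs : side w = side w'
    · left
      have : t' = 0 := by
        rw [hside, ← hs] at e2'
        have : t' * (μ (!side w) - μ (side w)) = 0 := by linarith
        refine (mul_eq_zero.1 this).resolve_right (sub_ne_zero.2 ?_)
        rcases side w
        · exact hμ.ne'
        · exact hμ.ne
      subst this
      exact xinj hs (by linarith)
    · right
      have hs' : side (f.κ w') = side w := (hside w').trans (Bool.eq_not.2 hs).symm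
      have : t' = 1 := by
        have h' : side w' = !side w := by rw [← hs', hside]; simp
        rw [hs', h'] at e2'
        have : (1 - t') * (μ (!side w) - μ (side w)) = 0 := by linarith
        have := (mul_eq_zero.1 this).resolve_right (sub_ne_zero.2 (by
          rcases side w
          · exact hμ.ne'
          · exact hμ.ne))
        linarith
      subst this
      exact xinj hs'.symm (by linarith)
  · intro w w' p hn hp hp'
    obtain ⟨t, h0, h1, e1, e2, e3⟩ := exists_of_mem_segment hp
    obtain ⟨t', h0', h1', e1', e2', e3'⟩ := exists_of_mem_segment hp'
    simp only at e1 e2 e3 e1' e2' e3'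
    have : t = t' := by linarith
    subst this
    obtain ⟨a, hr⟩ := sep w w' hn (rsep w w' t t h0 h1 h0 h1 (by linarith)) t h0 h1 (by linarith)
      (by linarith)
    subst a
    exact ⟨by ext <;> simp only <;> linarith, hr⟩
  · intro w w' p hp hp'
    obtain ⟨t, h0, h1, e1, e2, e3⟩ := exists_of_mem_segment hp
    obtain ⟨t', h0', h1', e1', e2', e3'⟩ := exists_of_mem_segment hp'
    simp only at e1 e2 e3 e1' e2' e3'
    have m := mid w' t' h0' h1'
    rcases hs : side w
    · linarith [lerp_lt h0 h1 (hb w hs).1 (hb w hs).2]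
    · linarith [lt_lerp h0 h1 (ht w hs).1 (ht w hs).2]
  · intro w w' p n1 n2 hp hp'
    obtain ⟨t, h0, h1, e1, e2, e3⟩ := exists_of_mem_segment hp
    obtain ⟨t', h0', h1', e1', e2', e3'⟩ := exists_of_mem_segment hp'
    simp only at e1 e2 e3 e1' e2' e3'
    -- The bottoms of two columns are in the same horizontal order at both ends, so they never
    -- coincide at equal parameters.
    have key : ∀ w w' t, 0 ≤ t → t ≤ 1 → side w = side w' → w ≠ w' →
        (1 - t) * x w + t * x (f.κ w) ≠ (1 - t) * x w' + t * x (f.κ w') := by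
      intro w w' t h0 h1 hs hn
      rcases lt_trichotomy (col w) (col w') with h | h | h
      · exact (lerp_lt_lerp h0 h1 (hx w w' hs h) (hx _ _ (κflip.1 hs) (by rwa [hcκ, hcκ]))).ne
      · rcases hcol w w' h with rfl | rfl
        · exact absurd rfl hn
        · rw [hside] at hs; simp at hs
      · exact (lerp_lt_lerp h0 h1 (hx w' w hs.symm h) (hx _ _ (κflip.1 hs.symm) (by rwa [hcκ, hcκ]))).ne'
    by_cases hs : side w = side w'
    · have : t = t' := by
        have hs' := κflip.1 hs
        rw [hs, hs', hside] at e2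
        rw [hside] at e2'
        have : (t - t') * (μ (!side w') - μ (side w')) = 0 := by linarith
        have := (mul_eq_zero.1 this).resolve_right (sub_ne_zero.2 (by
          rcases side w'
          · exact hμ.ne'
          · exact hμ.ne))
        linarith
      subst this
      exact key w w' t h0 h1 hs n1 (by linarith)
    · have hs' : side w = side (f.κ w') := ((hside w').trans (Bool.eq_not.2 hs).symm).symm
      have : t = 1 - t' := by
        have hs'' := κflip.1 hs'
        rw [f.κ_κ] at hs''
        rw [hs', hs''] at e2
        have h3 : side (f.κ w') = !side w' := hside w'
        rw [h3] at e2 e2'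
        have : (1 - t - t') * (μ (!side w') - μ (side w')) = 0 := by linarith
        have := (mul_eq_zero.1 this).resolve_right (sub_ne_zero.2 (by
          rcases side w'
          · exact hμ.ne'
          · exact hμ.ne))
        linarith
      refine key w (f.κ w') t h0 h1 hs' n2 ?_
      rw [f.κ_κ]
      subst this
      linarith

/-! ## Grid diagrams as tent links -/

/-- The upper and lower point at a marking. -/
def upt (p : ℕ × ℕ) : Pt := (p.1, p.2, 1)
def lpt (p : ℕ × ℕ) : Pt := (p.1, p.2, 0)

theorem upt_inj {p q : ℕ × ℕ} : upt p = upt q ↔ p = q := by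
  simp [upt, Prod.ext_iff]

theorem lpt_inj {p q : ℕ × ℕ} : lpt p = lpt q ↔ p = q := by
  simp [lpt, Prod.ext_iff]

theorem upt_ne_lpt (p q : ℕ × ℕ) : upt p ≠ lpt q := by
  simp [upt, lpt]

/-- `f` is a frame for the grid diagram `G`. -/
structure IsGridFrame {m : ℕ} {G : Set (ℕ × ℕ)} (f : TentFrame G (Set.Icc 1 m)) : Prop where
  row : ∀ w, (f.row w : ℕ) = w.1.2
  col : ∀ w w' : G, w.1.1 = w'.1.1 ↔ w' = w ∨ w' = f.κ w

/-- A function whose fibres have two elements pairs up its domain; applied to the column and to the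
row of a marking. -/
theorem exists_partner_of_ncard {W : Type} {α : Type} (g : W → α)
    (h : ∀ w, ({w' | g w' = g w} : Set W).ncard = 2) :
    ∃ κ : W → W, (∀ w, κ w ≠ w) ∧ ∀ w w', g w = g w' ↔ w' = w ∨ w' = κ w := by
  have : ∀ w, ∃ w', w' ≠ w ∧ ∀ w'', g w = g w'' ↔ w'' = w ∨ w'' = w' := by
    intro w
    obtain ⟨a, b, hab, e⟩ := Set.ncard_eq_two.1 (h w)
    have key : ∀ w'', g w = g w'' ↔ w'' = a ∨ w'' = b := by
      intro w''
      have : w'' ∈ ({w' | g w' = g w} : Set W) ↔ w'' = a ∨ w'' = b := by rw [e]; rfl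
      rw [eq_comm]
      exact this
    rcases (key w).1 rfl with rfl | rfl
    · exact ⟨b, hab.symm, key⟩
    · exact ⟨a, hab, fun w'' => by rw [key]; tauto⟩
  choose κ h1 h2 using this
  exact ⟨κ, h1, h2⟩

theorem partner_involutive {W : Type} {α : Type} {g : W → α} {κ : W → W} (h1 : ∀ w, κ w ≠ w)
    (h2 : ∀ w w', g w = g w' ↔ w' = w ∨ w' = κ w) (w : W) : κ (κ w) = w := by
  have : g (κ w) = g w := ((h2 _ _).2 (Or.inr rfl)).symm
  rcases (h2 _ _).1 this with h | h
  · exact absurd h.symm (h1 w)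
  · exact h.symm

namespace IsGridDiagram

variable {m : ℕ} {G : Set (ℕ × ℕ)}

theorem finite (hG : IsGridDiagram m G) : G.Finite :=
  ((Set.finite_Icc 1 m).prod (Set.finite_Icc 1 m)).subset fun p hp => hG.bounds p hp

theorem exists_col_partner (hG : IsGridDiagram m G) : ∃ κ : G → G, (∀ w, κ w ≠ w) ∧
    ∀ w w' : G, w.1.1 = w'.1.1 ↔ w' = w ∨ w' = κ w := by
  refine exists_partner_of_ncard (fun w : G => w.1.1) fun w => ?_
  rw [← hG.column w.1.1 (hG.bounds _ w.2).1, ← Set.ncard_image_of_injective _ Subtype.val_injective,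
    ← Set.ncard_image_of_injective {y | (w.1.1, y) ∈ G} (f := fun y => (w.1.1, y)) (by
      intro a b h; simpa using h)]
  congr 1
  ext ⟨a, b⟩
  simp only [Set.mem_image, Set.mem_ofPred_eq, Subtype.exists, exists_and_left, exists_prop,
    Prod.mk.injEq]
  constructor
  · rintro ⟨⟨x, y⟩, h, h', e⟩
    cases e
    exact ⟨b, h ▸ h', h.symm, rfl⟩
  · rintro ⟨y, h, rfl, rfl⟩
    exact ⟨(_, y), rfl, h, rfl⟩

theorem exists_row_partner (hG : IsGridDiagram m G) : ∃ π : G → G, (∀ w, π w ≠ w) ∧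
    ∀ w w' : G, w.1.2 = w'.1.2 ↔ w' = w ∨ w' = π w := by
  refine exists_partner_of_ncard (fun w : G => w.1.2) fun w => ?_
  rw [← hG.row w.1.2 (hG.bounds _ w.2).2, ← Set.ncard_image_of_injective _ Subtype.val_injective,
    ← Set.ncard_image_of_injective {x | (x, w.1.2) ∈ G} (f := fun x => (x, w.1.2)) (by
      intro a b h; simpa using h)]
  congr 1
  ext ⟨a, b⟩
  simp only [Set.mem_image, Set.mem_ofPred_eq, Subtype.exists, exists_and_left, exists_prop,
    Prod.mk.injEq]
  constructor
  · rintro ⟨⟨x, y⟩, h, h', e⟩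
    cases e
    exact ⟨a, h ▸ h', rfl, h.symm⟩
  · rintro ⟨y, h, rfl, rfl⟩
    exact ⟨(y, _), rfl, h, rfl⟩

/-- The frame of a grid diagram. -/
def frame (hG : IsGridDiagram m G) (κ π : G → G) (S : G → Prop) (h1 : ∀ w, κ w ≠ w)
    (h2 : ∀ w w' : G, w.1.1 = w'.1.1 ↔ w' = w ∨ w' = κ w)
    (h4 : ∀ w w' : G, w.1.2 = w'.1.2 ↔ w' = w ∨ w' = π w) (hκ : ∀ w, S (κ w) ↔ ¬ S w)
    (hπ : ∀ w, S (π w) ↔ ¬ S w) : TentFrame G (Set.Icc 1 m) where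
  κ := κ
  π := π
  row w := ⟨w.1.2, (hG.bounds _ w.2).2⟩
  S := S
  κ_κ := partner_involutive h1 h2
  row_eq_iff w w' := by rw [← h4, Subtype.mk.injEq]
  row_surj := by
    rintro ⟨y, hy⟩
    have : {x | (x, y) ∈ G}.Nonempty := by
      apply Set.nonempty_of_ncard_ne_zero
      rw [hG.row y hy]
      norm_num
    obtain ⟨x, hx⟩ := this
    exact ⟨⟨(x, y), hx⟩, rfl⟩
  S_κ := hκ
  S_π := hπ

end IsGridDiagram

theorem mem_gridLink_iff {G : Set (ℕ × ℕ)} {κ π : G → G} (k1 : ∀ w, κ w ≠ w)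
    (k2 : ∀ w w' : G, w.1.1 = w'.1.1 ↔ w' = w ∨ w' = κ w) (p1 : ∀ w, π w ≠ w)
    (p2 : ∀ w w' : G, w.1.2 = w'.1.2 ↔ w' = w ∨ w' = π w) {e : Sym2 Pt} : e ∈ gridLink G ↔
    ∃ w : G, e = s(upt w, lpt w) ∨ e = s(upt w, upt (π w)) ∨ e = s(lpt w, lpt (κ w)) := by
  constructor
  · rintro ((⟨x, x', y, h, h', hne, rfl⟩ | ⟨x, y, y', h, h', hne, rfl⟩) | ⟨x, y, h, rfl⟩)
    · refine ⟨⟨(x, y), h⟩, Or.inr (Or.inl ?_)⟩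
      rcases (p2 ⟨(x, y), h⟩ ⟨(x', y), h'⟩).1 rfl with e | e
      · exact absurd (congrArg (fun w : G => w.1.1) e) (Ne.symm hne)
      · rw [← e]; rfl
    · refine ⟨⟨(x, y), h⟩, Or.inr (Or.inr ?_)⟩
      rcases (k2 ⟨(x, y), h⟩ ⟨(x, y'), h'⟩).1 rfl with e | e
      · exact absurd (congrArg (fun w : G => w.1.2) e) (Ne.symm hne)
      · rw [← e]; rfl
    · exact ⟨⟨(x, y), h⟩, Or.inl Sym2.eq_swap⟩
  · have q1 : ∀ w, (κ w).1.1 = w.1.1 := fun w => ((k2 _ _).2 (Or.inr rfl)).symm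
    have q2 : ∀ w, (π w).1.2 = w.1.2 := fun w => ((p2 _ _).2 (Or.inr rfl)).symm
    rintro ⟨w, rfl | rfl | rfl⟩
    · exact Or.inr ⟨w.1.1, w.1.2, w.2, Sym2.eq_swap⟩
    · refine Or.inl (Or.inl ⟨w.1.1, (π w).1.1, w.1.2, w.2, ?_, ?_, ?_⟩)
      · rw [← q2 w]; exact (π w).2
      · exact fun h => p1 w (Subtype.ext (Prod.ext h.symm (q2 w)))
      · simp [upt, q2]
    · refine Or.inl (Or.inr ⟨w.1.1, w.1.2, (κ w).1.2, w.2, ?_, ?_, ?_⟩)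
      · rw [← q1 w]; exact (κ w).2
      · exact fun h => k1 w (Subtype.ext (Prod.ext (q1 w) h.symm))
      · simp [lpt, q1]

namespace IsGridFrame

variable {m : ℕ} {G : Set (ℕ × ℕ)} {f : TentFrame G (Set.Icc 1 m)}

theorem col_κ (hf : IsGridFrame f) (w : G) : (f.κ w).1.1 = w.1.1 :=
  ((hf.col _ _).2 (Or.inr rfl)).symm

theorem row_iff (hf : IsGridFrame f) (w w' : G) : w.1.2 = w'.1.2 ↔ w' = w ∨ w' = f.π w := by
  rw [← f.row_eq_iff, ← hf.row, ← hf.row, Subtype.ext_iff]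

theorem row_π (hf : IsGridFrame f) (w : G) : (f.π w).1.2 = w.1.2 :=
  ((hf.row_iff _ _).2 (Or.inr rfl)).symm

theorem ext (w w' : G) (h1 : w.1.1 = w'.1.1) (h2 : w.1.2 = w'.1.2) : w = w' :=
  Subtype.ext (Prod.ext h1 h2)

theorem row_κ_ne (hf : IsGridFrame f) (w : G) : w.1.2 ≠ (f.κ w).1.2 := fun h =>
  f.κ_ne w (ext _ _ (hf.col_κ w) h.symm)

theorem col_π_ne (hf : IsGridFrame f) (w : G) : (f.π w).1.1 ≠ w.1.1 := fun h =>
  f.π_ne w (ext _ _ h (hf.row_π w))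

theorem mem_gridLink (hf : IsGridFrame f) {e : Sym2 Pt} : e ∈ gridLink G ↔
    ∃ w : G, e = s(upt w, lpt w) ∨ e = s(upt w, upt (f.π w)) ∨ e = s(lpt w, lpt (f.κ w)) :=
  mem_gridLink_iff f.κ_ne hf.col f.π_ne hf.row_iff

/-- The grid link of a frame with the orientation of the frame. -/
def _root_.TentFrame.gridOrientation (f : TentFrame G (Set.Icc 1 m)) : Set (Pt × Pt) :=
  {e | ∃ w : G, (f.S w ∧ (e = (lpt w, upt w) ∨ e = (upt w, upt (f.π w)))) ∨
    (¬ f.S w ∧ (e = (upt w, lpt w) ∨ e = (lpt w, lpt (f.κ w))))}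

theorem forget_gridOrientation (hf : IsGridFrame f) : forget f.gridOrientation = gridLink G := by
  ext e
  rw [hf.mem_gridLink]
  induction e using Sym2.ind with
  | _ a b =>
    rw [mem_forget]
    constructor
    · rintro (⟨w, ⟨h, e | e⟩ | ⟨h, e | e⟩⟩ | ⟨w, ⟨h, e | e⟩ | ⟨h, e | e⟩⟩) <;>
        obtain ⟨rfl, rfl⟩ := Prod.mk.inj e
      · exact ⟨w, Or.inl Sym2.eq_swap⟩
      · exact ⟨w, Or.inr (Or.inl rfl)⟩
      · exact ⟨w, Or.inl rfl⟩
      · exact ⟨w, Or.inr (Or.inr rfl)⟩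
      · exact ⟨w, Or.inl rfl⟩
      · exact ⟨w, Or.inr (Or.inl Sym2.eq_swap)⟩
      · exact ⟨w, Or.inl Sym2.eq_swap⟩
      · exact ⟨w, Or.inr (Or.inr Sym2.eq_swap)⟩
    · rintro ⟨w, e | e | e⟩
      · by_cases h : f.S w
        · rcases Sym2.eq_iff.1 e with ⟨rfl, rfl⟩ | ⟨rfl, rfl⟩
          · exact Or.inr ⟨w, Or.inl ⟨h, Or.inl rfl⟩⟩
          · exact Or.inl ⟨w, Or.inl ⟨h, Or.inl rfl⟩⟩
        · rcases Sym2.eq_iff.1 e with ⟨rfl, rfl⟩ | ⟨rfl, rfl⟩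
          · exact Or.inl ⟨w, Or.inr ⟨h, Or.inl rfl⟩⟩
          · exact Or.inr ⟨w, Or.inr ⟨h, Or.inl rfl⟩⟩
      · by_cases h : f.S w
        · rcases Sym2.eq_iff.1 e with ⟨rfl, rfl⟩ | ⟨rfl, rfl⟩
          · exact Or.inl ⟨w, Or.inl ⟨h, Or.inr rfl⟩⟩
          · exact Or.inr ⟨w, Or.inl ⟨h, Or.inr rfl⟩⟩
        · have h' : f.S (f.π w) := by rwa [f.S_π]
          rcases Sym2.eq_iff.1 e with ⟨rfl, rfl⟩ | ⟨rfl, rfl⟩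
          · exact Or.inr ⟨f.π w, Or.inl ⟨h', Or.inr (by rw [f.π_π])⟩⟩
          · exact Or.inl ⟨f.π w, Or.inl ⟨h', Or.inr (by rw [f.π_π])⟩⟩
      · by_cases h : f.S w
        · have h' : ¬ f.S (f.κ w) := by rw [f.S_κ]; tauto
          rcases Sym2.eq_iff.1 e with ⟨rfl, rfl⟩ | ⟨rfl, rfl⟩
          · exact Or.inr ⟨f.κ w, Or.inr ⟨h', Or.inr (by rw [f.κ_κ])⟩⟩
          · exact Or.inl ⟨f.κ w, Or.inr ⟨h', Or.inr (by rw [f.κ_κ])⟩⟩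
        · rcases Sym2.eq_iff.1 e with ⟨rfl, rfl⟩ | ⟨rfl, rfl⟩
          · exact Or.inl ⟨w, Or.inr ⟨h, Or.inr rfl⟩⟩
          · exact Or.inr ⟨w, Or.inr ⟨h, Or.inr rfl⟩⟩

theorem one_le_abs_cast_sub {a b : ℕ} (h : a ≠ b) : (1 : ℝ) ≤ |(a : ℝ) - b| := by
  have : (1 : ℤ) ≤ |(a : ℤ) - b| := Int.one_le_abs (by omega)
  exact_mod_cast this

/-- Tent links with the columns of the grid, and rows close to those of the grid. -/
theorem embedded (hf : IsGridFrame f) (y μ ζ : G → ℝ) (ξ η : Set.Icc 1 m → ℝ)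
    (hζ : ∀ w, ζ w < 1) (hζκ : ∀ w, ζ (f.κ w) = ζ w) (hy : ∀ w, |y w - (w.1.2 : ℝ)| < 1 / 2)
    (hη : ∀ r, |η r - (r.1 : ℝ)| < 1 / 2)
    (hμ : ∀ w, w.1.2 < (f.κ w).1.2 → μ w < μ (f.κ w)) :
    f.Embedded (fun w => ((w.1.1 : ℝ), y w, 1)) (fun w => ((w.1.1 : ℝ), μ w, ζ w))
      (fun r => (ξ r, η r, 2)) := by
  have lt : ∀ w w', w.1.2 < w'.1.2 → y w < y w' := by
    intro w w' h
    have h1 := abs_lt.1 (hy w)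
    have h2 := abs_lt.1 (hy w')
    have : (w.1.2 : ℝ) + 1 ≤ w'.1.2 := by exact_mod_cast h
    linarith [h1.2, h2.1]
  refine f.embedded_of_bands (fun w => w.1.1) y μ ζ ξ η (fun r => r.1) ?_ ?_ ?_ hζ hζκ ?_ ?_ ?_ hη ?_
  · intro w w' h
    exact (hf.col w w').1 (by exact_mod_cast h)
  · intro w
    simp [hf.col_κ]
  · intro w
    simpa using hf.col_π_ne w
  · intro w
    rcases (hf.row_κ_ne w).lt_or_gt with h | h
    · exact (lt _ _ h).ne
    · exact (lt _ _ h).ne'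
  · intro w h
    rcases (hf.row_κ_ne w).lt_or_gt with h' | h'
    · exact hμ w h'
    · exact absurd h (lt _ _ h').not_gt
  · intro w
    rw [hf.row]
    exact hy w
  · intro r r' h
    exact one_le_abs_cast_sub fun e => h (Subtype.ext e)

/-- The grid link is obtained from a tent link by flattening the rows. -/
theorem equiv_gridOrientation (hf : IsGridFrame f) [Finite G] (ξ : Set.Icc 1 m → ℝ) :
    IsOrientedLink f.gridOrientation ∧
    OrientedLinkEquiv (poly f.perm (TentFrame.pos (fun w : G => ((w.1.1 : ℝ), (w.1.2 : ℝ), 1))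
      (fun w => ((w.1.1 : ℝ), (w.1.2 : ℝ), 0)) (fun r => (ξ r, (r.1 : ℝ), 2)))) f.gridOrientation := by
  have emb := hf.embedded (fun w => w.1.2) (fun w => w.1.2) (fun _ => 0) ξ (fun r => r.1) (by simp)
    (by simp) (by simp) (by simp) (fun w h => by simpa using h)
  -- The triangle over a row stays in the vertical plane of this row and at or above level `1`. This
  -- confines all its intersections with the rest of the link to its two base points.
  have hull : ∀ (w : G) (x : Pt), x ∈ convexHull ℝ {((w.1.1 : ℝ), (w.1.2 : ℝ), (1 : ℝ)),
      (((f.π w).1.1 : ℝ), ((f.π w).1.2 : ℝ), (1 : ℝ)), (ξ (f.row w), ((f.row w).1 : ℝ), (2 : ℝ))} →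
      x.2.1 = w.1.2 ∧ 1 ≤ x.2.2 := by
    intro w x hx
    obtain ⟨α, β, γ, h1, h2, h3, h4, rfl⟩ := mem_hull_triple.1 hx
    simp only [Prod.smul_mk, Prod.mk_add_mk, smul_eq_mul, hf.row, hf.row_π]
    constructor
    · rw [← add_mul, ← add_mul, h4, one_mul]
    · linarith
  let A : G → Pt := fun w => ((w.1.1 : ℝ), (w.1.2 : ℝ), 1)
  let C : G → Pt := fun w => ((w.1.1 : ℝ), (w.1.2 : ℝ), 0)
  let B : Set.Icc 1 m → Pt := fun r => (ξ r, (r.1 : ℝ), 2)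
  have hA : ∀ (w w' : G) (x : Pt), True → x ∈ convexHull ℝ {A w, A (f.π w), B (f.row w)} →
      x ∈ segment ℝ (A w') (C w') → x = A w ∨ x = A (f.π w) := by
    intro w w' x _ hx hx'
    obtain ⟨e1, e2⟩ := hull w x hx
    obtain ⟨t, h0, h1, e1', e2', e3'⟩ := exists_of_mem_segment hx'
    simp only [A, C] at e1' e2' e3'
    have a : t = 0 := by linarith
    subst a
    have hr : w.1.2 = w'.1.2 := by
      have : (w.1.2 : ℝ) = w'.1.2 := by linarith
      exact_mod_cast this
    rcases (hf.row_iff w w').1 hr with rfl | rfl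
    · left; ext <;> simp only [A] <;> linarith
    · right; ext <;> simp only [A] <;> linarith
  have hB : ∀ (w w' : G) (x : Pt), True → f.row w ≠ f.row w' →
      x ∈ convexHull ℝ {A w, A (f.π w), B (f.row w)} →
      x ∈ segment ℝ (A w') (B (f.row w')) → x = A w ∨ x = A (f.π w) := by
    intro w w' x _ hn hx hx'
    obtain ⟨e1, e2⟩ := hull w x hx
    obtain ⟨t, h0, h1, e1', e2', e3'⟩ := exists_of_mem_segment hx'
    simp only [A, B, hf.row] at e1' e2' e3'
    refine absurd ?_ hn
    rw [Subtype.ext_iff, hf.row, hf.row]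
    have : (w.1.2 : ℝ) = w'.1.2 := by linarith
    exact_mod_cast this
  have hK : ∀ (w w' : G) (x : Pt), True → x ∈ convexHull ℝ {A w, A (f.π w), B (f.row w)} →
      x ∈ segment ℝ (C w') (C (f.κ w')) → x = A w ∨ x = A (f.π w) := by
    intro w w' x _ hx hx'
    obtain ⟨e1, e2⟩ := hull w x hx
    obtain ⟨t, h0, h1, e1', e2', e3'⟩ := exists_of_mem_segment hx'
    simp only [C] at e1' e2' e3'
    linarith
  have hT : ∀ (w w' : G) (x : Pt), True → True → f.row w ≠ f.row w' →
      x ∈ convexHull ℝ {A w, A (f.π w), B (f.row w)} →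
      x ∈ convexHull ℝ {A w', A (f.π w'), B (f.row w')} → x = A w ∨ x = A (f.π w) := by
    intro w w' x _ _ hn hx hx'
    obtain ⟨e1, e2⟩ := hull w x hx
    obtain ⟨e1', e2'⟩ := hull w' x hx'
    refine absurd ?_ hn
    rw [Subtype.ext_iff, hf.row, hf.row]
    exact_mod_cast e1.symm.trans e1'
  obtain ⟨D, h1, h2, h3⟩ := f.remove_tops emb (fun _ => True) hA hB hK hT
  have : D = f.gridOrientation := by
    ext e
    rw [h3]
    simp only [TentFrame.gridOrientation, Set.mem_ofPred_eq, not_true, false_and, false_or,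
      true_and]
    rfl
  rw [← this]
  exact ⟨h1, h2⟩

end IsGridFrame

/-! ## Orientations of grid links come from frames -/

/-- At a vertex with no neighbours other than `b` and `c`, an orientation that arrives from one
leaves towards the other. -/
theorem IsOrientedLink.turn_iff {D : Set (Pt × Pt)} (hD : IsOrientedLink D) {a b c : Pt}
    (h : ∀ v, s(a, v) ∈ forget D → v = b ∨ v = c) : (b, a) ∈ D ↔ (a, c) ∈ D := by
  constructor
  · intro hb
    obtain ⟨v, hv⟩ := hD.exists_next hb
    rcases h v (mem_forget.2 (Or.inl hv)) with rfl | rfl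
    · exact absurd hv (hD.swap_notMem hb)
    · exact hv
  · intro hb
    obtain ⟨v, hv⟩ := hD.exists_prev hb
    rcases h v (mem_forget.2 (Or.inr hv)) with rfl | rfl
    · exact hv
    · exact absurd hv (hD.swap_notMem hb)

theorem IsOrientedLink.mem_iff_swap {D : Set (Pt × Pt)} (hD : IsOrientedLink D) {a b : Pt}
    (h : s(a, b) ∈ forget D) : (b, a) ∈ D ↔ (a, b) ∉ D :=
  ⟨fun h' h'' => hD.swap_notMem h' h'', fun h' => (mem_forget.1 h).resolve_left h'⟩

/-- Take for `S` the markings at which the orientation goes up from the column to the row. Running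
through a row it goes up at one marking and down at the other, and similarly for columns, so `S`
alternates; it also determines the direction of all edges. -/
theorem IsGridDiagram.exists_frame_of_orientation {m : ℕ} {G : Set (ℕ × ℕ)} (hG : IsGridDiagram m G)
    {D : Set (Pt × Pt)} (hD : IsOrientedLink D) (hDG : forget D = gridLink G) :
    ∃ f : TentFrame G (Set.Icc 1 m), IsGridFrame f ∧ D = f.gridOrientation := by
  obtain ⟨κ, k1, k2⟩ := hG.exists_col_partner
  obtain ⟨π, p1, p2⟩ := hG.exists_row_partner
  have kk := partner_involutive k1 k2
  have pp := partner_involutive p1 p2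
  have mem : ∀ e, e ∈ forget D ↔ ∃ w : G, e = s(upt w, lpt w) ∨ e = s(upt w, upt (π w)) ∨
      e = s(lpt w, lpt (κ w)) := fun e => by rw [hDG, mem_gridLink_iff k1 k2 p1 p2]
  have uinj : ∀ {w w' : G}, upt w = upt w' → w = w' := fun h => Subtype.ext (upt_inj.1 h)
  have linj : ∀ {w w' : G}, lpt w = lpt w' → w = w' := fun h => Subtype.ext (lpt_inj.1 h)
  have un : ∀ (w : G) v, s(upt w, v) ∈ forget D → v = lpt w ∨ v = upt (π w) := by
    intro w v h
    obtain ⟨w', e | e | e⟩ := (mem _).1 h <;> rcases Sym2.eq_iff.1 e with ⟨h1, rfl⟩ | ⟨h1, rfl⟩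
    · rw [uinj h1]; simp
    · exact absurd h1 (upt_ne_lpt _ _)
    · rw [uinj h1]; simp
    · rw [uinj h1, pp]; simp
    · exact absurd h1 (upt_ne_lpt _ _)
    · exact absurd h1 (upt_ne_lpt _ _)
  have ln : ∀ (w : G) v, s(lpt w, v) ∈ forget D → v = upt w ∨ v = lpt (κ w) := by
    intro w v h
    obtain ⟨w', e | e | e⟩ := (mem _).1 h <;> rcases Sym2.eq_iff.1 e with ⟨h1, rfl⟩ | ⟨h1, rfl⟩
    · exact absurd h1.symm (upt_ne_lpt _ _)
    · rw [linj h1]; simp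
    · exact absurd h1.symm (upt_ne_lpt _ _)
    · exact absurd h1.symm (upt_ne_lpt _ _)
    · rw [linj h1]; simp
    · rw [linj h1, kk]; simp
  have eA : ∀ w : G, s(upt w, lpt w) ∈ forget D := fun w => (mem _).2 ⟨w, Or.inl rfl⟩
  have eB : ∀ w : G, s(upt w, upt (π w)) ∈ forget D := fun w => (mem _).2 ⟨w, Or.inr (Or.inl rfl)⟩
  have eK : ∀ w : G, s(lpt w, lpt (κ w)) ∈ forget D := fun w => (mem _).2 ⟨w, Or.inr (Or.inr rfl)⟩
  -- The orientation passes straight through upper and lower points (`i1`, `i2`), and every edge has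
  -- exactly one direction (`i3` to `i5`).
  have i1 : ∀ w : G, (lpt w, upt w) ∈ D ↔ (upt w, upt (π w)) ∈ D := fun w => hD.turn_iff (un w)
  have i2 : ∀ w : G, (upt w, lpt w) ∈ D ↔ (lpt w, lpt (κ w)) ∈ D := fun w => hD.turn_iff (ln w)
  have i3 : ∀ w : G, (lpt w, upt w) ∈ D ↔ (upt w, lpt w) ∉ D := fun w => hD.mem_iff_swap (eA w)
  have i4 : ∀ w : G, (upt (π w), upt w) ∈ D ↔ (upt w, upt (π w)) ∉ D := fun w => hD.mem_iff_swap (eB w)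
  have i5 : ∀ w : G, (lpt (κ w), lpt w) ∈ D ↔ (lpt w, lpt (κ w)) ∉ D := fun w => hD.mem_iff_swap (eK w)
  refine ⟨hG.frame κ π (fun w => (lpt w, upt w) ∈ D) k1 k2 p2 ?_ ?_, ⟨fun _ => rfl, k2⟩, ?_⟩
  · intro w
    have := i2 (κ w)
    rw [kk, i5, ← i2] at this
    rw [i3, i3, this]
  · intro w
    have := i1 (π w)
    rw [pp, i4, ← i1] at this
    exact this
  · ext ⟨a, b⟩
    constructor
    · intro hab
      obtain ⟨w, e | e | e⟩ := (mem _).1 (mem_forget.2 (Or.inl hab)) <;>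
        rcases Sym2.eq_iff.1 e with ⟨rfl, rfl⟩ | ⟨rfl, rfl⟩
      · exact ⟨w, Or.inr ⟨fun h => hD.swap_notMem h hab, Or.inl rfl⟩⟩
      · exact ⟨w, Or.inl ⟨hab, Or.inl rfl⟩⟩
      · exact ⟨w, Or.inl ⟨(i1 w).2 hab, Or.inr rfl⟩⟩
      · have h' : (lpt (π w), upt (π w)) ∈ D := (i1 (π w)).2 (by rwa [pp])
        exact ⟨π w, Or.inl ⟨h', Or.inr (by show _ = (_, upt (π (π w))); rw [pp])⟩⟩
      · exact ⟨w, Or.inr ⟨fun h => (i3 w).1 h ((i2 w).2 hab), Or.inr rfl⟩⟩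
      · have h' : (upt (κ w), lpt (κ w)) ∈ D := (i2 (κ w)).2 (by rwa [kk])
        exact ⟨κ w, Or.inr ⟨fun h => (i3 _).1 h h', Or.inr (by show _ = (_, lpt (κ (κ w))); rw [kk])⟩⟩
    · rintro ⟨w, ⟨h, e | e⟩ | ⟨h, e | e⟩⟩ <;> obtain ⟨rfl, rfl⟩ := Prod.mk.inj e
      · exact h
      · exact (i1 w).1 h
      · exact not_not.1 fun h' => h ((i3 w).2 h')
      · exact (i2 w).1 (not_not.1 fun h' => h ((i3 w).2 h'))

/-! ## Reversing orientations -/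

/-- The oriented link with all orientations reversed. -/
def reverse (D : Set (Pt × Pt)) : Set (Pt × Pt) := {e | (e.2, e.1) ∈ D}

theorem mem_reverse {D : Set (Pt × Pt)} {a b : Pt} : (a, b) ∈ reverse D ↔ (b, a) ∈ D := Iff.rfl

theorem forget_reverse (D : Set (Pt × Pt)) : forget (reverse D) = forget D := by
  ext e
  induction e using Sym2.ind with
  | _ a b => rw [mem_forget, mem_forget, mem_reverse, mem_reverse, or_comm]

theorem IsOrientedLink.reverse {D : Set (Pt × Pt)} (hD : IsOrientedLink D) :
    IsOrientedLink (reverse D) where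
  finite := by
    refine (hD.finite.image Prod.swap).subset ?_
    rintro ⟨a, b⟩ h
    exact ⟨(b, a), h, rfl⟩
  nondegenerate := fun e he => (hD.nondegenerate _ he).symm
  next := by
    intro e he
    obtain ⟨g, ⟨h1, h2⟩, h3⟩ := hD.prev _ he
    exact ⟨g.swap, ⟨h1, h2⟩, fun g' hg' => by rw [← h3 g'.swap hg', Prod.swap_swap]⟩
  prev := by
    intro e he
    obtain ⟨g, ⟨h1, h2⟩, h3⟩ := hD.next _ he
    exact ⟨g.swap, ⟨h1, h2⟩, fun g' hg' => by rw [← h3 g'.swap hg', Prod.swap_swap]⟩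
  embedded := by
    rintro e he g hg hne p ⟨hp, hp'⟩
    have := hD.embedded _ he _ hg (fun h => hne (Prod.ext (Prod.mk.inj h).2 (Prod.mk.inj h).1)) p
      ⟨by rwa [segment_symm], by rwa [segment_symm]⟩
    exact ⟨this.1.symm, this.2.symm⟩

theorem OrientedTriangleMove.reverse {D D' : Set (Pt × Pt)} (h : OrientedTriangleMove D D') :
    OrientedTriangleMove (reverse D) (reverse D') := by
  obtain ⟨h1, h2, a, b, c, hab, hT, rfl⟩ := h
  refine ⟨h1.reverse, h2.reverse, b, a, c, hab, ?_, ?_⟩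
  · rw [forget_reverse, segment_symm, ← hT, Set.insert_comm]
  · ext ⟨x, y⟩
    simp only [mem_reverse, Set.mem_union, Set.mem_sdiff, Set.mem_singleton_iff,
      Set.mem_insert_iff, Prod.mk.injEq]
    tauto

theorem OrientedLinkEquiv.reverse {D D' : Set (Pt × Pt)} (h : OrientedLinkEquiv D D') :
    OrientedLinkEquiv (reverse D) (reverse D') := by
  induction h with
  | rel _ _ h => exact .rel _ _ h.reverse
  | refl _ => exact .refl _
  | symm _ _ _ ih => exact ih.symm
  | trans _ _ _ _ _ ih ih' => exact ih.trans ih'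

theorem turning_swap (c : ℝ × ℝ) (p q : Pt) : turning c q p = - turning c p q := by
  simp only [turning]; ring

theorem IsClosedBraid.reverse {c : ℝ × ℝ} {D : Set (Pt × Pt)} (h : IsClosedBraid c D) :
    IsClosedBraid c (reverse D) := by
  rcases h with h | h
  · exact Or.inr fun e he => by
      have := h _ he
      rw [turning_swap] at this
      linarith
  · exact Or.inl fun e he => by
      have := h _ he
      rw [turning_swap] at this
      linarith

theorem strands_reverse (c : ℝ × ℝ) (D : Set (Pt × Pt)) : strands c (reverse D) = strands c D := by
  rw [strands, strands, forget_reverse]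

/-- A closed braid may turn in either direction about its axis, so reversing it gives a closed braid
with the same strands. -/
theorem braidIndex_le_reverse (D : Set (Pt × Pt)) : braidIndex D ≤ braidIndex (reverse D) := by
  refine le_sInf ?_
  rintro k ⟨D', c, h, hb, rfl⟩
  exact sInf_le ⟨reverse D', c, h.reverse, hb.reverse, by rw [strands_reverse]⟩

/-- The frame with the opposite orientation. -/
def TentFrame.reverse {W R : Type} (f : TentFrame W R) : TentFrame W R where
  __ := f
  S w := ¬ f.S w
  S_κ w := by rw [f.S_κ]
  S_π w := by rw [f.S_π]

/-! ## Closed braids from grid diagrams -/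

namespace IsGridFrame

variable {m : ℕ} {G : Set (ℕ × ℕ)} {f : TentFrame G (Set.Icc 1 m)}

theorem frame_reverse (hf : IsGridFrame f) : IsGridFrame f.reverse := ⟨hf.row, hf.col⟩

theorem reverse_gridOrientation : reverse f.gridOrientation = f.reverse.gridOrientation := by
  ext ⟨a, b⟩
  rw [mem_reverse]
  simp only [TentFrame.gridOrientation, TentFrame.reverse, Set.mem_ofPred_eq, Prod.mk.injEq,
    not_not]
  constructor
  · rintro ⟨w, ⟨h, ⟨rfl, rfl⟩ | ⟨rfl, rfl⟩⟩ | ⟨h, ⟨rfl, rfl⟩ | ⟨rfl, rfl⟩⟩⟩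
    · exact ⟨w, by tauto⟩
    · exact ⟨f.π w, Or.inl ⟨by rwa [f.S_π, not_not], Or.inr ⟨rfl, by rw [f.π_π]⟩⟩⟩
    · exact ⟨w, by tauto⟩
    · exact ⟨f.κ w, Or.inr ⟨by rwa [f.S_κ], Or.inr ⟨rfl, by rw [f.κ_κ]⟩⟩⟩
  · rintro ⟨w, ⟨h, ⟨rfl, rfl⟩ | ⟨rfl, rfl⟩⟩ | ⟨h, ⟨rfl, rfl⟩ | ⟨rfl, rfl⟩⟩⟩
    · exact ⟨w, by tauto⟩
    · exact ⟨f.π w, Or.inl ⟨by rwa [f.S_π], Or.inr ⟨rfl, by rw [f.π_π]⟩⟩⟩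
    · exact ⟨w, by tauto⟩
    · exact ⟨f.κ w, Or.inr ⟨by rw [f.S_κ, not_not]; exact h, Or.inr ⟨rfl, by rw [f.κ_κ]⟩⟩⟩

open Classical in
/-- The sign of the flow at a marking. -/
def flow (f : TentFrame G (Set.Icc 1 m)) (w : G) : ℝ := if f.S w then -1 else 1

theorem flow_pos {w : G} (h : ¬ f.S w) : flow f w = 1 := if_neg h
theorem flow_neg {w : G} (h : f.S w) : flow f w = -1 := if_pos h
theorem abs_flow (w : G) : |flow f w| = 1 := by
  by_cases h : f.S w
  · rw [flow_neg h]; norm_num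
  · rw [flow_pos h]; norm_num

/-- The columns in which the flow goes down. -/
def Down (f : TentFrame G (Set.Icc 1 m)) (w : G) : Prop :=
  (¬ f.S w ∧ (f.κ w).1.2 < w.1.2) ∨ (f.S w ∧ w.1.2 < (f.κ w).1.2)

theorem down_κ (w : G) : Down f (f.κ w) ↔ Down f w := by
  rw [Down, Down, f.κ_κ, f.S_κ, not_not]
  tauto

open Classical in
/-- The final vertical position of the lower vertices of a column: below the axis if the flow goes
down, above it otherwise. -/
def braidY (f : TentFrame G (Set.Icc 1 m)) (w : G) : ℝ :=
  if Down f w then flow f w * (m + 1) else w.1.2 + flow f w / 4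

-- The axis is at depth `8m + 8`, and the downward columns pass at twice this depth. At such a
-- distance the small steps of size `1/8` in the vertical coordinate outweigh the change of level
-- along a leg or slope above the axis.
open Classical in
def braidZ (f : TentFrame G (Set.Icc 1 m)) (w : G) : ℝ := if Down f w then -2 * (8 * m + 8) else 0

theorem braidZ_κ (w : G) : braidZ f (f.κ w) = braidZ f w := by
  by_cases h : Down f w
  · rw [braidZ, braidZ, if_pos h, if_pos ((down_κ w).2 h)]
  · rw [braidZ, braidZ, if_neg h, if_neg fun h' => h ((down_κ w).1 h')]

/-- Keeps the two lower vertices of a column in their vertical order, so that they can be moved to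
their final position without a collision. -/
theorem braidY_lt (w : G) (h : w.1.2 < (f.κ w).1.2) :
    braidY f w < braidY f (f.κ w) := by
  by_cases hd : Down f w
  · have hS : f.S w := by
      rcases hd with h' | h'
      · exact absurd h h'.2.not_gt
      · exact h'.1
    rw [braidY, braidY, if_pos hd, if_pos ((down_κ w).2 hd), flow_neg hS,
      flow_pos (by rw [f.S_κ]; tauto)]
    have : (0 : ℝ) ≤ m := m.cast_nonneg
    linarith
  · have hS : ¬ f.S w := fun hS => hd (Or.inr ⟨hS, h⟩)
    rw [braidY, braidY, if_neg hd, if_neg (fun h => hd ((down_κ w).1 h)), flow_pos hS,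
      flow_neg (by rwa [f.S_κ])]
    have : (w.1.2 : ℝ) + 1 ≤ (f.κ w).1.2 := by exact_mod_cast h
    linarith

/-- The closed braid of a grid diagram. -/
def braid (f : TentFrame G (Set.Icc 1 m)) : TentVertex G (Set.Icc 1 m) → Pt :=
  TentFrame.pos (fun w : G => ((w.1.1 : ℝ), (w.1.2 : ℝ) + flow f w / 8, 1))
    (fun w => ((w.1.1 : ℝ), braidY f w, braidZ f w)) (fun r => (0, (r.1 : ℝ), 2))

/-- The motion is linear; it keeps every column in its own plane and moves the rows by at most
`1/8`, hence within their bands. -/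
theorem equiv_braid (hf : IsGridFrame f) [Finite G] :
    OrientedLinkEquiv f.gridOrientation (poly f.perm (braid f)) := by
  refine (hf.equiv_gridOrientation fun _ => 0).2.symm.trans ?_
  let p : ℝ → TentVertex G (Set.Icc 1 m) → Pt := fun t =>
    TentFrame.pos (fun w : G => ((w.1.1 : ℝ), (w.1.2 : ℝ) + t * (flow f w / 8), 1))
    (fun w => ((w.1.1 : ℝ), (1 - t) * (w.1.2 : ℝ) + t * braidY f w, t * braidZ f w))
    (fun r => (0, (r.1 : ℝ), 2))
  have h := orientedLinkEquiv_of_motion f.perm p ?_ ?_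
  · have e0 : p 0 = TentFrame.pos (fun w : G => ((w.1.1 : ℝ), (w.1.2 : ℝ), 1))
        (fun w => ((w.1.1 : ℝ), (w.1.2 : ℝ), 0)) (fun r => (0, (r.1 : ℝ), 2)) := by simp [p]
    have e1 : p 1 = braid f := by simp [p, braid]
    rwa [e0, e1] at h
  · intro v
    rcases v with w | w | r <;> simp only [p, TentFrame.pos] <;> fun_prop
  · rintro t ⟨h0, h1⟩
    refine (hf.embedded _ _ _ _ _ ?_ ?_ ?_ ?_ ?_).isGoodPosition
    · intro w
      have : braidZ f w ≤ 0 := by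
        rw [braidZ]
        have : (0 : ℝ) ≤ m := m.cast_nonneg
        split_ifs <;> linarith
      nlinarith
    · intro w
      rw [braidZ_κ]
    · intro w
      have := abs_flow (f := f) w
      rw [add_sub_cancel_left, abs_mul, abs_div, this, abs_of_nonneg h0]
      norm_num
      linarith
    · simp
    · intro w h
      have h2 := braidY_lt w h
      have h3 : (w.1.2 : ℝ) < (f.κ w).1.2 := by exact_mod_cast h
      exact lerp_lt_lerp h0 h1 h3 h2

/-- Rows rise from `r - 1/8` over `r` to `r + 1/8`, and upward columns rise as well, so these edges
pass above the axis in one direction. A downward column passes below the axis from positive to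
negative vertical coordinate, which is the same sense of rotation. -/
theorem turning_braid (hf : IsGridFrame f) (e : Pt × Pt) (he : e ∈ poly f.perm (braid f)) :
    turning (0, -(8 * m + 8)) e.1 e.2 < 0 := by
  have m0 : (0 : ℝ) ≤ m := m.cast_nonneg
  have hw : ∀ w : G, (w.1.2 : ℝ) ≤ m ∧ (1 : ℝ) ≤ w.1.2 := by
    intro w
    have := (f.row w).2
    rw [hf.row] at this
    exact ⟨by exact_mod_cast this.2, by exact_mod_cast this.1⟩
  obtain ⟨w, ⟨hS, rfl | rfl⟩ | ⟨hS, rfl | rfl | rfl⟩⟩ := f.mem_poly.1 he <;>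
    have ⟨w1, w2⟩ := hw w
  · by_cases hd : Down f w
    · simp only [turning, braidY, braidZ, if_pos hd, flow_neg hS]
      nlinarith
    · simp only [turning, braidY, braidZ, if_neg hd, flow_neg hS]
      nlinarith
  · simp only [turning, flow_neg hS, hf.row]
    nlinarith
  · simp only [turning, flow_pos hS, hf.row]
    nlinarith
  · by_cases hd : Down f w
    · simp only [turning, braidY, braidZ, if_pos hd, flow_pos hS]
      nlinarith
    · simp only [turning, braidY, braidZ, if_neg hd, flow_pos hS]
      nlinarith
  · have hS' : f.S (f.κ w) := by rwa [f.S_κ]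
    by_cases hd : Down f w
    · have hd' := (down_κ w).2 hd
      simp only [turning, braidY, braidZ, if_pos hd, if_pos hd', flow_pos hS, flow_neg hS']
      nlinarith
    · have hd' := fun h => hd ((down_κ w).1 h)
      simp only [turning, braidY, braidZ, if_neg hd, if_neg hd', flow_pos hS, flow_neg hS']
      have : (w.1.2 : ℝ) + 1 ≤ (f.κ w).1.2 := by
        rcases (hf.row_κ_ne w).lt_or_gt with h | h
        · exact_mod_cast h
        · exact absurd (Or.inl ⟨hS, h⟩) hd
      nlinarith

/-- Only legs of downward columns reach the level of the axis. Among them the leg at the upper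
marking crosses it on the positive side, the one at the lower marking on the negative side. -/
theorem strands_braid (hf : IsGridFrame f) : strands (0, -(8 * m + 8)) (poly f.perm (braid f)) ⊆
    (fun w : G => ((w.1.1 : ℝ), (1 - (8 * m + 9) / (16 * m + 17)) * ((w.1.2 : ℝ) + 1 / 8) +
      (8 * m + 9) / (16 * m + 17) * (m + 1), (-(8 * m + 8) : ℝ))) ''
      {w | ¬ f.S w ∧ (f.κ w).1.2 < w.1.2} := by
  have m0 : (0 : ℝ) ≤ m := m.cast_nonneg
  have key : ∀ w x, x ∈ segment ℝ (((w : G).1.1 : ℝ), (w.1.2 : ℝ) + flow f w / 8, (1 : ℝ))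
      ((w.1.1 : ℝ), braidY f w, braidZ f w) → (0 : ℝ) < x.2.1 → x.2.2 = -(8 * m + 8) →
      x ∈ (fun w : G => ((w.1.1 : ℝ), (1 - (8 * m + 9) / (16 * m + 17)) * ((w.1.2 : ℝ) + 1 / 8) +
      (8 * m + 9) / (16 * m + 17) * (m + 1), (-(8 * m + 8) : ℝ))) ''
      {w | ¬ f.S w ∧ (f.κ w).1.2 < w.1.2} := by
    intro w x hx hy hz
    obtain ⟨t, h0, h1, e1, e2, e3⟩ := exists_of_mem_segment hx
    simp only at e1 e2 e3
    by_cases hd : Down f w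
    · rw [braidZ, if_pos hd] at e3
      rw [braidY, if_pos hd] at e2
      -- The leg descends from `1` to `-(16m + 16)` and meets the axis level after `8m + 9` of these
      -- `16m + 17` units, so past its middle.
      have ht : t = (8 * m + 9) / (16 * m + 17) := by
        rw [eq_div_iff (by positivity)]
        linarith
      by_cases hS : f.S w
      · rw [flow_neg hS] at e2
        have hw : (w.1.2 : ℝ) ≤ m := by
          have := (f.row w).2
          rw [hf.row] at this
          exact_mod_cast this.2
        -- Past the middle the end at `-(m + 1)` outweighs the other end, which is less than `m`;
        -- the crossing is on the negative side.
        have : 1 - t ≤ t := by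
          rw [ht, sub_le_iff_le_add, ← add_div, le_div_iff₀ (by positivity)]
          linarith
        nlinarith
      · refine ⟨w, ⟨hS, ?_⟩, ?_⟩
        · rcases hd with h | h
          · exact h.2
          · exact absurd h.1 hS
        · rw [flow_pos hS] at e2
          rw [← ht]
          ext <;> simp only <;> linarith
    · rw [braidZ, if_neg hd] at e3
      linarith
  rintro x ⟨hx, hy, hz⟩
  obtain ⟨a, b, hab, hx⟩ := mem_carrier_forget.1 hx
  simp only at hy hz
  obtain ⟨w, ⟨hS, e | e⟩ | ⟨hS, e | e | e⟩⟩ := f.mem_poly.1 hab <;>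
    obtain ⟨rfl, rfl⟩ := Prod.mk.inj e
  · exact key w x (by rwa [segment_symm]) hy hz
  · obtain ⟨t, h0, h1, e1, e2, e3⟩ := exists_of_mem_segment hx
    simp only at e3
    linarith
  · obtain ⟨t, h0, h1, e1, e2, e3⟩ := exists_of_mem_segment hx
    simp only at e3
    linarith
  · exact key w x hx hy hz
  · obtain ⟨t, h0, h1, e1, e2, e3⟩ := exists_of_mem_segment hx
    simp only [braidZ_κ] at e3
    rw [braidZ] at e3
    split_ifs at e3 <;> linarith

theorem braidIndex_le (hf : IsGridFrame f) [Finite G] :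
    braidIndex f.gridOrientation ≤ {w | ¬ f.S w ∧ (f.κ w).1.2 < w.1.2}.encard := by
  have h : braidIndex f.gridOrientation ≤ _ :=
    sInf_le ⟨_, _, hf.equiv_braid, Or.inr hf.turning_braid, rfl⟩
  refine h.trans ?_
  exact (Set.encard_le_encard hf.strands_braid).trans (Set.encard_image_le _ _)

end IsGridFrame

/-- Use the bound for the given orientation and for the opposite one: downward columns become upward
ones, and every column is counted once. -/
theorem IsGridDiagram.two_mul_braidIndex_le {m : ℕ} {G : Set (ℕ × ℕ)} (hG : IsGridDiagram m G)
    {D : Set (Pt × Pt)} (hD : IsOrientedLink D) (hDG : forget D = gridLink G) :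
    2 * braidIndex D ≤ m := by
  obtain ⟨f, hf, rfl⟩ := hG.exists_frame_of_orientation hD hDG
  have : Finite G := hG.finite
  have h1 := hf.braidIndex_le
  have h2 : braidIndex f.gridOrientation ≤
      {w | ¬ f.reverse.S w ∧ (f.reverse.κ w).1.2 < w.1.2}.encard :=
    (braidIndex_le_reverse f.gridOrientation).trans
      (by rw [IsGridFrame.reverse_gridOrientation]; exact hf.frame_reverse.braidIndex_le)
  -- Both sets consist of the upper markings of columns, so a marking is determined by its column.
  have h3 : {w | ¬ f.S w ∧ (f.κ w).1.2 < w.1.2}.encard +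
      {w | ¬ f.reverse.S w ∧ (f.reverse.κ w).1.2 < w.1.2}.encard ≤ m := by
    rw [← Set.encard_union_eq]
    · have : (Set.Icc 1 m).encard = m := by
        rw [← Finset.coe_Icc, Set.encard_coe_eq_coe_finsetCard]
        simp
      rw [← this]
      refine Set.encard_le_encard_of_injOn (f := fun w : G => w.1.1) ?_ ?_
      · intro w _
        exact (hG.bounds _ w.2).1
      · intro w hw w' hw' h
        have l : (f.κ w).1.2 < w.1.2 := by
          rcases hw with h | h
          · exact h.2
          · exact h.2
        have l' : (f.κ w').1.2 < w'.1.2 := by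
          rcases hw' with h | h
          · exact h.2
          · exact h.2
        rcases (hf.col w w').1 h with rfl | rfl
        · rfl
        · rw [f.κ_κ] at l'
          exact absurd l l'.not_gt
    · rw [Set.disjoint_left]
      rintro w h h'
      exact h'.1 h.1
  rw [two_mul]
  exact (add_le_add h1 h2).trans h3

/-! ## The bridge number is at most the braid index -/

theorem OrientedLinkEquiv.isOrientedLink_iff {D D' : Set (Pt × Pt)} (h : OrientedLinkEquiv D D') :
    IsOrientedLink D ↔ IsOrientedLink D' := by
  induction h with
  | rel _ _ h => exact ⟨fun _ => h.2.1, fun _ => h.1⟩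
  | refl _ => exact Iff.rfl
  | symm _ _ _ ih => exact ih.symm
  | trans _ _ _ _ _ ih ih' => exact ih.trans ih'

/-- Subdivision of an edge. -/
theorem IsOrientedLink.freeTriangle_of_sbtw {D : Set (Pt × Pt)} (hD : IsOrientedLink D)
    {a b m : Pt} (hab : (a, b) ∈ D) (hm : Sbtw ℝ a m b) : FreeTriangle (D \ {(a, b)}) a b m where
  off := by
    intro x y hxy p hp hp'
    have : convexHull ℝ {a, b, m} ⊆ segment ℝ a b := by
      refine convexHull_min ?_ (convex_segment _ _)
      rintro x (rfl | rfl | rfl)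
      · exact left_mem_segment ℝ _ _
      · exact right_mem_segment ℝ _ _
      · exact mem_segment_iff_wbtw.2 hm.wbtw
    exact (hD.emb hab hxy.1 (fun h => hxy.2 h.symm) (this hp') hp).1
  ne := hm.left_ne_right
  ne_left := hm.ne_left
  ne_right := hm.ne_right
  tip := by
    intro p hp hp'
    rw [mem_segment_iff_wbtw] at hp hp'
    exact (wbtw_swap_left_iff ℝ b).1 ⟨hm.wbtw.trans_left_right hp, hp'⟩

theorem turning_lerp_left (c : ℝ × ℝ) (a b : Pt) (t : ℝ) :
    turning c a (AffineMap.lineMap a b t) = t * turning c a b := by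
  simp only [turning, AffineMap.lineMap_apply_module, Prod.snd_add, Prod.fst_add, Prod.smul_snd,
    Prod.smul_fst, smul_eq_mul]
  ring

theorem turning_lerp_right (c : ℝ × ℝ) (a b : Pt) (t : ℝ) :
    turning c (AffineMap.lineMap a b t) b = (1 - t) * turning c a b := by
  simp only [turning, AffineMap.lineMap_apply_module, Prod.snd_add, Prod.fst_add, Prod.smul_snd,
    Prod.smul_fst, smul_eq_mul]
  ring

/-- A closed braid can be subdivided so that no edge crosses the level of the axis. -/
theorem exists_subdivision (c : ℝ × ℝ) (k : ℕ) : ∀ D : Set (Pt × Pt), IsOrientedLink D →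
    (∀ e ∈ D, 0 < turning c e.1 e.2) →
    {e | e ∈ D ∧ (e.1.2.2 - c.2) * (e.2.2.2 - c.2) < 0}.ncard ≤ k →
    ∃ D', OrientedLinkEquiv D D' ∧ IsOrientedLink D' ∧ (∀ e ∈ D', 0 < turning c e.1 e.2) ∧
      carrier (forget D') ⊆ carrier (forget D) ∧
      ∀ e ∈ D', 0 ≤ (e.1.2.2 - c.2) * (e.2.2.2 - c.2) := by
  induction k with
  | zero =>
    intro D hD ht hk
    refine ⟨D, .refl _, hD, ht, le_rfl, fun e he => ?_⟩
    have fin : {e | e ∈ D ∧ (e.1.2.2 - c.2) * (e.2.2.2 - c.2) < 0}.Finite :=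
      hD.finite.subset fun e he => he.1
    rw [Nat.le_zero, Set.ncard_eq_zero fin] at hk
    by_contra hn
    exact (Set.eq_empty_iff_forall_notMem.1 hk e) ⟨he, not_le.1 hn⟩
  | succ k ih =>
    intro D hD ht hk
    have fin : {e | e ∈ D ∧ (e.1.2.2 - c.2) * (e.2.2.2 - c.2) < 0}.Finite :=
      hD.finite.subset fun e he => he.1
    by_cases hne : ∃ a b, (a, b) ∈ D ∧ (a.2.2 - c.2) * (b.2.2 - c.2) < 0
    · obtain ⟨a, b, hab, hc⟩ := hne
      have hz : a.2.2 - b.2.2 ≠ 0 := fun h => by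
        rw [sub_eq_zero] at h
        rw [h] at hc
        exact absurd hc (not_lt.2 (mul_self_nonneg _))
      -- The parameter at which the edge crosses the level of the axis.
      have ht0 : ∃ t : ℝ, 0 < t ∧ t < 1 ∧ (1 - t) * a.2.2 + t * b.2.2 = c.2 := by
        refine ⟨(a.2.2 - c.2) / (a.2.2 - b.2.2), ?_, ?_, ?_⟩
        · rcases mul_neg_iff.1 hc with h | h
          · exact div_pos h.1 (by linarith)
          · exact div_pos_of_neg_of_neg h.1 (by linarith)
        · rcases mul_neg_iff.1 hc with h | h
          · rw [div_lt_one (by linarith)]; linarith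
          · rw [div_lt_one_of_neg (by linarith)]; linarith
        · field_simp
          ring
      obtain ⟨t, h0, h1, hm⟩ := ht0
      set m : Pt := AffineMap.lineMap a b t with hmdef
      have hmz : m.2.2 = c.2 := by
        rw [← hm, hmdef]
        simp [AffineMap.lineMap_apply_module]
      have ne : a ≠ b := hD.nondegenerate _ hab
      have hs : Sbtw ℝ a m b := by
        rw [hmdef, sbtw_lineMap_iff]
        exact ⟨ne, h0, h1⟩
      have hF := hD.freeTriangle_of_sbtw hab hs
      have hab' : (a, b) ∉ D \ {(a, b)} := fun h => h.2 rfl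
      have hDe : insert (a, b) (D \ {(a, b)}) = D := by
        rw [Set.insert_sdiff_singleton, Set.insert_eq_of_mem hab]
      have hD₀ : IsOrientedLink (insert (a, b) (D \ {(a, b)})) := by rwa [hDe]
      have hD' := hF.isOrientedLink_insert hD₀ hab'
      have hmove := hF.orientedTriangleMove hD₀ hD' hab'
      rw [hDe] at hmove
      set D' := insert (a, m) (insert (m, b) (D \ {(a, b)})) with hD'def
      have hms := mem_segment_iff_wbtw.2 hs.wbtw
      have ht' : ∀ e ∈ D', 0 < turning c e.1 e.2 := by
        have hp := ht _ hab
        rintro ⟨x, y⟩ (⟨⟨⟩⟩ | ⟨⟨⟩⟩ | hxy)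
        · rw [hmdef, turning_lerp_left]
          exact mul_pos h0 hp
        · rw [hmdef, turning_lerp_right]
          exact mul_pos (by linarith) hp
        · exact ht _ hxy.1
      -- Both new edges end on the level of the axis, so they no longer cross it and the count
      -- drops.
      have hk' : {e | e ∈ D' ∧ (e.1.2.2 - c.2) * (e.2.2.2 - c.2) < 0}.ncard ≤ k := by
        have : {e | e ∈ D' ∧ (e.1.2.2 - c.2) * (e.2.2.2 - c.2) < 0}.ncard <
            {e | e ∈ D ∧ (e.1.2.2 - c.2) * (e.2.2.2 - c.2) < 0}.ncard := by
          refine Set.ncard_lt_ncard ?_ fin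
          rw [Set.ssubset_iff_of_subset]
          · refine ⟨(a, b), ⟨hab, hc⟩, ?_⟩
            rintro ⟨h | h | h, -⟩
            · exact hs.ne_right (Prod.mk.inj h).2.symm
            · exact hs.ne_left (Prod.mk.inj h).1.symm
            · exact h.2 rfl
          · rintro ⟨x, y⟩ ⟨⟨⟨⟩⟩ | ⟨⟨⟩⟩ | hxy, h⟩
            · simp [hmz] at h
            · simp [hmz] at h
            · exact ⟨hxy.1, h⟩
        omega
      obtain ⟨D'', e1, e2, e3, e4, e5⟩ := ih D' hD' ht' hk'
      refine ⟨D'', (Relation.EqvGen.rel _ _ hmove).trans _ _ _ e1, e2, e3, e4.trans ?_, e5⟩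
      intro p hp
      rw [mem_carrier_forget] at hp ⊢
      obtain ⟨x, y, ⟨⟨⟩⟩ | ⟨⟨⟩⟩ | hxy, hp⟩ := hp
      · exact ⟨a, b, hab, (convex_segment a b).segment_subset (left_mem_segment ℝ _ _) hms hp⟩
      · exact ⟨a, b, hab, (convex_segment a b).segment_subset hms (right_mem_segment ℝ _ _) hp⟩
      · exact ⟨x, y, hxy.1, hp⟩
    · refine ⟨D, .refl _, hD, ht, le_rfl, fun e he => ?_⟩
      by_contra hn
      exact hne ⟨e.1, e.2, he, not_le.1 hn⟩

/-- Every oriented link is a polygon on its set of vertices. -/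
theorem IsOrientedLink.exists_poly {D : Set (Pt × Pt)} (hD : IsOrientedLink D) :
    ∃ (V : Type) (_ : Finite V) (σ : Equiv.Perm V) (p : V → Pt), poly σ p = D ∧
      IsGoodPosition σ p := by
  let V : Type := {v : Pt // ∃ b, (v, b) ∈ D}
  have finV : Finite V := by
    have : (Prod.fst '' D).Finite := hD.finite.image _
    refine (this.subset ?_).to_subtype
    rintro v ⟨b, hb⟩
    exact ⟨_, hb, rfl⟩
  have hprev : ∀ v : V, ∃ u, (u, v.1) ∈ D := fun v => by
    obtain ⟨b, hb⟩ := v.2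
    exact hD.exists_prev hb
  let nx : V → V := fun v => ⟨v.2.choose, hD.exists_next v.2.choose_spec⟩
  let pv : V → V := fun v => ⟨(hprev v).choose, v.1, (hprev v).choose_spec⟩
  have hn : ∀ v : V, (v.1, (nx v).1) ∈ D := fun v => v.2.choose_spec
  have hp : ∀ v : V, ((pv v).1, v.1) ∈ D := fun v => (hprev v).choose_spec
  let σ : Equiv.Perm V := ⟨nx, pv, fun v => Subtype.ext (hD.snd_unique (hp _) (hn _)),
    fun v => Subtype.ext (hD.fst_unique (hn _) (hp _))⟩
  have hpoly : poly σ Subtype.val = D := by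
    ext ⟨a, b⟩
    constructor
    · rintro ⟨v, ⟨⟩⟩
      exact hn v
    · intro h
      exact ⟨⟨a, b, h⟩, Prod.ext rfl (hD.fst_unique (hn ⟨a, b, h⟩) h)⟩
  exact ⟨V, finV, σ, Subtype.val, hpoly, Subtype.val_injective, by rwa [hpoly]⟩

/-! ### The projective squeeze and the bridge number -/

/-- Squeezing space towards the level of the axis, projectively on each side. -/
def squeeze (c : ℝ × ℝ) (τ : ℝ) (p : Pt) : Pt :=
  (p.1 / (1 + τ * |p.2.2 - c.2|), c.1 + (p.2.1 - c.1) / (1 + τ * |p.2.2 - c.2|),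
    c.2 + (p.2.2 - c.2) / (1 + τ * |p.2.2 - c.2|))

theorem squeeze_pos {τ : ℝ} (hτ : 0 ≤ τ) (z : ℝ) : 0 < 1 + τ * |z| := by positivity

theorem squeeze_at_zero (c : ℝ × ℝ) (p : Pt) : squeeze c 0 p = p := by
  simp [squeeze]

theorem squeeze_of_eq (c : ℝ × ℝ) (τ : ℝ) {p : Pt} (h : p.2.2 = c.2) : squeeze c τ p = p := by
  ext <;> simp [squeeze, h]

/-- The image of `z` determines `|z - c.2|`, because `u / (1 + τ u)` is injective for `u ≥ 0`; then
the common denominator is known. -/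
theorem squeeze_injective (c : ℝ × ℝ) {τ : ℝ} (hτ : 0 ≤ τ) : Function.Injective (squeeze c τ) := by
  rintro ⟨x, y, z⟩ ⟨x', y', z'⟩ h
  simp only [squeeze, Prod.mk.injEq, add_right_inj] at h
  obtain ⟨h1, h2, h3⟩ := h
  have p := squeeze_pos hτ (z - c.2)
  have p' := squeeze_pos hτ (z' - c.2)
  have e : 1 + τ * |z - c.2| = 1 + τ * |z' - c.2| := by
    have h4 := congrArg abs h3
    rw [abs_div, abs_div, abs_of_pos p, abs_of_pos p', div_eq_div_iff p.ne' p'.ne'] at h4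
    have : |z - c.2| = |z' - c.2| := by linarith
    rw [this]
  rw [e] at h1 h2 h3
  rw [div_left_inj' p'.ne'] at h1 h2 h3
  rw [h1, sub_left_inj.1 h2, sub_left_inj.1 h3]

/-- On either side of the level the denominator is affine, so the map is projective there and takes
segments to segments. For this reason edges crossing the level had to be subdivided. -/
theorem exists_of_mem_segment_squeeze {c : ℝ × ℝ} {τ : ℝ} (hτ : 0 ≤ τ) {a b x : Pt}
    (h : 0 ≤ (a.2.2 - c.2) * (b.2.2 - c.2)) (hx : x ∈ segment ℝ (squeeze c τ a) (squeeze c τ b)) :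
    ∃ y ∈ segment ℝ a b, x = squeeze c τ y := by
  obtain ⟨s, h0, h1, e1, e2, e3⟩ := exists_of_mem_segment hx
  -- With `ε` the common sign of both ends, the absolute values become linear along the edge.
  obtain ⟨ε, hε, ha, hb⟩ : ∃ ε : ℝ, (ε = 1 ∨ ε = -1) ∧ |a.2.2 - c.2| = ε * (a.2.2 - c.2) ∧
      |b.2.2 - c.2| = ε * (b.2.2 - c.2) := by
    rcases mul_nonneg_iff.1 h with h | h
    · exact ⟨1, Or.inl rfl, by rw [one_mul, abs_of_nonneg h.1], by rw [one_mul, abs_of_nonneg h.2]⟩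
    · exact ⟨-1, Or.inr rfl, by rw [neg_one_mul, abs_of_nonpos h.1],
        by rw [neg_one_mul, abs_of_nonpos h.2]⟩
  simp only [squeeze] at e1 e2 e3
  have pa := squeeze_pos hτ (a.2.2 - c.2)
  have pb := squeeze_pos hτ (b.2.2 - c.2)
  set A := 1 + τ * |a.2.2 - c.2| with hA
  set B := 1 + τ * |b.2.2 - c.2| with hB
  -- Weights of the preimage up to normalisation: each weight of the image point is divided by the
  -- denominator at its end.
  set α := (1 - s) / A with hα
  set β := s / B with hβ
  have α0 : 0 ≤ α := div_nonneg (by linarith) pa.le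
  have β0 : 0 ≤ β := div_nonneg h0 pb.le
  have αA : α * A = 1 - s := by rw [hα]; field_simp
  have βB : β * B = s := by rw [hβ]; field_simp
  have σ0 : 0 < α + β := by
    rcases h0.eq_or_lt with h | h
    · have : 0 < α := div_pos (by linarith) pa
      linarith
    · have : 0 < β := div_pos h pb
      linarith
  let y : Pt := (α / (α + β)) • a + (β / (α + β)) • b
  have y1 : y.1 = (α * a.1 + β * b.1) / (α + β) := by
    simp only [y, Prod.fst_add, Prod.smul_fst, smul_eq_mul]; ring
  have y2 : y.2.1 - c.1 = (α * (a.2.1 - c.1) + β * (b.2.1 - c.1)) / (α + β) := by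
    simp only [y, Prod.fst_add, Prod.smul_fst, smul_eq_mul, Prod.snd_add, Prod.smul_snd]
    field_simp
    ring
  have y3 : y.2.2 - c.2 = (α * (a.2.2 - c.2) + β * (b.2.2 - c.2)) / (α + β) := by
    simp only [y, smul_eq_mul, Prod.snd_add, Prod.smul_snd]
    field_simp
    ring
  have yabs : |y.2.2 - c.2| = (α * |a.2.2 - c.2| + β * |b.2.2 - c.2|) / (α + β) := by
    have e : (α * |a.2.2 - c.2| + β * |b.2.2 - c.2|) / (α + β) = ε * (y.2.2 - c.2) := by
      rw [ha, hb, y3]; ring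
    have nn : 0 ≤ ε * (y.2.2 - c.2) := by
      rw [← e]; positivity
    rw [e, ← abs_of_nonneg nn, abs_mul]
    rcases hε with rfl | rfl <;> simp
  have yσ : 1 + τ * |y.2.2 - c.2| = 1 / (α + β) := by
    rw [yabs, eq_div_iff σ0.ne', add_mul, mul_assoc, div_mul_cancel₀ _ σ0.ne']
    rw [hA] at αA
    rw [hB] at βB
    linarith
  refine ⟨y, ⟨α / (α + β), β / (α + β), by positivity, by positivity, by
    rw [← add_div, div_self σ0.ne'], rfl⟩, ?_⟩
  have m1 : ∀ u v : ℝ, (1 - s) * (u / A) + s * (v / B) = α * u + β * v := by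
    intro u v
    rw [hα, hβ]
    ring
  ext
  · simp only [squeeze]
    rw [yσ, y1, div_div_div_cancel_right₀ σ0.ne', div_one, e1, m1]
  · simp only [squeeze]
    rw [yσ, y2, div_div_div_cancel_right₀ σ0.ne', div_one, e2, ← m1]
    ring
  · simp only [squeeze]
    rw [yσ, y3, div_div_div_cancel_right₀ σ0.ne', div_one, e3, ← m1]
    ring

/-- After clearing denominators the difference of the squeezed heights is the difference of the
original heights minus `τ` times the turning. A large `τ` therefore lets the turning decide: edges
above the axis go down, and those below it go up (`lt_squeeze`). -/
theorem squeeze_lt {c : ℝ × ℝ} {τ : ℝ} (hτ : 0 ≤ τ) {a b : Pt}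
    (ht : |b.2.1 - a.2.1| < τ * turning c a b) (ha : c.2 ≤ a.2.2) (hb : c.2 ≤ b.2.2) :
    (squeeze c τ b).2.1 < (squeeze c τ a).2.1 := by
  simp only [squeeze, add_lt_add_iff_left]
  rw [div_lt_div_iff₀ (squeeze_pos hτ _) (squeeze_pos hτ _), abs_of_nonneg (sub_nonneg.2 ha),
    abs_of_nonneg (sub_nonneg.2 hb)]
  have := (abs_lt.1 ht).2
  simp only [turning] at this
  linarith

theorem lt_squeeze {c : ℝ × ℝ} {τ : ℝ} (hτ : 0 ≤ τ) {a b : Pt}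
    (ht : |b.2.1 - a.2.1| < τ * turning c a b) (ha : a.2.2 ≤ c.2) (hb : b.2.2 ≤ c.2) :
    (squeeze c τ a).2.1 < (squeeze c τ b).2.1 := by
  simp only [squeeze, add_lt_add_iff_left]
  rw [div_lt_div_iff₀ (squeeze_pos hτ _) (squeeze_pos hτ _), abs_of_nonpos (sub_nonpos.2 ha),
    abs_of_nonpos (sub_nonpos.2 hb)]
  have := (abs_lt.1 ht).1
  simp only [turning] at this
  linarith

/-- The squeezed braid falls on one side of the level of the axis and rises on the other. A local
maximum must lie on the level itself, where the squeeze is the identity, so it is a point of a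
strand. -/
theorem bridgeNumber_le_strands {D : Set (Pt × Pt)} (hD : IsOrientedLink D) {c : ℝ × ℝ}
    (ht : ∀ e ∈ D, 0 < turning c e.1 e.2) :
    ∃ E', LinkEquiv (forget D) E' ∧ (∀ v w : Pt, s(v, w) ∈ E' → v.2.1 ≠ w.2.1) ∧
      (localMaxima E').encard ≤ (strands c D).encard := by
  obtain ⟨D₁, e1, hD₁, ht₁, hcar, hlev⟩ := exists_subdivision c _ D hD ht le_rfl
  obtain ⟨V, _, σ, p, rfl, hp⟩ := hD₁.exists_poly
  have htv : ∀ v, 0 < turning c (p v) (p (σ v)) := fun v => ht₁ _ ⟨v, rfl⟩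
  have hlv : ∀ v, 0 ≤ ((p v).2.2 - c.2) * ((p (σ v)).2.2 - c.2) := fun v => hlev _ ⟨v, rfl⟩
  obtain ⟨T₀, hT₀⟩ := Finite.bddAbove_range
    fun v => |(p (σ v)).2.1 - (p v).2.1| / turning c (p v) (p (σ v))
  -- There are finitely many edges, all with positive turning, so one strength of the squeeze is
  -- enough.
  obtain ⟨T, hT0, hT⟩ : ∃ T : ℝ, 0 ≤ T ∧
      ∀ v, |(p (σ v)).2.1 - (p v).2.1| < T * turning c (p v) (p (σ v)) := by
    refine ⟨max T₀ 0 + 1, by positivity, fun v => ?_⟩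
    rw [← div_lt_iff₀ (htv v)]
    have : _ ≤ T₀ := hT₀ ⟨v, rfl⟩
    have := le_max_left T₀ 0
    linarith
  have good : ∀ τ : ℝ, 0 ≤ τ → IsGoodPosition σ fun v => squeeze c τ (p v) := by
    intro τ hτ
    refine IsGoodPosition.mk' ((squeeze_injective c hτ).comp hp.inj) hp.ne_self ?_
    intro v w hvw x hx hx'
    obtain ⟨y, hy, rfl⟩ := exists_of_mem_segment_squeeze hτ (hlv v) hx
    obtain ⟨y', hy', e⟩ := exists_of_mem_segment_squeeze hτ (hlv w) hx'
    rw [← squeeze_injective c hτ e] at hy'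
    have := hp.emb hvw hy hy'
    simpa only [(squeeze_injective c hτ).eq_iff] using this
  have equiv := orientedLinkEquiv_of_motion σ (fun t v => squeeze c (t * T) (p v)) ?_ ?_
  · simp only [zero_mul, one_mul, squeeze_at_zero] at equiv
    have up : ∀ v, (c.2 ≤ (p v).2.2 ∧ c.2 ≤ (p (σ v)).2.2 ∧
        (squeeze c T (p (σ v))).2.1 < (squeeze c T (p v)).2.1) ∨
        ((p v).2.2 ≤ c.2 ∧ (p (σ v)).2.2 ≤ c.2 ∧
        (squeeze c T (p v)).2.1 < (squeeze c T (p (σ v))).2.1) := by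
      intro v
      rcases mul_nonneg_iff.1 (hlv v) with ⟨h1, h2⟩ | ⟨h1, h2⟩
      · exact Or.inl ⟨sub_nonneg.1 h1, sub_nonneg.1 h2,
          squeeze_lt hT0 (hT v) (sub_nonneg.1 h1) (sub_nonneg.1 h2)⟩
      · exact Or.inr ⟨sub_nonpos.1 h1, sub_nonpos.1 h2,
          lt_squeeze hT0 (hT v) (sub_nonpos.1 h1) (sub_nonpos.1 h2)⟩
    refine ⟨_, (e1.trans equiv).linkEquiv, ?_, ?_⟩
    · intro v w h
      rcases mem_forget.1 h with ⟨u, e⟩ | ⟨u, e⟩ <;> obtain ⟨rfl, rfl⟩ := Prod.mk.inj e <;>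
        rcases up u with h | h
      · exact h.2.2.ne'
      · exact h.2.2.ne
      · exact h.2.2.ne
      · exact h.2.2.ne'
    · refine Set.encard_le_encard ?_
      rintro x ⟨⟨e, he, hxe⟩, hmax⟩
      obtain ⟨v, rfl⟩ : ∃ v, squeeze c T (p v) = x := by
        obtain ⟨y, rfl⟩ := Sym2.mem_iff_exists.1 hxe
        rcases mem_forget.1 he with ⟨u, e⟩ | ⟨u, e⟩ <;> obtain ⟨rfl, rfl⟩ := Prod.mk.inj e
        · exact ⟨u, rfl⟩
        · exact ⟨σ u, rfl⟩
      have m1 := hmax _ (mem_forget.2 (Or.inl ⟨v, rfl⟩)) (Sym2.mem_mk_left _ _) _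
        (Sym2.mem_mk_right _ _)
      have m2 := hmax _ (mem_forget.2 (Or.inr ⟨σ.symm v, by simp⟩)) (Sym2.mem_mk_left _ _) _
        (Sym2.mem_mk_right _ (squeeze c T (p (σ.symm v))))
      -- The edge leaving a local maximum falls, so it lies above the level; the one arriving rises,
      -- so it lies below.
      have z1 : c.2 ≤ (p v).2.2 ∧ c.2 ≤ (p (σ v)).2.2 := by
        rcases up v with h | h
        · exact ⟨h.1, h.2.1⟩
        · exact absurd h.2.2 (not_lt.2 m1)
      have z2 : (p v).2.2 ≤ c.2 := by
        have := up (σ.symm v)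
        rw [Equiv.apply_symm_apply] at this
        rcases this with h | h
        · exact absurd h.2.2 (not_lt.2 m2)
        · exact h.2.1
      have z : (p v).2.2 = c.2 := le_antisymm z2 z1.1
      rw [squeeze_of_eq c T z]
      refine ⟨hcar (mem_carrier_forget.2 ⟨_, _, ⟨v, rfl⟩, left_mem_segment ℝ _ _⟩), ?_, z⟩
      have := htv v
      rw [turning, z, sub_self, zero_mul, sub_zero] at this
      exact sub_pos.1 (pos_of_mul_pos_left this (sub_nonneg.2 z1.2))
  · intro v
    have : ∀ t ∈ Set.Icc (0 : ℝ) 1, 1 + t * T * |(p v).2.2 - c.2| ≠ 0 := fun t ht =>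
      (squeeze_pos (mul_nonneg ht.1 hT0) _).ne'
    simp only [squeeze]
    fun_prop (disch := assumption)
  · intro t ht
    exact good _ (mul_nonneg ht.1 hT0)

theorem bridgeNumber_le_braidIndex {D : Set (Pt × Pt)} (hD : IsOrientedLink D) :
    bridgeNumber (forget D) ≤ braidIndex D := by
  refine le_sInf ?_
  rintro k ⟨D', c, h, hb, rfl⟩
  have hD' := h.isOrientedLink_iff.1 hD
  have h' := h.linkEquiv
  rcases hb with hb | hb
  · obtain ⟨E', h1, h2, h3⟩ := bridgeNumber_le_strands hD' hb
    exact (show bridgeNumber (forget D) ≤ _ from sInf_le ⟨E', h'.trans h1, h2, rfl⟩).trans h3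
  · obtain ⟨E', h1, h2, h3⟩ := bridgeNumber_le_strands (c := c) hD'.reverse fun e he => by
      have := hb _ he
      rw [turning_swap] at this
      linarith
    rw [strands_reverse] at h3
    rw [forget_reverse] at h1
    exact (show bridgeNumber (forget D) ≤ _ from sInf_le ⟨E', h'.trans h1, h2, rfl⟩).trans h3

/-! ## Orientations of alternating cycles -/

open Equiv in
/-- Two fixed-point-free involutions are both reversed by some two-colouring. -/
theorem exists_two_coloring {W : Type} (α β : W → W) (hα : ∀ w, α (α w) = w)
    (hβ : ∀ w, β (β w) = w) (nα : ∀ w, α w ≠ w) (nβ : ∀ w, β w ≠ w) :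
    ∃ S : W → Prop, (∀ w, S (α w) ↔ ¬ S w) ∧ ∀ w, S (β w) ↔ ¬ S w := by
  let a : Perm W := ⟨α, α, hα, hα⟩
  let b : Perm W := ⟨β, β, hβ, hβ⟩
  have aa : a⁻¹ = a := rfl
  have a2 : a * a = 1 := Equiv.ext hα
  have bb : b⁻¹ = b := rfl
  -- Along an alternating cycle of `α` and `β` the colours should alternate, so a colouring should
  -- be constant on the orbits of `ρ` and change under `α`.
  let ρ : Perm W := b * a
  have conj : a * ρ * a⁻¹ = ρ⁻¹ := by
    simp only [ρ, mul_inv_rev, aa, bb, mul_assoc, a2, mul_one]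
  have conj' : ∀ k : ℤ, a * ρ ^ k = ρ ^ (-k) * a := by
    intro k
    rw [zpow_neg, ← inv_zpow, ← conj, conj_zpow, inv_mul_cancel_right]
  have key : ∀ (k : ℤ) w, α ((ρ ^ k) w) = (ρ ^ (-k)) (α w) := fun k w =>
    congrArg (fun g : Perm W => g w) (conj' k)
  have hβρ : ∀ w, β w = ρ (α w) := fun w => congrArg β (hα w).symm
  have add : ∀ (j k : ℤ) w, (ρ ^ j) ((ρ ^ k) w) = (ρ ^ (j + k)) w := fun j k w => by
    rw [zpow_add]; rfl
  -- If `α w = ρ ^ k w`, conjugation by `α` inverts `ρ` and halving `k` gives a fixed point: of `α`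
  -- for even `k`, of `β` for odd `k`.
  have hn : ∀ w, ¬ ρ.SameCycle w (α w) := by
    rintro w ⟨k, hk⟩
    rcases Int.even_or_odd' k with ⟨j, rfl | rfl⟩
    · apply nα ((ρ ^ j) w)
      rw [key, ← hk, add]
      congr 2
      ring
    · apply nβ ((ρ ^ (j + 1)) w)
      have e : ρ = ρ ^ (1 : ℤ) := (zpow_one ρ).symm
      rw [hβρ, key, ← hk, add]
      conv_lhs => enter [1]; rw [e]
      rw [add]
      congr 2
      ring
  have hc : ∀ w w', ρ.SameCycle w w' → ρ.SameCycle (α w) (α w') := by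
    rintro w _ ⟨k, rfl⟩
    exact ⟨-k, (key k w).symm⟩
  let Q := Quotient (Perm.SameCycle.setoid ρ)
  let cl : W → Q := Quotient.mk _
  have hcl : ∀ w w', cl w = cl w' ↔ ρ.SameCycle w w' := fun w w' => Quotient.eq
  -- The orbits of `w` and `α w` differ; an arbitrary linear order of the orbits chooses one of
  -- them.
  let lt : Q → Q → Prop := WellOrderingRel
  have asymm : ∀ p q, lt p q → ¬ lt q p := fun p q h h' => asymm_of WellOrderingRel h h'
  have tri : ∀ p q, p ≠ q → lt p q ∨ lt q p := fun p q h =>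
    (trichotomous_of WellOrderingRel p q).imp id (fun h' => h'.resolve_left h)
  have flip : ∀ w, lt (cl (α w)) (cl w) ↔ ¬ lt (cl w) (cl (α w)) := by
    intro w
    refine ⟨asymm _ _, fun h => (tri _ _ ?_).resolve_right h⟩
    exact fun e => hn w ((hcl _ _).1 e.symm)
  refine ⟨fun w => lt (cl w) (cl (α w)), fun w => ?_, fun w => ?_⟩
  · beta_reduce
    rw [hα]
    exact flip w
  · have h1 : cl (β w) = cl (α w) := by
      rw [hcl, hβρ]
      exact Perm.SameCycle.symm ⟨1, by simp⟩
    have h2 : cl (α (β w)) = cl w := by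
      rw [hcl]
      have := hc _ _ ((hcl _ _).1 h1)
      rwa [hα] at this
    beta_reduce
    rw [h1, h2]
    exact flip w

/-- Some orientation is needed even for the unoriented statement, because motions are formulated for
oriented polygons. -/
theorem IsGridDiagram.exists_frame {m : ℕ} {G : Set (ℕ × ℕ)} (hG : IsGridDiagram m G) :
    ∃ f : TentFrame G (Set.Icc 1 m), IsGridFrame f := by
  obtain ⟨κ, k1, k2⟩ := hG.exists_col_partner
  obtain ⟨π, p1, p2⟩ := hG.exists_row_partner
  obtain ⟨S, s1, s2⟩ := exists_two_coloring κ π (partner_involutive k1 k2)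
    (partner_involutive p1 p2) k1 p1
  exact ⟨hG.frame κ π S k1 k2 p2 s1 s2, fun _ => rfl, k2⟩

/-- The unoriented link obtained by removing the tops of some rows of a tent link. -/
theorem TentFrame.mem_forget_remove_tops {W R : Type} (f : TentFrame W R) {L M : W → Pt}
    {U : R → Pt} {P : R → Prop} {D : Set (Pt × Pt)}
    (hD : ∀ e, e ∈ D ↔ ∃ w, (f.S w ∧ (e = (M w, L w) ∨ (¬ P (f.row w) ∧ e = (L w, U (f.row w))) ∨
          (P (f.row w) ∧ e = (L w, L (f.π w))))) ∨
        (¬ f.S w ∧ ((¬ P (f.row w) ∧ e = (U (f.row w), L w)) ∨ e = (L w, M w) ∨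
          e = (M w, M (f.κ w))))) (e : Sym2 Pt) :
    e ∈ forget D ↔ ∃ w, e = s(L w, M w) ∨ (¬ P (f.row w) ∧ e = s(U (f.row w), L w)) ∨
      (P (f.row w) ∧ e = s(L w, L (f.π w))) ∨ e = s(M w, M (f.κ w)) := by
  induction e using Sym2.ind with
  | _ a b =>
    have swap : ∀ {c d : Pt}, s(a, b) = s(c, d) → (c, d) ∈ D ∨ (d, c) ∈ D →
        s(a, b) ∈ forget D := fun h h' => by rw [h]; exact mem_forget.2 h'
    constructor
    · intro h
      have key : ∀ a b, (a, b) ∈ D → ∃ w, s(a, b) = s(L w, M w) ∨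
          (¬ P (f.row w) ∧ s(a, b) = s(U (f.row w), L w)) ∨
          (P (f.row w) ∧ s(a, b) = s(L w, L (f.π w))) ∨ s(a, b) = s(M w, M (f.κ w)) := by
        intro a b h
        obtain ⟨w, ⟨-, e | ⟨hp, e⟩ | ⟨hp, e⟩⟩ | ⟨-, ⟨hp, e⟩ | e | e⟩⟩ := (hD _).1 h <;>
          obtain ⟨rfl, rfl⟩ := Prod.mk.inj e
        · exact ⟨w, Or.inl Sym2.eq_swap⟩
        · exact ⟨w, Or.inr (Or.inl ⟨hp, Sym2.eq_swap⟩)⟩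
        · exact ⟨w, Or.inr (Or.inr (Or.inl ⟨hp, rfl⟩))⟩
        · exact ⟨w, Or.inr (Or.inl ⟨hp, rfl⟩)⟩
        · exact ⟨w, Or.inl rfl⟩
        · exact ⟨w, Or.inr (Or.inr (Or.inr rfl))⟩
      rcases mem_forget.1 h with h | h
      · exact key _ _ h
      · rw [Sym2.eq_swap]
        exact key _ _ h
    · rintro ⟨w, e | ⟨hp, e⟩ | ⟨hp, e⟩ | e⟩ <;> refine swap e ?_ <;> by_cases hs : f.S w
      · exact Or.inr ((hD _).2 ⟨w, Or.inl ⟨hs, Or.inl rfl⟩⟩)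
      · exact Or.inl ((hD _).2 ⟨w, Or.inr ⟨hs, Or.inr (Or.inl rfl)⟩⟩)
      · exact Or.inr ((hD _).2 ⟨w, Or.inl ⟨hs, Or.inr (Or.inl ⟨hp, rfl⟩)⟩⟩)
      · exact Or.inl ((hD _).2 ⟨w, Or.inr ⟨hs, Or.inl ⟨hp, rfl⟩⟩⟩)
      · exact Or.inl ((hD _).2 ⟨w, Or.inl ⟨hs, Or.inr (Or.inr ⟨hp, rfl⟩)⟩⟩)
      · refine Or.inr ((hD _).2 ⟨f.π w, Or.inl ⟨by rwa [f.S_π], Or.inr (Or.inr ⟨?_, ?_⟩)⟩⟩)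
        · rwa [f.row_π]
        · rw [f.π_π]
      · refine Or.inr ((hD _).2 ⟨f.κ w, Or.inr ⟨by rwa [f.S_κ, not_not], Or.inr (Or.inr ?_)⟩⟩)
        rw [f.κ_κ]
      · exact Or.inl ((hD _).2 ⟨w, Or.inr ⟨hs, Or.inr (Or.inr rfl)⟩⟩)

/-! ## Half diagrams -/

/-- The column (from the left) of a breakpoint `(i, false)` or midpoint `(i, true)`. -/
def col {n : ℕ} (a : Fin n × Bool) : ℕ := 2 * a.1 + 1 + a.2.toNat

theorem col_injective {n : ℕ} : Function.Injective (col : Fin n × Bool → ℕ) := by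
  rintro ⟨⟨i, hi⟩, b⟩ ⟨⟨j, hj⟩, c⟩ h
  cases b <;> cases c <;> simp [col] at h ⊢ <;> omega

theorem col_mem {n : ℕ} (a : Fin n × Bool) : col a ∈ Set.Icc 1 (2 * n) := by
  obtain ⟨⟨i, hi⟩, b⟩ := a
  cases b <;> simp [col] <;> omega

theorem exists_col {n x : ℕ} (hx : x ∈ Set.Icc 1 (2 * n)) : ∃ a : Fin n × Bool, col a = x := by
  obtain ⟨h1, h2⟩ := hx
  rcases Nat.even_or_odd' x with ⟨k, rfl | rfl⟩
  · exact ⟨(⟨k - 1, by omega⟩, true), by simp [col]; omega⟩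
  · exact ⟨(⟨k, by omega⟩, false), by simp [col]⟩

/-- A half grid diagram together with a planar tree diagram: each column ends at a marking, drawn at
`(x, h)` in the plane, and the two markings in each row are joined to an apex `(ξ, g)`. The root
joins the markings `root` and `conj root`. -/
structure HalfDiagram (n : ℕ) where
  row : Fin n × Bool → ℕ
  conj : Fin n × Bool → Fin n × Bool
  root : Fin n × Bool
  x : Fin n × Bool → ℝ
  h : Fin n × Bool → ℝ
  ξ₀ : Fin n × Bool → ℝ
  ξ : Fin n × Bool → ℝ
  g : Fin n × Bool → ℝ
  conj_ne : ∀ a, conj a ≠ a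
  row_eq_iff : ∀ a b, row a = row b ↔ b = a ∨ b = conj a
  row_mem : ∀ a, row a ∈ Set.Icc 1 n
  row_surj : ∀ y ∈ Set.Icc 1 n, ∃ a, row a = y
  x_lt : ∀ a b, col a < col b → x a < x b
  one_lt_h : ∀ a, 1 < h a
  one_lt_g : ∀ a, 1 < g a
  ξ₀_conj : ∀ a, ξ₀ (conj a) = ξ₀ a
  ξ_conj : ∀ a, ξ (conj a) = ξ a
  g_conj : ∀ a, g (conj a) = g a
  sep : ∀ a b, a ≠ b → b ≠ conj a → (col a < col b ∧ ξ₀ a < ξ₀ b ∧ ξ a < ξ b) ∨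
    (col b < col a ∧ ξ₀ b < ξ₀ a ∧ ξ b < ξ a) ∨ (row a < row b ∧ h a < h b ∧ g a < g b) ∨
    (row b < row a ∧ h b < h a ∧ g b < g a)
  x_root : x root = 0
  h_root : h root = 3
  x_conj_root : x (conj root) = 1 / 2
  h_conj_root : h (conj root) = 2
  ξ_root : ξ root = 1 / 4
  g_root : g root = 5 / 2
  h_lt_two : ∀ a, a ≠ root → a ≠ conj root → h a < 2
  g_le_two : ∀ a, a ≠ root → a ≠ conj root → g a ≤ 2

namespace HalfDiagram

variable {n : ℕ}

theorem row_conj (H : HalfDiagram n) (a) : H.row (H.conj a) = H.row a :=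
  ((H.row_eq_iff _ _).2 (Or.inr rfl)).symm

theorem conj_conj (H : HalfDiagram n) (a) : H.conj (H.conj a) = a := by
  rcases (H.row_eq_iff _ _).1 (H.row_conj a) with h | h
  · exact absurd h.symm (H.conj_ne a)
  · exact h.symm

variable (H : Bool → HalfDiagram n)

/-- The markings of the upper (`true`) and lower (`false`) half of a grid diagram. -/
def mark (v : Bool × Fin n × Bool) : ℕ × ℕ :=
  (col v.2, if v.1 then n + (H v.1).row v.2 else n + 1 - (H v.1).row v.2)

theorem mark_true (a) : mark H (true, a) = (col a, n + (H true).row a) := rfl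
theorem mark_false (a) : mark H (false, a) = (col a, n + 1 - (H false).row a) := rfl

theorem side_iff (v) : v.1 = true ↔ n < (mark H v).2 := by
  obtain ⟨b, a⟩ := v
  have := (H b).row_mem a
  rw [Set.mem_Icc] at this
  cases b
  · rw [mark_false]; simp only [Bool.false_eq_true, false_iff]; omega
  · rw [mark_true]; simp only [true_iff]; omega

theorem mark_injective : Function.Injective (mark H) := by
  intro v v' h
  have h1 : v.1 = v'.1 := by rw [Bool.eq_iff_iff, side_iff H, side_iff H, h]
  exact Prod.ext h1 (col_injective (congrArg Prod.fst h))

theorem mark_row_iff (v v') : (mark H v).2 = (mark H v').2 ↔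
    v' = v ∨ v' = (v.1, (H v.1).conj v.2) := by
  obtain ⟨b, a⟩ := v
  obtain ⟨b', a'⟩ := v'
  simp only [Prod.mk.injEq]
  constructor
  · intro h
    have h1 : b = b' := by
      have : ((b, a) : Bool × _).1 = ((b', a') : Bool × _).1 := by
        rw [Bool.eq_iff_iff, side_iff H, side_iff H, h]
      exact this
    subst h1
    have := (H b).row_mem a
    have := (H b).row_mem a'
    have e : (H b).row a = (H b).row a' := by
      simp only [Set.mem_Icc] at *
      cases b
      · rw [mark_false, mark_false] at h; simp only at h; omega
      · rw [mark_true, mark_true] at h; simp only at h; omega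
    rcases ((H b).row_eq_iff _ _).1 e with h | h
    · exact Or.inl ⟨rfl, h⟩
    · exact Or.inr ⟨rfl, h⟩
  · rintro (⟨rfl, rfl⟩ | ⟨rfl, rfl⟩)
    · rfl
    · simp only [mark, row_conj]

/-- Each half has one marking in every column, so stacking gives two; in each half, rows consist of
conjugate pairs. -/
theorem isGridDiagram : IsGridDiagram (2 * n) (Set.range (mark H)) where
  bounds := by
    rintro _ ⟨⟨b, a⟩, rfl⟩
    refine ⟨col_mem a, ?_⟩
    have := (H b).row_mem a
    rw [Set.mem_Icc] at this ⊢
    cases b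
    · rw [mark_false]; simp only; omega
    · rw [mark_true]; simp only; omega
  row := by
    intro y hy
    rw [Set.mem_Icc] at hy
    have : ∃ v, (mark H v).2 = y := by
      rcases lt_or_ge n y with h | h
      · obtain ⟨a, ha⟩ := (H true).row_surj (y - n) (by rw [Set.mem_Icc]; omega)
        exact ⟨(true, a), by rw [mark_true, ha]; simp only; omega⟩
      · obtain ⟨a, ha⟩ := (H false).row_surj (n + 1 - y) (by rw [Set.mem_Icc]; omega)
        exact ⟨(false, a), by rw [mark_false, ha]; simp only; omega⟩
    obtain ⟨v, rfl⟩ := this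
    rw [Set.ncard_eq_two]
    refine ⟨col v.2, col ((H v.1).conj v.2), fun h => (H v.1).conj_ne _ (col_injective h).symm, ?_⟩
    ext x
    simp only [Set.mem_ofPred_eq, Set.mem_range, Set.mem_insert_iff, Set.mem_singleton_iff]
    constructor
    · rintro ⟨v', h⟩
      rcases (mark_row_iff H v v').1 (congrArg Prod.snd h).symm with rfl | rfl
      · exact Or.inl (congrArg Prod.fst h).symm
      · exact Or.inr (congrArg Prod.fst h).symm
    · rintro (rfl | rfl)
      · exact ⟨v, rfl⟩
      · exact ⟨(v.1, (H v.1).conj v.2), Prod.ext rfl ((mark_row_iff H _ _).2 (Or.inr rfl)).symm⟩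
  column := by
    intro x hx
    obtain ⟨a, rfl⟩ := exists_col hx
    rw [Set.ncard_eq_two]
    refine ⟨(mark H (true, a)).2, (mark H (false, a)).2, ?_, ?_⟩
    · have h1 := side_iff H (true, a)
      have h2 := side_iff H (false, a)
      simp only [true_iff, Bool.false_eq_true, false_iff] at h1 h2
      omega
    · ext y
      simp only [Set.mem_ofPred_eq, Set.mem_range, Set.mem_insert_iff, Set.mem_singleton_iff]
      constructor
      · rintro ⟨⟨b, a'⟩, h⟩
        have : a' = a := col_injective (congrArg Prod.fst h)
        subst this
        cases b
        · exact Or.inr (congrArg Prod.snd h).symm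
        · exact Or.inl (congrArg Prod.snd h).symm
      · rintro (rfl | rfl)
        · exact ⟨(true, a), rfl⟩
        · exact ⟨(false, a), rfl⟩

end HalfDiagram

/-! ## From grid diagrams to tree diagrams -/

/-- The sign of a side of the horizontal axis. -/
def sg (b : Bool) : ℝ := if b then 1 else -1

theorem sg_true : sg true = 1 := rfl
theorem sg_false : sg false = -1 := rfl

namespace HalfDiagram

variable {n : ℕ} (H : Bool → HalfDiagram n)

/-- The union of two planar tree diagrams, on both sides of the horizontal axis. -/
def treeLink : Set (Sym2 Pt) :=
  {e | ∃ b a, e = s(((H b).x a, sg b * (H b).h a, 0), ((H b).x a, sg b, 0))} ∪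
  {e | ∃ b a, a ≠ (H b).root ∧ a ≠ (H b).conj (H b).root ∧
    e = s(((H b).ξ a, sg b * (H b).g a, 1), ((H b).x a, sg b * (H b).h a, 0))} ∪
  {e | ∃ b, e = s((0, sg b * 3, 0), (1 / 2, sg b * 2, 0))} ∪
  {e | ∃ a, e = s(((H true).x a, 1, 0), ((H false).x a, -1, 0))}

variable {H}

/-- The side and index of a marking. -/
def idx (w : Set.range (mark H)) : Bool × Fin n × Bool := w.2.choose

theorem mark_idx (w : Set.range (mark H)) : mark H (idx w) = w.1 := w.2.choose_spec

theorem idx_inj {w w' : Set.range (mark H)} (h : idx w = idx w') : w = w' := by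
  rw [Subtype.ext_iff, ← mark_idx, h, mark_idx]

theorem idx_eq_iff {w : Set.range (mark H)} {v} : idx w = v ↔ w.1 = mark H v := by
  rw [← mark_idx, (mark_injective H).eq_iff]

theorem idx_surjective : Function.Surjective (idx (H := H)) := fun v =>
  ⟨⟨mark H v, v, rfl⟩, idx_eq_iff.2 rfl⟩

variable {f : TentFrame (Set.range (mark H)) (Set.Icc 1 (2 * n))}

theorem col_idx (w : Set.range (mark H)) : col (idx w).2 = w.1.1 := by rw [← mark_idx]; rfl

theorem idx_κ (hf : IsGridFrame f) (w) : idx (f.κ w) = (!(idx w).1, (idx w).2) := by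
  have h : (idx (f.κ w)).2 = (idx w).2 :=
    col_injective (by rw [col_idx, col_idx, hf.col_κ])
  refine Prod.ext ?_ h
  by_contra hne
  rw [Bool.eq_not, not_not] at hne
  exact f.κ_ne w (idx_inj (Prod.ext hne h))

theorem idx_π (hf : IsGridFrame f) (w) :
    idx (f.π w) = ((idx w).1, (H (idx w).1).conj (idx w).2) := by
  have h : (mark H (idx w)).2 = (mark H (idx (f.π w))).2 := by
    rw [mark_idx, mark_idx, hf.row_π]
  refine ((mark_row_iff H _ _).1 h).resolve_left fun h => ?_
  exact f.π_ne w (idx_inj h)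

/-- Functions of the markings that depend only on the row. -/
theorem apply_out_row (hf : IsGridFrame f) {α : Type} (F : Bool → Fin n × Bool → α)
    (hF : ∀ b a, F b ((H b).conj a) = F b a) (w) :
    F (idx (f.out (f.row w))).1 (idx (f.out (f.row w))).2 = F (idx w).1 (idx w).2 := by
  rcases (f.row_eq_iff _ _).1 (f.row_out (f.row w)).symm with h | h
  · rw [h]
  · rw [h, idx_π hf, hF]

/-- The positions of the tent vertices during the planar motion. -/
def posX (t : ℝ) (v : Bool × Fin n × Bool) : ℝ := (1 - t) * (col v.2 : ℝ) + t * (H v.1).x v.2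
def posY (t : ℝ) (v : Bool × Fin n × Bool) : ℝ :=
  (1 - t) * ((mark H v).2 : ℝ) + t * (sg v.1 * (H v.1).h v.2)
def apexX (t : ℝ) (v : Bool × Fin n × Bool) : ℝ := (1 - t) * (H v.1).ξ₀ v.2 + t * (H v.1).ξ v.2
def apexY (t : ℝ) (v : Bool × Fin n × Bool) : ℝ :=
  (1 - t) * ((mark H v).2 : ℝ) + t * (sg v.1 * (H v.1).g v.2)
def level (n : ℕ) (t : ℝ) (b : Bool) : ℝ :=
  (1 - t) * ((n : ℝ) + if b then 3 / 4 else 1 / 4) + t * sg b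

theorem apexX_out_row (hf : IsGridFrame f) (t : ℝ) (w) :
    apexX (H := H) t (idx (f.out (f.row w))) = apexX (H := H) t (idx w) :=
  apply_out_row hf (fun b a => apexX (H := H) t (b, a))
    (fun b a => by simp only [apexX, ξ₀_conj, ξ_conj]) w

theorem apexY_out_row (hf : IsGridFrame f) (t : ℝ) (w) :
    apexY (H := H) t (idx (f.out (f.row w))) = apexY (H := H) t (idx w) :=
  apply_out_row hf (fun b a => apexY (H := H) t (b, a))
    (fun b a => by simp only [apexY, g_conj, mark, row_conj]) w

theorem mark_lt_of_row_lt {b : Bool} {a a' : Fin n × Bool} (h : (H b).row a < (H b).row a')  :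
    sg b * (mark H (b, a)).2 < sg b * (mark H (b, a')).2 := by
  have h1 := ((H b).row_mem a)
  have h2 := ((H b).row_mem a')
  rw [Set.mem_Icc] at h1 h2
  cases b
  · have : (mark H (false, a')).2 < (mark H (false, a)).2 := by
      rw [mark_false, mark_false]; simp only; omega
    have : ((mark H (false, a')).2 : ℝ) < (mark H (false, a)).2 := by exact_mod_cast this
    rw [sg_false]; linarith
  · have : (mark H (true, a)).2 < (mark H (true, a')).2 := by
      rw [mark_true, mark_true]; simp only; omega
    have : ((mark H (true, a)).2 : ℝ) < (mark H (true, a')).2 := by exact_mod_cast this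
    rw [sg_true]; linarith

theorem sg_mul_sg (b : Bool) : sg b * sg b = 1 := by cases b <;> simp [sg]

theorem sg_lerp (b : Bool) (t A B : ℝ) :
    sg b * ((1 - t) * A + t * (sg b * B)) = (1 - t) * (sg b * A) + t * B := by
  linear_combination t * B * sg_mul_sg b

/-- The heart of the isotopy. By `sep` two markings of one half in different rows are ordered either
horizontally or vertically, with the same order in the grid and in the tree, for markings and for
apices. This order persists under interpolation in both the time `t` and the position `s` on the
slope. Conjugate markings have different abscissae and one apex, so their slopes meet only there. -/
theorem planar_sep {t s : ℝ} (ht0 : 0 ≤ t) (ht1 : t ≤ 1) (hs0 : 0 ≤ s) (hs1 : s ≤ 1) (b : Bool)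
    (a a' : Fin n × Bool) (hne : a ≠ a')
    (h1 : (1 - s) * posX (H := H) t (b, a) + s * apexX (H := H) t (b, a) =
      (1 - s) * posX (H := H) t (b, a') + s * apexX (H := H) t (b, a'))
    (h2 : (1 - s) * posY (H := H) t (b, a) + s * apexY (H := H) t (b, a) =
      (1 - s) * posY (H := H) t (b, a') + s * apexY (H := H) t (b, a')) :
    s = 1 ∧ a' = (H b).conj a := by
  have xlt : ∀ a a', col a < col a' → posX (H := H) t (b, a) < posX (H := H) t (b, a') :=
    fun a a' h => lerp_lt_lerp ht0 ht1 (by exact_mod_cast h) ((H b).x_lt _ _ h)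
  by_cases hc : a' = (H b).conj a
  · refine ⟨?_, hc⟩
    have e : apexX (H := H) t (b, a') = apexX (H := H) t (b, a) := by
      rw [hc]; simp only [apexX, ξ₀_conj, ξ_conj]
    rw [e] at h1
    have : (1 - s) * (posX (H := H) t (b, a) - posX (H := H) t (b, a')) = 0 := by linarith
    rcases mul_eq_zero.1 this with h | h
    · linarith
    · rcases lt_trichotomy (col a) (col a') with h' | h' | h'
      · linarith [xlt _ _ h']
      · exact absurd (col_injective h') hne
      · linarith [xlt _ _ h']
  · have key1 : ∀ a a', col a < col a' → (H b).ξ₀ a < (H b).ξ₀ a' → (H b).ξ a < (H b).ξ a' →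
        (1 - s) * posX (H := H) t (b, a) + s * apexX (H := H) t (b, a) <
          (1 - s) * posX (H := H) t (b, a') + s * apexX (H := H) t (b, a') := fun a a' u v w =>
      lerp_lt_lerp hs0 hs1 (xlt _ _ u) (lerp_lt_lerp ht0 ht1 v w)
    have key2 : ∀ a a', (H b).row a < (H b).row a' → (H b).h a < (H b).h a' →
        (H b).g a < (H b).g a' →
        sg b * ((1 - s) * posY (H := H) t (b, a) + s * apexY (H := H) t (b, a)) <
          sg b * ((1 - s) * posY (H := H) t (b, a') + s * apexY (H := H) t (b, a')) := by
      intro a a' u v w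
      have e1 : sg b * posY (H := H) t (b, a) < sg b * posY (H := H) t (b, a') := by
        simp only [posY, sg_lerp]
        exact lerp_lt_lerp ht0 ht1 (mark_lt_of_row_lt u) v
      have e2 : sg b * apexY (H := H) t (b, a) < sg b * apexY (H := H) t (b, a') := by
        simp only [apexY, sg_lerp]
        exact lerp_lt_lerp ht0 ht1 (mark_lt_of_row_lt u) w
      have := lerp_lt_lerp hs0 hs1 e1 e2
      linarith
    rcases (H b).sep a a' hne hc with h | h | h | h
    · exact absurd h1 (key1 _ _ h.1 h.2.1 h.2.2).ne
    · exact absurd h1 (key1 _ _ h.1 h.2.1 h.2.2).ne'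
    · have := key2 _ _ h.1 h.2.1 h.2.2
      rw [h2] at this
      exact absurd this (lt_irrefl _)
    · have := key2 _ _ h.1 h.2.1 h.2.2
      rw [h2] at this
      exact absurd this (lt_irrefl _)

theorem level_lt {t : ℝ} (ht0 : 0 ≤ t) (ht1 : t ≤ 1) : level n t false < level n t true := by
  simp only [level, sg]
  refine lerp_lt_lerp ht0 ht1 ?_ ?_ <;> norm_num

theorem level_lt_top {t u : ℝ} (ht0 : 0 ≤ t) (ht1 : t ≤ 1) (hu : 1 < u) (a) :
    level n t true < (1 - t) * ((mark H (true, a)).2 : ℝ) + t * (sg true * u) := by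
  have : (n : ℝ) + 1 ≤ (mark H (true, a)).2 := by
    exact_mod_cast (side_iff H (true, a)).1 rfl
  simp only [level, sg_true, if_true]
  exact lerp_lt_lerp ht0 ht1 (by linarith) (by linarith)

theorem bottom_lt_level {t u : ℝ} (ht0 : 0 ≤ t) (ht1 : t ≤ 1) (hu : 1 < u) (a) :
    (1 - t) * ((mark H (false, a)).2 : ℝ) + t * (sg false * u) < level n t false := by
  have : ((mark H (false, a)).2 : ℝ) ≤ n := by
    have := (side_iff H (false, a)).not
    simp only [Bool.false_eq_true, not_false_iff, true_iff, not_lt] at this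
    exact_mod_cast this
  simp only [level, sg_false, Bool.false_eq_true, if_false]
  exact lerp_lt_lerp ht0 ht1 (by linarith) (by linarith)

variable (f) in
/-- The positions of the tent vertices during the planar motion. -/
def planar (t : ℝ) : TentVertex (Set.range (mark H)) (Set.Icc 1 (2 * n)) → Pt :=
  TentFrame.pos (fun w => (posX (H := H) t (idx w), posY (H := H) t (idx w), 1 - t))
    (fun w => (posX (H := H) t (idx w), level n t (idx w).1, 0))
    (fun r => (apexX (H := H) t (idx (f.out r)), apexY (H := H) t (idx (f.out r)), 1 - t + 1))

theorem planar_embedded (hf : IsGridFrame f) {t : ℝ} (ht0 : 0 ≤ t) (ht1 : t ≤ 1) :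
    f.Embedded (fun w => (posX (H := H) t (idx w), posY (H := H) t (idx w), 1 - t))
    (fun w => (posX (H := H) t (idx w), level n t (idx w).1, 0))
    (fun r => (apexX (H := H) t (idx (f.out r)), apexY (H := H) t (idx (f.out r)), 1 - t + 1)) := by
  refine f.embedded_of_planar (fun w => (idx w).1) (fun w => w.1.1) _ _ (level n t) _ _ _
    (by linarith) (level_lt ht0 ht1) (fun w => by rw [idx_κ hf]) hf.col_κ
    (fun w w' h => (hf.col w w').1 h) ?_ ?_ ?_ ?_
  · intro w w' h1 h2
    simp only [posX]
    rw [← h1]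
    rw [← col_idx, ← col_idx] at h2
    exact lerp_lt_lerp ht0 ht1 (by exact_mod_cast h2) ((H _).x_lt _ _ h2)
  · intro w hw
    rw [apexY_out_row hf]
    generalize idx w = v at hw ⊢
    obtain ⟨b, a⟩ := v
    obtain rfl : b = _ := hw
    exact ⟨level_lt_top ht0 ht1 ((H _).one_lt_h _) _, level_lt_top ht0 ht1 ((H _).one_lt_g _) _⟩
  · intro w hw
    rw [apexY_out_row hf]
    generalize idx w = v at hw ⊢
    obtain ⟨b, a⟩ := v
    obtain rfl : b = _ := hw
    exact ⟨bottom_lt_level ht0 ht1 ((H _).one_lt_h _) _,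
      bottom_lt_level ht0 ht1 ((H _).one_lt_g _) _⟩
  · intro w w' hne hside s hs0 hs1 h1 h2
    rw [apexX_out_row hf, apexX_out_row hf] at h1
    rw [apexY_out_row hf, apexY_out_row hf] at h2
    have hi : (idx w').2 ≠ (idx w).2 := fun h => hne (idx_inj (Prod.ext hside h.symm))
    have e' : idx w' = ((idx w).1, (idx w').2) := Prod.ext hside.symm rfl
    rw [e'] at h1 h2
    obtain ⟨q1, q2⟩ := planar_sep ht0 ht1 hs0 hs1 (idx w).1 (idx w).2 (idx w').2 hi.symm h1 h2
    refine ⟨q1, (f.row_eq_iff _ _).2 (Or.inr (idx_inj ?_))⟩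
    rw [idx_π hf, e', q2]

theorem equiv_planar (hf : IsGridFrame f) [Finite (Set.range (mark H))] :
    OrientedLinkEquiv (poly f.perm (planar f 0)) (poly f.perm (planar f 1)) := by
  refine orientedLinkEquiv_of_motion f.perm (planar f) ?_ ?_
  · intro v
    rcases v with w | w | r <;>
      simp only [planar, TentFrame.pos, posX, posY, apexX, apexY, level] <;> fun_prop
  · rintro t ⟨h0, h1⟩
    exact (planar_embedded hf h0 h1).isGoodPosition

/-- A preliminary motion within the columns: the lower vertices move to the levels `n + 3/4` and `n
+ 1/4`, between the two halves of the grid. -/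
theorem equiv_planar_zero (hf : IsGridFrame f) [Finite (Set.range (mark H))] :
    OrientedLinkEquiv f.gridOrientation (poly f.perm (planar f 0)) := by
  refine (hf.equiv_gridOrientation
    fun r => apexX (H := H) 0 (idx (f.out r))).2.symm.trans ?_
  let p : ℝ → TentVertex (Set.range (mark H)) (Set.Icc 1 (2 * n)) → Pt := fun t =>
    TentFrame.pos (fun w : Set.range (mark H) => ((w.1.1 : ℝ), (w.1.2 : ℝ), 1))
    (fun w => ((w.1.1 : ℝ), (1 - t) * (w.1.2 : ℝ) + t * level n 0 (idx w).1, 0))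
    (fun r => (apexX (H := H) 0 (idx (f.out r)), (r.1 : ℝ), 2))
  have h := orientedLinkEquiv_of_motion f.perm p ?_ ?_
  · have e0 : p 0 = TentFrame.pos
        (fun w : Set.range (mark H) => ((w.1.1 : ℝ), (w.1.2 : ℝ), 1))
        (fun w => ((w.1.1 : ℝ), (w.1.2 : ℝ), 0))
        (fun r => (apexX (H := H) 0 (idx (f.out r)), (r.1 : ℝ), 2)) := by simp [p]
    have e1 : p 1 = planar f 0 := by
      have hr : ∀ r : Set.Icc 1 (2 * n), (r.1 : ℝ) = ((f.out r).1.2 : ℝ) := fun r => by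
        rw [← hf.row, f.row_out]
      funext v
      rcases v with w | w | r
      · simp [p, planar, TentFrame.pos, posX, posY, col_idx, mark_idx]
      · simp [p, planar, TentFrame.pos, posX, col_idx]
      · simp only [p, planar, TentFrame.pos, apexY, mark_idx, hr]
        norm_num
    rwa [e0, e1] at h
  · intro v
    rcases v with w | w | r <;> simp only [p, TentFrame.pos] <;> fun_prop
  · rintro t ⟨h0, h1⟩
    refine (hf.embedded _ _ (fun _ => 0) _ _ ?_ ?_ ?_ ?_ ?_).isGoodPosition
    · simp
    · simp
    · simp
    · simp
    · intro w h
      have h3 : (w.1.2 : ℝ) < (f.κ w).1.2 := by exact_mod_cast h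
      refine lerp_lt_lerp h0 h1 h3 ?_
      rw [idx_κ hf]
      -- A column has one marking in each half, so its lower marking belongs to the lower half.
      have : (idx w).1 = false := by
        by_contra hb
        rw [Bool.not_eq_false] at hb
        have h4 := (side_iff H _).1 hb
        have h5 := (side_iff H (idx (f.κ w))).not
        rw [idx_κ hf, hb] at h5
        simp only [Bool.not_true, Bool.false_eq_true, not_false_iff, true_iff] at h5
        rw [← mark_idx w, ← mark_idx (f.κ w), idx_κ hf, hb] at h
        simp only [Bool.not_true] at h
        omega
      rw [this]
      exact level_lt le_rfl zero_le_one

end HalfDiagram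

/-! ### Flattening the rows at the root -/

namespace HalfDiagram

variable {n : ℕ} {H : Bool → HalfDiagram n}

/-- The vertices of the tree diagrams. -/
def leafPt (v : Bool × Fin n × Bool) : Pt := ((H v.1).x v.2, sg v.1 * (H v.1).h v.2, 0)
def footPt (v : Bool × Fin n × Bool) : Pt := ((H v.1).x v.2, sg v.1, 0)
def apexPt (v : Bool × Fin n × Bool) : Pt := ((H v.1).ξ v.2, sg v.1 * (H v.1).g v.2, 1)

variable (H) in
/-- The two markings next to the root. -/
def AtRoot (v : Bool × Fin n × Bool) : Prop := v.2 = (H v.1).root ∨ v.2 = (H v.1).conj (H v.1).root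

theorem atRoot_conj (b : Bool) (a : Fin n × Bool) :
    AtRoot H (b, (H b).conj a) ↔ AtRoot H (b, a) := by
  have : ∀ a a', (H b).conj a = a' ↔ a = (H b).conj a' := fun a a' =>
    ⟨fun h => by rw [← h, conj_conj], fun h => by rw [h, conj_conj]⟩
  simp only [AtRoot]
  rw [this, this, conj_conj, or_comm]

theorem leafPt_root (b : Bool) : leafPt (H := H) (b, (H b).root) = (0, sg b * 3, 0) := by
  simp [leafPt, x_root, h_root]

theorem leafPt_conj_root (b : Bool) :
    leafPt (H := H) (b, (H b).conj (H b).root) = (1 / 2, sg b * 2, 0) := by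
  simp [leafPt, x_conj_root, h_conj_root]

theorem apexPt_root (b : Bool) : apexPt (H := H) (b, (H b).root) = (1 / 4, sg b * (5 / 2), 1) := by
  simp [apexPt, ξ_root, g_root]

theorem apexPt_conj (b : Bool) (a : Fin n × Bool) :
    apexPt (H := H) (b, (H b).conj a) = apexPt (H := H) (b, a) := by
  simp [apexPt, ξ_conj, g_conj]

/-- The triangle at the root. -/
def rootTriangle (b : Bool) : Set Pt :=
  convexHull ℝ {(0, sg b * 3, 0), (1 / 2, sg b * 2, 0), (1 / 4, sg b * (5 / 2), 1)}

theorem exists_of_mem_rootTriangle {b : Bool} {p : Pt} (hp : p ∈ rootTriangle b) :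
    ∃ β γ : ℝ, 0 ≤ β ∧ 0 ≤ γ ∧ β + γ ≤ 1 ∧ p = (β / 2 + γ / 4, sg b * (3 - β - γ / 2), γ) := by
  obtain ⟨α, β, γ, h1, h2, h3, h4, rfl⟩ := mem_hull_triple.1 hp
  refine ⟨β, γ, h2, h3, by linarith, ?_⟩
  obtain rfl : α = 1 - β - γ := by linarith
  ext <;> simp <;> ring

theorem AtRoot.hull {v : Bool × Fin n × Bool} (hv : AtRoot H v) :
    convexHull ℝ {leafPt (H := H) v, leafPt (H := H) (v.1, (H v.1).conj v.2), apexPt (H := H) v} =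
      rootTriangle v.1 ∧ ∀ p, (p = leafPt (H := H) v ∨
        p = leafPt (H := H) (v.1, (H v.1).conj v.2)) ↔
        (p = (0, sg v.1 * 3, 0) ∨ p = (1 / 2, sg v.1 * 2, 0)) := by
  obtain ⟨b, a⟩ := v
  rcases hv with h | h
  · obtain rfl : a = (H b).root := h
    simp only [leafPt_root, leafPt_conj_root, apexPt_root, rootTriangle, implies_true, and_self]
  · obtain rfl : a = (H b).conj (H b).root := h
    simp only [leafPt_root, leafPt_conj_root, apexPt_root, apexPt_conj, conj_conj]
    exact ⟨by rw [rootTriangle, Set.insert_comm], fun p => or_comm⟩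

/-- At level `0` the triangle lies at distance between `2` and `3` from the horizontal axis, higher
than all legs except the two below its own corners. -/
theorem rootTriangle_leg {b : Bool} {v : Bool × Fin n × Bool} {p : Pt} (hp : p ∈ rootTriangle b)
    (hp' : p ∈ segment ℝ (leafPt (H := H) v) (footPt (H := H) v)) :
    p = (0, sg b * 3, 0) ∨ p = (1 / 2, sg b * 2, 0) := by
  obtain ⟨β, γ, h1, h2, h3, rfl⟩ := exists_of_mem_rootTriangle hp
  obtain ⟨t, h0, h1, e1, e2, e3⟩ := exists_of_mem_segment hp'
  obtain ⟨b', a⟩ := v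
  simp only [leafPt, footPt] at e1 e2 e3
  obtain rfl : γ = 0 := by linarith
  have l1 := le_lerp h0 h1 ((H b').one_lt_h a).le le_rfl
  have hb : (1 - t) * (H b').h a + t * 1 = 3 - β ∧ b = b' := by
    cases b <;> cases b' <;> simp only [sg_true, sg_false] at e2 <;> simp <;> linarith
  obtain ⟨hb, rfl⟩ := hb
  by_cases ha : a = (H b).root
  · left
    rw [ha, x_root] at e1
    obtain rfl : β = 0 := by linarith
    norm_num
  by_cases ha' : a = (H b).conj (H b).root
  · right
    rw [ha', x_conj_root] at e1
    obtain rfl : β = 1 := by linarith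
    norm_num
  · have := lerp_lt h0 h1 ((H b).h_lt_two a ha ha') one_lt_two
    linarith

/-- At level `γ` the triangle is at height at least `2 + γ/2`, while the other slopes stay at height
at most `2`, with strict inequality below level `1`. -/
theorem rootTriangle_branch {b : Bool} {v : Bool × Fin n × Bool} {p : Pt} (hv : ¬ AtRoot H v)
    (hp : p ∈ rootTriangle b) : p ∉ segment ℝ (leafPt (H := H) v) (apexPt (H := H) v) := by
  intro hp'
  obtain ⟨β, γ, h1, h2, h3, rfl⟩ := exists_of_mem_rootTriangle hp
  obtain ⟨t, h0, h1, e1, e2, e3⟩ := exists_of_mem_segment hp'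
  obtain ⟨b', a⟩ := v
  simp only [AtRoot, not_or] at hv
  simp only [leafPt, apexPt] at e1 e2 e3
  obtain rfl : γ = t := by linarith
  have l1 := le_lerp h0 h1 ((H b').one_lt_h a).le ((H b').one_lt_g a).le
  have hb : (1 - γ) * (H b').h a + γ * (H b').g a = 3 - β - γ / 2 ∧ b = b' := by
    cases b <;> cases b' <;> simp only [sg_true, sg_false] at e2 <;> simp <;> linarith
  obtain ⟨hb, rfl⟩ := hb
  have a1 := (H b).h_lt_two a hv.1 hv.2
  have a2 := (H b).g_le_two a hv.1 hv.2
  rcases h1.eq_or_lt with rfl | h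
  · linarith
  · have := lerp_lt_lerp_of_lt h0 h a1 a2
    linarith

theorem rootTriangle_disjoint {b b' : Bool} (h : b ≠ b') {p : Pt} (hp : p ∈ rootTriangle b) :
    p ∉ rootTriangle b' := by
  intro hp'
  obtain ⟨β, γ, h1, h2, h3, rfl⟩ := exists_of_mem_rootTriangle hp
  obtain ⟨β', γ', h1', h2', h3', e⟩ := exists_of_mem_rootTriangle hp'
  have e2 : sg b * (3 - β - γ / 2) = sg b' * (3 - β' - γ' / 2) := congrArg (fun p : Pt => p.2.1) e
  cases b <;> cases b' <;> simp only [sg_true, sg_false] at e2 <;> simp at h <;> linarith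

theorem rootTriangle_middle {b : Bool} {v v' : Bool × Fin n × Bool} {p : Pt}
    (hp : p ∈ rootTriangle b) : p ∉ segment ℝ (footPt (H := H) v) (footPt (H := H) v') := by
  intro hp'
  obtain ⟨β, γ, h1, h2, h3, rfl⟩ := exists_of_mem_rootTriangle hp
  obtain ⟨t, h0, h1, e1, e2, e3⟩ := exists_of_mem_segment hp'
  obtain ⟨c, a⟩ := v
  obtain ⟨c', a'⟩ := v'
  simp only [footPt] at e2
  cases b <;> cases c <;> cases c' <;> simp only [sg_true, sg_false] at e2 <;> linarith

variable {f : TentFrame (Set.range (mark H)) (Set.Icc 1 (2 * n))}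

/-- The final tent link differs from the tree link only at the two roots, where the left strand is
joined directly to the top edge of the tree; the root triangles are free. -/
theorem equiv_treeLink (hf : IsGridFrame f) :
    LinkEquiv (gridLink (Set.range (mark H))) (treeLink H) := by
  have : Finite (Set.range (mark H)) := (isGridDiagram H).finite
  have hL : ∀ w : Set.range (mark H), ((posX (H := H) 1 (idx w), posY (H := H) 1 (idx w), 1 - 1) : Pt) =
      leafPt (H := H) (idx w) := fun w => by simp [posX, posY, leafPt]
  have hM : ∀ w : Set.range (mark H), ((posX (H := H) 1 (idx w), level n 1 (idx w).1, 0) : Pt) =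
      footPt (H := H) (idx w) := fun w => by simp [posX, level, footPt]
  have hU : ∀ r, ((apexX (H := H) 1 (idx (f.out r)), apexY (H := H) 1 (idx (f.out r)), 1 - 1 + 1)
      : Pt) = apexPt (H := H) (idx (f.out r)) := fun w => by simp [apexX, apexY, apexPt]
  have hUrow : ∀ w, apexPt (H := H) (idx (f.out (f.row w))) = apexPt (H := H) (idx w) := fun w =>
    apply_out_row hf (fun b a => apexPt (H := H) (b, a)) apexPt_conj w
  have hProw : ∀ w, AtRoot H (idx (f.out (f.row w))) ↔ AtRoot H (idx w) := fun w => by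
    rw [← apply_out_row hf (fun b a => AtRoot H (b, a)) (fun b a => propext (atRoot_conj b a)) w]
  have emb := planar_embedded hf zero_le_one le_rfl
  have equiv := (equiv_planar_zero hf).trans (equiv_planar hf)
  unfold planar at equiv
  simp only [hL, hM, hU] at emb equiv
  have hA : ∀ (w w' : Set.range (mark H)) (x : Pt), AtRoot H (idx (f.out (f.row w))) →
      x ∈ convexHull ℝ {leafPt (H := H) (idx w), leafPt (H := H) (idx (f.π w)),
        apexPt (H := H) (idx (f.out (f.row w)))} →
      x ∈ segment ℝ (leafPt (H := H) (idx w')) (footPt (H := H) (idx w')) →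
      x = leafPt (H := H) (idx w) ∨ x = leafPt (H := H) (idx (f.π w)) := by
    intro w w' x hP hx hx'
    rw [hProw] at hP
    rw [hUrow, idx_π hf, hP.hull.1] at hx
    rw [idx_π hf, hP.hull.2]
    exact rootTriangle_leg hx hx'
  have hB : ∀ (w w' : Set.range (mark H)) (x : Pt), AtRoot H (idx (f.out (f.row w))) →
      f.row w ≠ f.row w' → x ∈ convexHull ℝ {leafPt (H := H) (idx w), leafPt (H := H) (idx (f.π w)),
        apexPt (H := H) (idx (f.out (f.row w)))} →
      x ∈ segment ℝ (leafPt (H := H) (idx w')) (apexPt (H := H) (idx (f.out (f.row w')))) →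
      x = leafPt (H := H) (idx w) ∨ x = leafPt (H := H) (idx (f.π w)) := by
    intro w w' x hP hne hx hx'
    rw [hProw] at hP
    rw [hUrow, idx_π hf, hP.hull.1] at hx
    rw [hUrow] at hx'
    by_cases hP' : AtRoot H (idx w')
    · by_cases hs : (idx w).1 = (idx w').1
      · refine absurd ((f.row_eq_iff _ _).2 ?_) hne
        rcases hP with h | h <;> rcases hP' with h' | h' <;> rw [← hs] at h'
        · exact Or.inl (idx_inj (Prod.ext hs.symm (h'.trans h.symm)))
        · exact Or.inr (idx_inj (by rw [idx_π hf, h]; exact Prod.ext hs.symm h'))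
        · exact Or.inr (idx_inj (by rw [idx_π hf, h, conj_conj]; exact Prod.ext hs.symm h'))
        · exact Or.inl (idx_inj (Prod.ext hs.symm (h'.trans h.symm)))
      · refine absurd ?_ (rootTriangle_disjoint hs hx)
        rw [← hP'.hull.1]
        exact (convex_convexHull ℝ _).segment_subset (subset_convexHull ℝ _ (by simp))
          (subset_convexHull ℝ _ (by simp)) hx'
    · exact absurd hx' (rootTriangle_branch hP' hx)
  have hK : ∀ (w w' : Set.range (mark H)) (x : Pt), AtRoot H (idx (f.out (f.row w))) →
      x ∈ convexHull ℝ {leafPt (H := H) (idx w), leafPt (H := H) (idx (f.π w)),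
        apexPt (H := H) (idx (f.out (f.row w)))} →
      x ∈ segment ℝ (footPt (H := H) (idx w')) (footPt (H := H) (idx (f.κ w'))) →
      x = leafPt (H := H) (idx w) ∨ x = leafPt (H := H) (idx (f.π w)) := by
    intro w w' x hP hx hx'
    rw [hProw] at hP
    rw [hUrow, idx_π hf, hP.hull.1] at hx
    exact absurd hx' (rootTriangle_middle hx)
  have hT : ∀ (w w' : Set.range (mark H)) (x : Pt), AtRoot H (idx (f.out (f.row w))) →
      AtRoot H (idx (f.out (f.row w'))) →
      f.row w ≠ f.row w' → x ∈ convexHull ℝ {leafPt (H := H) (idx w), leafPt (H := H) (idx (f.π w)),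
        apexPt (H := H) (idx (f.out (f.row w)))} →
      x ∈ convexHull ℝ {leafPt (H := H) (idx w'), leafPt (H := H) (idx (f.π w')),
        apexPt (H := H) (idx (f.out (f.row w')))} →
      x = leafPt (H := H) (idx w) ∨ x = leafPt (H := H) (idx (f.π w)) := by
    intro w w' x hP hP' hne hx hx'
    rw [hProw] at hP hP'
    rw [hUrow, idx_π hf, hP.hull.1] at hx
    rw [hUrow, idx_π hf, hP'.hull.1] at hx'
    by_cases hs : (idx w).1 = (idx w').1
    · refine absurd ((f.row_eq_iff _ _).2 ?_) hne
      rcases hP with h | h <;> rcases hP' with h' | h' <;> rw [← hs] at h'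
      · exact Or.inl (idx_inj (Prod.ext hs.symm (h'.trans h.symm)))
      · exact Or.inr (idx_inj (by rw [idx_π hf, h]; exact Prod.ext hs.symm h'))
      · exact Or.inr (idx_inj (by rw [idx_π hf, h, conj_conj]; exact Prod.ext hs.symm h'))
      · exact Or.inl (idx_inj (Prod.ext hs.symm (h'.trans h.symm)))
    · exact absurd hx' (rootTriangle_disjoint hs hx)
  obtain ⟨D, h1, h2, h3⟩ := f.remove_tops emb (fun r => AtRoot H (idx (f.out r))) hA hB hK hT
  have h4 := (equiv.trans h2).linkEquiv
  rw [hf.forget_gridOrientation] at h4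
  convert h4 using 1
  ext e
  rw [f.mem_forget_remove_tops (L := fun w => leafPt (H := H) (idx w))
    (M := fun w => footPt (H := H) (idx w)) (U := fun r => apexPt (H := H) (idx (f.out r)))
    (P := fun r => AtRoot H (idx (f.out r))) h3]
  simp only [hProw, hUrow, idx_π hf, idx_κ hf]
  rw [← idx_surjective.exists (p := fun v => e = s(leafPt (H := H) v, footPt (H := H) v) ∨
    (¬ AtRoot H v ∧ e = s(apexPt (H := H) v, leafPt (H := H) v)) ∨
    (AtRoot H v ∧ e = s(leafPt (H := H) v, leafPt (H := H) (v.1, (H v.1).conj v.2))) ∨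
    e = s(footPt (H := H) v, footPt (H := H) (!v.1, v.2)))]
  constructor
  · rintro (((⟨b, a, rfl⟩ | ⟨b, a, ha, ha', rfl⟩) | ⟨b, rfl⟩) | ⟨a, rfl⟩)
    · exact ⟨(b, a), Or.inl rfl⟩
    · exact ⟨(b, a), Or.inr (Or.inl ⟨not_or.2 ⟨ha, ha'⟩, rfl⟩)⟩
    · refine ⟨(b, (H b).root), Or.inr (Or.inr (Or.inl ⟨Or.inl rfl, ?_⟩))⟩
      rw [leafPt_root, leafPt_conj_root]
    · exact ⟨(true, a), Or.inr (Or.inr (Or.inr rfl))⟩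
  · rintro ⟨⟨b, a⟩, rfl | ⟨hn, rfl⟩ | ⟨hn, rfl⟩ | rfl⟩
    · exact Or.inl (Or.inl (Or.inl ⟨b, a, rfl⟩))
    · exact Or.inl (Or.inl (Or.inr ⟨b, a, (not_or.1 hn).1, (not_or.1 hn).2, rfl⟩))
    · refine Or.inl (Or.inr ⟨b, ?_⟩)
      rcases hn with h | h
      · obtain rfl : a = (H b).root := h
        rw [leafPt_root, leafPt_conj_root]
      · obtain rfl : a = (H b).conj (H b).root := h
        simp only [conj_conj]
        rw [leafPt_root, leafPt_conj_root, Sym2.eq_swap]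
    · cases b
      · exact Or.inr ⟨a, Sym2.eq_swap⟩
      · exact Or.inr ⟨a, rfl⟩

end HalfDiagram

/-! ## Standard dyadic intervals -/

namespace SDInterval

theorem ext_val {A B : SDInterval} (h1 : A.1.1 = B.1.1) (h2 : A.1.2 = B.1.2) : A = B :=
  Subtype.ext (Prod.ext h1 h2)

theorem two_pow_pos (m : ℕ) : (0 : ℝ) < 2 ^ m := by positivity

theorem len_eq (A : SDInterval) : A.len = 1 / 2 ^ A.1.1 := by
  simp only [len, hi, lo]
  ring

theorem len_pos (A : SDInterval) : 0 < A.len := by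
  rw [len_eq]
  positivity

theorem lo_lt_mid (A : SDInterval) : A.lo < A.mid := by
  have := A.len_pos
  simp only [len, mid] at *
  linarith

theorem mid_lt_hi (A : SDInterval) : A.mid < A.hi := by
  have := A.len_pos
  simp only [len, mid] at *
  linarith

theorem lo_nonneg (A : SDInterval) : 0 ≤ A.lo := by
  simp only [lo]
  positivity

theorem hi_le_one (A : SDInterval) : A.hi ≤ 1 := by
  rw [hi, div_le_one (two_pow_pos _)]
  exact_mod_cast A.2

/-- No point of a coarser grid lies inside a dyadic interval. -/
theorem grid (A : SDInterval) {m : ℕ} (h : m ≤ A.1.1) (j : ℕ) :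
    (j : ℝ) / 2 ^ m ≤ A.lo ∨ A.hi ≤ (j : ℝ) / 2 ^ m := by
  obtain ⟨d, hd⟩ := Nat.exists_eq_add_of_le h
  have e : (j : ℝ) / 2 ^ m = ((j * 2 ^ d : ℕ) : ℝ) / 2 ^ A.1.1 := by
    rw [hd, pow_add]
    push_cast
    field_simp
  rw [e, lo, hi]
  rcases le_or_gt (j * 2 ^ d) A.1.2 with h | h
  · left
    gcongr
  · right
    have : ((A.1.2 : ℝ) + 1) ≤ ((j * 2 ^ d : ℕ) : ℝ) := by exact_mod_cast h
    gcongr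

theorem grid_lo (A : SDInterval) {B : SDInterval} (h : B.1.1 ≤ A.1.1) :
    B.lo ≤ A.lo ∨ A.hi ≤ B.lo := A.grid h B.1.2

theorem grid_hi (A : SDInterval) {B : SDInterval} (h : B.1.1 ≤ A.1.1) :
    B.hi ≤ A.lo ∨ A.hi ≤ B.hi := by
  have := A.grid h (B.1.2 + 1)
  push_cast at this
  exact this

theorem mid_eq (A : SDInterval) : A.mid = ((2 * A.1.2 + 1 : ℕ) : ℝ) / 2 ^ (A.1.1 + 1) := by
  simp only [mid, lo, hi, pow_succ]
  push_cast
  field_simp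
  ring

theorem grid_mid (A : SDInterval) {B : SDInterval} (h : B.1.1 < A.1.1) :
    B.mid ≤ A.lo ∨ A.hi ≤ B.mid := by
  rw [mid_eq]
  exact A.grid h _

/-- For intervals of different levels, the midpoint of the longer one would be a coarser grid point
in the interior of the shorter one. -/
theorem mid_injective {A B : SDInterval} (h : A.mid = B.mid) : A = B := by
  have key : ∀ {A B : SDInterval}, A.mid = B.mid → B.1.1 ≤ A.1.1 := by
    intro A B h
    by_contra hn
    rcases B.grid_mid (not_le.1 hn) with h' | h'
    · linarith [B.lo_lt_mid]
    · linarith [B.mid_lt_hi]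
  have e := le_antisymm (key h.symm) (key h)
  rw [mid_eq, mid_eq, e, div_left_inj' (two_pow_pos _).ne'] at h
  have : 2 * A.1.2 + 1 = 2 * B.1.2 + 1 := by exact_mod_cast h
  exact ext_val e (by omega)

theorem eq_unit_iff {A : SDInterval} : A = unit ↔ A.1.1 = 0 := by
  constructor
  · rintro rfl; rfl
  · intro h
    have := A.2
    rw [h, pow_zero] at this
    exact ext_val h (by simp only [unit]; omega)

theorem len_unit : unit.len = 1 := by simp [len_eq, unit]
theorem mid_unit : unit.mid = 1 / 2 := by simp [mid_eq, unit]

theorem len_eq_iff {A B : SDInterval} : A.len = B.len ↔ A.1.1 = B.1.1 := by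
  constructor
  · intro h
    rw [len_eq, len_eq, one_div, one_div, inv_inj] at h
    exact pow_right_injective₀ (by norm_num : (0 : ℝ) < 2) (by norm_num) h
  · intro h
    rw [len_eq, len_eq, h]

theorem len_eq_one_iff {A : SDInterval} : A.len = 1 ↔ A = unit := by
  rw [eq_unit_iff, ← len_unit, len_eq_iff]
  rfl

theorem len_le_one (A : SDInterval) : A.len ≤ 1 := by
  have := A.lo_nonneg
  have := A.hi_le_one
  rw [len]
  linarith

/-- The interval of which `A` is a half. -/
def parent (A : SDInterval) : SDInterval := ⟨(A.1.1 - 1, A.1.2 / 2), by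
  have h := A.2
  rcases Nat.eq_zero_or_pos A.1.1 with h0 | h0
  · rw [h0] at h ⊢
    simp only [pow_zero] at h ⊢
    omega
  · obtain ⟨m, hm⟩ := Nat.exists_eq_succ_of_ne_zero h0.ne'
    rw [hm, Nat.succ_eq_add_one, pow_succ] at h
    simp only [hm, Nat.succ_eq_add_one, Nat.add_sub_cancel]
    omega⟩

theorem isHalfOf_iff {A B : SDInterval} : A.IsHalfOf B ↔ A ≠ unit ∧ B = parent A := by
  rw [Ne, eq_unit_iff]
  constructor
  · rintro ⟨h1, h2⟩
    exact ⟨by omega, ext_val (by simp only [parent]; omega) h2.symm⟩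
  · rintro ⟨h, rfl⟩
    exact ⟨by simp only [parent]; omega, rfl⟩

theorem conj_val {A : SDInterval} (h : A ≠ unit) : (conj A).1 =
    (A.1.1, if A.1.2 % 2 = 0 then A.1.2 + 1 else A.1.2 - 1) := by
  rw [Ne, eq_unit_iff] at h
  rw [conj, dif_neg h]

theorem conj_level {A : SDInterval} (h : A ≠ unit) : (conj A).1.1 = A.1.1 := by rw [conj_val h]

theorem conj_index {A : SDInterval} (h : A ≠ unit) :
    (A.1.2 % 2 = 0 ∧ (conj A).1.2 = A.1.2 + 1) ∨ (A.1.2 % 2 = 1 ∧ (conj A).1.2 + 1 = A.1.2) := by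
  have e : (conj A).1.2 = if A.1.2 % 2 = 0 then A.1.2 + 1 else A.1.2 - 1 := by rw [conj_val h]
  rw [e]
  split_ifs with h' <;> omega

theorem conj_ne_unit {A : SDInterval} (h : A ≠ unit) : conj A ≠ unit := by
  rw [Ne, eq_unit_iff, conj_level h, ← eq_unit_iff]
  exact h

theorem conj_ne {A : SDInterval} (h : A ≠ unit) : conj A ≠ A := by
  intro e
  have := conj_index h
  rw [e] at this
  omega

theorem conj_conj {A : SDInterval} (h : A ≠ unit) : conj (conj A) = A := by
  refine ext_val ?_ ?_
  · rw [conj_level (conj_ne_unit h), conj_level h]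
  · have := conj_index h
    have := conj_index (conj_ne_unit h)
    omega

theorem parent_conj {A : SDInterval} (h : A ≠ unit) : parent (conj A) = parent A := by
  refine ext_val ?_ ?_
  · simp only [parent, conj_level h]
  · have := conj_index h
    simp only [parent]
    omega

theorem eq_or_eq_conj {A B : SDInterval} (hA : A ≠ unit) (hB : B ≠ unit)
    (h : parent A = parent B) : B = A ∨ B = conj A := by
  have h1 : A.1.1 - 1 = B.1.1 - 1 := congrArg (fun C : SDInterval => C.1.1) h
  have h2 : A.1.2 / 2 = B.1.2 / 2 := congrArg (fun C : SDInterval => C.1.2) h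
  have := conj_index hA
  have e := conj_level hA
  rw [Ne, eq_unit_iff] at hA hB
  by_cases hp : B.1.2 = A.1.2
  · exact Or.inl (ext_val (by omega) hp)
  · exact Or.inr (ext_val (by omega) (by omega))

theorem len_conj {A : SDInterval} (h : A ≠ unit) : (conj A).len = A.len :=
  len_eq_iff.2 (conj_level h)

theorem len_parent {A : SDInterval} (h : A ≠ unit) : (parent A).len = 2 * A.len := by
  rw [Ne, eq_unit_iff] at h
  obtain ⟨m, hm⟩ := Nat.exists_eq_succ_of_ne_zero h
  rw [len_eq, len_eq]
  simp only [parent, hm, Nat.succ_eq_add_one, Nat.add_sub_cancel, pow_succ]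
  field_simp

/-- A half of an interval shares one end with it; the other one is the midpoint. -/
theorem half_ends {A : SDInterval} (h : A ≠ unit) :
    (A.1.2 % 2 = 0 ∧ A.lo = (parent A).lo ∧ A.hi = (parent A).mid) ∨
    (A.1.2 % 2 = 1 ∧ A.lo = (parent A).mid ∧ A.hi = (parent A).hi) := by
  have hl := len_parent h
  rw [Ne, eq_unit_iff] at h
  obtain ⟨m, hm⟩ := Nat.exists_eq_succ_of_ne_zero h
  have p0 := two_pow_pos m
  rcases Nat.even_or_odd' A.1.2 with ⟨k, hk | hk⟩
  · have e : A.lo = (parent A).lo := by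
      have : (parent A).1 = (m, k) := Prod.ext (by simp [parent, hm]) (by simp only [parent]; omega)
      simp only [lo, this, hm, hk, Nat.succ_eq_add_one, pow_succ]
      push_cast
      field_simp
    refine Or.inl ⟨by omega, e, ?_⟩
    simp only [len, mid] at *
    linarith
  · have e : A.hi = (parent A).hi := by
      have : (parent A).1 = (m, k) := Prod.ext (by simp [parent, hm]) (by simp only [parent]; omega)
      simp only [hi, this, hm, hk, Nat.succ_eq_add_one, pow_succ]
      push_cast
      field_simp
      ring
    refine Or.inr ⟨by omega, ?_, e⟩
    simp only [len, mid] at *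
    linarith

theorem conj_ends {A : SDInterval} (h : A ≠ unit) :
    (A.lo = (parent A).lo ∧ A.hi = (parent A).mid ∧ (conj A).lo = (parent A).mid ∧
      (conj A).hi = (parent A).hi) ∨
    (A.lo = (parent A).mid ∧ A.hi = (parent A).hi ∧ (conj A).lo = (parent A).lo ∧
      (conj A).hi = (parent A).mid) := by
  have h2 := half_ends (conj_ne_unit h)
  rw [parent_conj h] at h2
  have h3 := conj_index h
  rcases half_ends h with h1 | h1
  · left
    rcases h2 with h2 | h2
    · omega
    · exact ⟨h1.2.1, h1.2.2, h2.2.1, h2.2.2⟩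
  · right
    rcases h2 with h2 | h2
    · exact ⟨h1.2.1, h1.2.2, h2.2.1, h2.2.2⟩
    · omega

theorem parent_lo_le {A : SDInterval} (h : A ≠ unit) : (parent A).lo ≤ A.lo := by
  have := (parent A).lo_lt_mid
  rcases half_ends h with h | h <;> linarith

theorem le_parent_hi {A : SDInterval} (h : A ≠ unit) : A.hi ≤ (parent A).hi := by
  have := (parent A).mid_lt_hi
  rcases half_ends h with h | h <;> linarith

theorem positive_unit : unit.Positive := trivial

theorem positive_conj {A : SDInterval} (h : A ≠ unit) : (conj A).Positive ↔ ¬ A.Positive := by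
  have h1 := conj_index h
  have h2 := conj_level h
  rw [Ne, eq_unit_iff] at h
  obtain ⟨m, hm⟩ := Nat.exists_eq_succ_of_ne_zero h
  simp only [Positive]
  rw [h2, hm, Nat.succ_eq_add_one]
  simp only [signAux]
  rcases h1 with ⟨h1, h3⟩ | ⟨h1, h3⟩
  · rw [if_neg (by omega), if_pos h1, h3, (by omega : (A.1.2 + 1) / 2 = A.1.2 / 2)]
  · rw [if_pos (by omega), if_neg (by omega), (by omega : (conj A).1.2 / 2 = A.1.2 / 2), not_not]

/-- Cancel factors of two until the numerator is odd. -/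
theorem exists_mid_eq (m : ℕ) : ∀ k : ℕ, 0 < k → k < 2 ^ m →
    ∃ B : SDInterval, B.mid = (k : ℝ) / 2 ^ m := by
  induction m with
  | zero => intro k h0 h1; simp at h1; omega
  | succ m ih =>
    intro k h0 h1
    rw [pow_succ] at h1
    rcases Nat.even_or_odd' k with ⟨j, rfl | rfl⟩
    · obtain ⟨B, hB⟩ := ih j (by omega) (by omega)
      refine ⟨B, ?_⟩
      rw [hB, pow_succ]
      push_cast
      field_simp
    · exact ⟨⟨(m, j), by simp only; omega⟩, by rw [mid_eq]⟩

theorem LenLE.refl (A : SDInterval) : A.LenLE A := Or.inr ⟨rfl, le_rfl⟩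

theorem LenLE.trans {A B C : SDInterval} (h : A.LenLE B) (h' : B.LenLE C) : A.LenLE C := by
  rcases h with h | ⟨h1, h2⟩ <;> rcases h' with h' | ⟨h1', h2'⟩
  · exact Or.inl (h.trans h')
  · exact Or.inl (h1' ▸ h)
  · exact Or.inl (h1 ▸ h')
  · exact Or.inr ⟨h1.trans h1', h2.trans h2'⟩

theorem LenLE.antisymm {A B : SDInterval} (h : A.LenLE B) (h' : B.LenLE A) : A = B := by
  rcases h with h | ⟨h1, h2⟩ <;> rcases h' with h' | ⟨h1', h2'⟩
  · exact absurd h h'.not_gt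
  · exact absurd h1' h.ne'
  · exact absurd h1 h'.ne'
  · exact mid_injective (le_antisymm h2 h2')

theorem LenLE.total (A B : SDInterval) : A.LenLE B ∨ B.LenLE A := by
  rcases lt_trichotomy A.len B.len with h | h | h
  · exact Or.inl (Or.inl h)
  · rcases le_total A.mid B.mid with h' | h'
    · exact Or.inl (Or.inr ⟨h, h'⟩)
    · exact Or.inr (Or.inr ⟨h.symm, h'⟩)
  · exact Or.inr (Or.inl h)

theorem lenLE_unit (A : SDInterval) : A.LenLE unit := by
  by_cases h : A = unit
  · rw [h]; exact .refl _
  · refine Or.inl (lt_of_le_of_ne (by rw [len_unit]; exact A.len_le_one) fun e => ?_)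
    exact h (eq_unit_iff.2 (len_eq_iff.1 e))

theorem len_le_half {A : SDInterval} (h : A ≠ unit) : A.len ≤ 1 / 2 := by
  have := len_parent h
  have := (parent A).len_le_one
  linarith

end SDInterval

/-! ## The columns and rows of a partition -/

namespace SDPartition

open SDInterval

variable {n : ℕ} (I : SDPartition n)

theorem pos {n : ℕ} (I : SDPartition n) : 0 < n := by
  rcases Nat.eq_zero_or_pos n with rfl | h
  · have := I.first.symm.trans I.last
    norm_num at this
  · exact h

theorem exists_between {x : ℝ} (h0 : 0 ≤ x) (h1 : x < 1) :
    ∃ i : Fin n, I.a i.castSucc ≤ x ∧ x < I.a i.succ := by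
  by_contra hn
  push Not at hn
  have : ∀ i, I.a i ≤ x := by
    intro i
    induction i using Fin.induction with
    | zero => rwa [I.first]
    | succ i ih => exact hn i ih
  have := this (Fin.last n)
  rw [I.last] at this
  linarith

theorem not_between (i : Fin n) (j : Fin (n + 1)) : I.a j ≤ I.a i.castSucc ∨ I.a i.succ ≤ I.a j := by
  rcases le_or_gt j i.castSucc with h | h
  · exact Or.inl (I.strictMono.monotone h)
  · exact Or.inr (I.strictMono.monotone (Fin.castSucc_lt_iff_succ_le.1 h))

/-- An interval with a breakpoint in its interior belongs to the tree. -/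
theorem mem_intervals_of_lt {B : SDInterval} {j : Fin (n + 1)} (h1 : B.lo < I.a j)
    (h2 : I.a j < B.hi) : B ∈ I.intervals := by
  constructor
  -- If an end of `B` were interior to a subinterval `A`, dyadic nesting would put `B` inside `A`,
  -- and the given breakpoint would be interior to `A`.
  · obtain ⟨i, hi1, hi2⟩ := I.exists_between B.lo_nonneg
      ((B.lo_lt_mid.trans B.mid_lt_hi).trans_le B.hi_le_one)
    rcases hi1.eq_or_lt with h | h
    · exact ⟨_, h⟩
    obtain ⟨A, hA1, hA2⟩ := I.standard i
    rw [← hA1] at h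
    rw [← hA2] at hi2
    have hn := I.not_between i j
    rw [← hA1, ← hA2] at hn
    rcases le_total B.1.1 A.1.1 with hl | hl
    · rcases A.grid_lo hl with h' | h' <;> linarith
    · rcases B.grid_hi hl with h' | h'
      · linarith
      · rcases hn with hn | hn <;> linarith
  · rcases B.hi_le_one.eq_or_lt with h | h
    · exact ⟨Fin.last n, by rw [I.last, h]⟩
    obtain ⟨i, hi1, hi2⟩ := I.exists_between
      (B.lo_nonneg.trans (B.lo_lt_mid.trans B.mid_lt_hi).le) h
    rcases hi1.eq_or_lt with h | h
    · exact ⟨_, h⟩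
    obtain ⟨A, hA1, hA2⟩ := I.standard i
    rw [← hA1] at h
    rw [← hA2] at hi2
    have hn := I.not_between i j
    rw [← hA1, ← hA2] at hn
    rcases le_total B.1.1 A.1.1 with hl | hl
    · rcases A.grid_hi hl with h' | h' <;> linarith
    · rcases B.grid_lo hl with h' | h'
      · rcases hn with hn | hn <;> linarith
      · linarith

theorem unit_mem : SDInterval.unit ∈ I.intervals :=
  ⟨⟨0, by rw [I.first]; simp [lo, SDInterval.unit]⟩,
    ⟨Fin.last n, by rw [I.last]; simp [hi, SDInterval.unit]⟩⟩

theorem parent_mem {A : SDInterval} (hA : A ∈ I.intervals) (h : A ≠ SDInterval.unit) :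
    parent A ∈ I.intervals := by
  have h1 := (parent A).lo_lt_mid
  have h2 := (parent A).mid_lt_hi
  obtain ⟨⟨i, hi⟩, ⟨j, hj⟩⟩ := hA
  rcases half_ends h with h | h
  · exact I.mem_intervals_of_lt (j := j) (by rw [hj, h.2.2]; exact h1) (by rw [hj, h.2.2]; exact h2)
  · exact I.mem_intervals_of_lt (j := i) (by rw [hi, h.2.1]; exact h1) (by rw [hi, h.2.1]; exact h2)

theorem conj_mem {A : SDInterval} (hA : A ∈ I.intervals) (h : A ≠ SDInterval.unit) :
    conj A ∈ I.intervals := by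
  have hp := I.parent_mem hA h
  rcases conj_ends h with ⟨h1, h2, h3, h4⟩ | ⟨h1, h2, h3, h4⟩
  · exact ⟨by rw [h3, ← h2]; exact hA.2, by rw [h4]; exact hp.2⟩
  · exact ⟨by rw [h3]; exact hp.1, by rw [h4, ← h1]; exact hA.1⟩

/-- The points of the horizontal axis at which the columns end. -/
def point (a : Fin n × Bool) : ℝ := if a.2 then I.midpt a.1 else I.a a.1.castSucc

theorem point_true (i : Fin n) : I.point (i, true) = I.midpt i := rfl
theorem point_false (i : Fin n) : I.point (i, false) = I.a i.castSucc := rfl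

theorem lt_midpt (i : Fin n) : I.a i.castSucc < I.midpt i := by
  have := I.strictMono (Fin.castSucc_lt_succ (i := i))
  simp only [midpt]
  linarith

theorem midpt_lt (i : Fin n) : I.midpt i < I.a i.succ := by
  have := I.strictMono (Fin.castSucc_lt_succ (i := i))
  simp only [midpt]
  linarith

theorem point_lt {a b : Fin n × Bool} (h : col a < col b) : I.point a < I.point b := by
  obtain ⟨i, s⟩ := a
  obtain ⟨j, t⟩ := b
  have succ_le : i.1 < j.1 → I.a i.succ ≤ I.a j.castSucc := fun h =>
    I.strictMono.monotone (by rw [Fin.le_def]; simp; omega)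
  have l1 := I.lt_midpt i
  have l2 := I.midpt_lt i
  have l3 := I.lt_midpt j
  cases s <;> cases t <;> simp only [col, Bool.toNat_true, Bool.toNat_false] at h <;>
    simp only [point_true, point_false]
  · linarith [succ_le (by omega)]
  · rcases Nat.lt_or_ge i.1 j.1 with h' | h'
    · linarith [succ_le h']
    · obtain rfl : i = j := Fin.ext (by omega)
      exact l1
  · linarith [succ_le (by omega)]
  · linarith [succ_le (by omega)]

theorem point_lt_iff {a b : Fin n × Bool} : I.point a < I.point b ↔ col a < col b := by
  refine ⟨fun h => ?_, I.point_lt⟩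
  by_contra hn
  rcases (not_lt.1 hn).eq_or_lt with e | e
  · rw [col_injective e] at h
    exact lt_irrefl _ h
  · exact absurd h (I.point_lt e).not_gt

theorem point_injective {a b : Fin n × Bool} (h : I.point a = I.point b) : a = b := by
  rcases lt_trichotomy (col a) (col b) with h' | h' | h'
  · exact absurd h (I.point_lt h').ne
  · exact col_injective h'
  · exact absurd h (I.point_lt h').ne'

/-- The index of the left strand. -/
def root : Fin n × Bool := (⟨0, I.pos⟩, false)

theorem point_root : I.point I.root = 0 := I.first

/-- Breakpoints in the interior of `[0, 1]` are midpoints of intervals that split, and midpoints of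
subintervals belong to the leaves. So columns other than the first correspond to intervals. -/
theorem exists_interval {a : Fin n × Bool} (ha : a ≠ I.root) :
    ∃ A ∈ I.intervals, A.mid = I.point a := by
  obtain ⟨i, s⟩ := a
  obtain ⟨A, h1, h2⟩ := I.standard i
  cases s
  · have hi : 0 < i.1 := by
      by_contra h
      exact ha (Prod.ext (Fin.ext (by simp only [root]; omega)) rfl)
    have h0 : 0 < A.lo := by
      rw [h1, ← I.first]
      exact I.strictMono (by rw [Fin.lt_def]; simpa using hi)
    have hk : 0 < A.1.2 := by
      by_contra h
      have e : A.1.2 = 0 := by omega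
      rw [lo, e] at h0
      simp at h0
    obtain ⟨B, hB⟩ := exists_mid_eq A.1.1 A.1.2 hk A.2
    have hB' : B.mid = I.a i.castSucc := hB.trans h1
    exact ⟨B, I.mem_intervals_of_lt (hB' ▸ B.lo_lt_mid) (hB' ▸ B.mid_lt_hi), hB'⟩
  · exact ⟨A, ⟨⟨_, h1.symm⟩, ⟨_, h2.symm⟩⟩, by rw [point_true, mid, midpt, h1, h2]⟩

/-- If the midpoint is interior to a subinterval `C`, then `A` cannot be longer than `C` by
`grid_mid`. Its ends are breakpoints, hence not interior to `C`, and this forces `A` and `C` to have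
the same ends. -/
theorem exists_index {A : SDInterval} (hA : A ∈ I.intervals) :
    ∃ a, a ≠ I.root ∧ I.point a = A.mid := by
  have m0 : 0 < A.mid := A.lo_nonneg.trans_lt A.lo_lt_mid
  suffices h : ∃ a, I.point a = A.mid by
    obtain ⟨a, ha⟩ := h
    refine ⟨a, ?_, ha⟩
    rintro rfl
    rw [point_root] at ha
    linarith
  obtain ⟨i, h1, h2⟩ := I.exists_between m0.le (A.mid_lt_hi.trans_le A.hi_le_one)
  rcases h1.eq_or_lt with h | h
  · exact ⟨(i, false), h⟩
  refine ⟨(i, true), ?_⟩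
  obtain ⟨C, hC1, hC2⟩ := I.standard i
  rw [← hC1] at h
  rw [← hC2] at h2
  have l1 := A.lo_lt_mid
  have l2 := A.mid_lt_hi
  rcases lt_or_ge A.1.1 C.1.1 with hl | hl
  · rcases C.grid_mid hl with h' | h' <;> linarith
  · obtain ⟨⟨j, hj⟩, ⟨k, hk⟩⟩ := hA
    have b1 := I.not_between i j
    have b2 := I.not_between i k
    rw [← hC1, ← hC2, hj] at b1
    rw [← hC1, ← hC2, hk] at b2
    have e1 : A.lo = C.lo := by
      rcases A.grid_lo hl with h' | h' <;> rcases b1 with b1 | b1 <;> linarith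
    have e2 : A.hi = C.hi := by
      rcases A.grid_hi hl with h' | h' <;> rcases b2 with b2 | b2 <;> linarith
    rw [point_true, midpt, ← hC1, ← hC2, mid, e1, e2]

open Classical in
/-- The interval that belongs to a column (`[0, 1]` for the left strand, by convention). -/
def interval (a : Fin n × Bool) : SDInterval :=
  if h : a = I.root then SDInterval.unit else (I.exists_interval h).choose

theorem interval_root : I.interval I.root = SDInterval.unit := dif_pos rfl

theorem interval_mem (a : Fin n × Bool) : I.interval a ∈ I.intervals := by
  by_cases h : a = I.root
  · rw [h, interval_root]
    exact I.unit_mem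
  · rw [interval, dif_neg h]
    exact (I.exists_interval h).choose_spec.1

theorem mid_interval {a : Fin n × Bool} (h : a ≠ I.root) : (I.interval a).mid = I.point a := by
  rw [interval, dif_neg h]
  exact (I.exists_interval h).choose_spec.2

theorem interval_inj {a b : Fin n × Bool} (ha : a ≠ I.root) (hb : b ≠ I.root)
    (h : I.interval a = I.interval b) : a = b :=
  I.point_injective (by rw [← I.mid_interval ha, ← I.mid_interval hb, h])

open Classical in
/-- The column of an interval. -/
def index (A : SDInterval) : Fin n × Bool :=
  if h : A ∈ I.intervals then (I.exists_index h).choose else I.root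

theorem index_ne {A : SDInterval} (h : A ∈ I.intervals) : I.index A ≠ I.root := by
  rw [index, dif_pos h]
  exact (I.exists_index h).choose_spec.1

theorem point_index {A : SDInterval} (h : A ∈ I.intervals) : I.point (I.index A) = A.mid := by
  rw [index, dif_pos h]
  exact (I.exists_index h).choose_spec.2

theorem interval_index {A : SDInterval} (h : A ∈ I.intervals) : I.interval (I.index A) = A :=
  mid_injective (by rw [I.mid_interval (I.index_ne h), I.point_index h])

theorem index_interval {a : Fin n × Bool} (h : a ≠ I.root) : I.index (I.interval a) = a :=
  I.interval_inj (I.index_ne (I.interval_mem a)) h (I.interval_index (I.interval_mem a))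

theorem index_eq {A : SDInterval} {a : Fin n × Bool} (ha : a ≠ I.root) (h : I.interval a = A) :
    I.index A = a := by rw [← h, I.index_interval ha]

theorem finite_intervals : I.intervals.Finite := by
  refine (Set.finite_range I.interval).subset fun A hA => ⟨I.index A, I.interval_index hA⟩

open Classical in
/-- The other marking in the same row. -/
def conjIndex (a : Fin n × Bool) : Fin n × Bool :=
  if a = I.root then I.index SDInterval.unit else
    if I.interval a = SDInterval.unit then I.root else I.index (conj (I.interval a))

theorem conjIndex_root : I.conjIndex I.root = I.index SDInterval.unit := if_pos rfl

theorem interval_conjIndex_root : I.interval (I.conjIndex I.root) = SDInterval.unit := by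
  rw [conjIndex_root, I.interval_index I.unit_mem]

theorem conjIndex_unit {a : Fin n × Bool} (ha : a ≠ I.root)
    (h : I.interval a = SDInterval.unit) : I.conjIndex a = I.root := by
  rw [conjIndex, if_neg ha, if_pos h]

theorem ne_root {a : Fin n × Bool} (h : I.interval a ≠ SDInterval.unit) : a ≠ I.root := by
  rintro rfl
  exact h I.interval_root

theorem conjIndex_of_ne {a : Fin n × Bool} (h : I.interval a ≠ SDInterval.unit) :
    I.conjIndex a = I.index (conj (I.interval a)) := by
  rw [conjIndex, if_neg (I.ne_root h), if_neg h]

theorem interval_conjIndex {a : Fin n × Bool} (h : I.interval a ≠ SDInterval.unit) :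
    I.interval (I.conjIndex a) = conj (I.interval a) := by
  rw [I.conjIndex_of_ne h, I.interval_index (I.conj_mem (I.interval_mem a) h)]

theorem interval_eq_unit_iff {a : Fin n × Bool} :
    I.interval a = SDInterval.unit ↔ a = I.root ∨ a = I.conjIndex I.root := by
  constructor
  · intro h
    by_cases ha : a = I.root
    · exact Or.inl ha
    · right
      rw [conjIndex_root]
      exact (I.index_eq ha h).symm
  · rintro (rfl | rfl)
    · exact I.interval_root
    · exact I.interval_conjIndex_root

theorem interval_conjIndex_eq_unit_iff {a : Fin n × Bool} :
    I.interval (I.conjIndex a) = SDInterval.unit ↔ I.interval a = SDInterval.unit := by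
  constructor
  · intro h
    by_contra hn
    rw [I.interval_conjIndex hn] at h
    exact conj_ne_unit hn h
  · intro h
    by_cases ha : a = I.root
    · rw [ha, I.interval_conjIndex_root]
    · rw [I.conjIndex_unit ha h, I.interval_root]

theorem parent_conjIndex {a : Fin n × Bool} (h : I.interval a ≠ SDInterval.unit) :
    parent (I.interval (I.conjIndex a)) = parent (I.interval a) := by
  rw [I.interval_conjIndex h, parent_conj h]

theorem conjIndex_conjIndex (a : Fin n × Bool) : I.conjIndex (I.conjIndex a) = a := by
  by_cases h : I.interval a = SDInterval.unit
  · by_cases ha : a = I.root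
    · rw [ha]
      refine I.conjIndex_unit ?_ I.interval_conjIndex_root
      rw [conjIndex_root]
      exact I.index_ne I.unit_mem
    · rw [I.conjIndex_unit ha h, conjIndex_root]
      exact I.index_eq ha h
  · rw [I.conjIndex_of_ne (mt I.interval_conjIndex_eq_unit_iff.1 h), I.interval_conjIndex h,
      conj_conj h, I.index_interval (I.ne_root h)]

theorem conjIndex_ne (a : Fin n × Bool) : I.conjIndex a ≠ a := by
  intro e
  by_cases h : I.interval a = SDInterval.unit
  · by_cases ha : a = I.root
    · rw [ha, conjIndex_root] at e
      exact I.index_ne I.unit_mem e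
    · rw [I.conjIndex_unit ha h] at e
      exact ha e.symm
  · have := I.interval_conjIndex h
    rw [e] at this
    exact conj_ne h this.symm

/-- The columns that belong to positive intervals. -/
def PositiveIndex (a : Fin n × Bool) : Prop := a ≠ I.root ∧ (I.interval a).Positive

/-- The left strand plays the part of a negative conjugate of `[0, 1]`, so that every pair has
exactly one positive member. -/
theorem positiveIndex_conjIndex (a : Fin n × Bool) :
    I.PositiveIndex (I.conjIndex a) ↔ ¬ I.PositiveIndex a := by
  by_cases h : I.interval a = SDInterval.unit
  · rcases I.interval_eq_unit_iff.1 h with rfl | rfl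
    · simp only [PositiveIndex, I.interval_conjIndex_root, positive_unit, and_true, ne_eq,
        not_true, false_and, not_false_iff, iff_true]
      exact I.conjIndex_ne _
    · rw [I.conjIndex_conjIndex]
      simp only [PositiveIndex, ne_eq, not_true, false_and, I.interval_conjIndex_root,
        positive_unit, and_true, not_not, false_iff]
      exact I.conjIndex_ne _
  · have h1 := I.ne_root h
    have h2 := I.ne_root (mt I.interval_conjIndex_eq_unit_iff.1 h)
    simp only [PositiveIndex, ne_eq, h1, h2, not_false_iff, true_and, I.interval_conjIndex h,
      positive_conj h]

/-- The positive intervals. -/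
def positives : Set SDInterval := {B | B ∈ I.intervals ∧ B.Positive}

/-- Conjugation exchanges positive and other columns, so the positive ones make up half of the `2n`
columns. -/
theorem ncard_positives : I.positives.ncard = n := by
  classical
  have e : I.positives = I.interval '' {a | I.PositiveIndex a} := by
    ext A
    constructor
    · rintro ⟨h1, h2⟩
      exact ⟨I.index A, ⟨I.index_ne h1, by rwa [I.interval_index h1]⟩, I.interval_index h1⟩
    · rintro ⟨a, ha, rfl⟩
      exact ⟨I.interval_mem a, ha.2⟩
  rw [e, Set.InjOn.ncard_image fun a ha b hb h => I.interval_inj ha.1 hb.1 h]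
  have h1 : {a | I.PositiveIndex a} = ↑(Finset.univ.filter fun a => I.PositiveIndex a) := by
    ext; simp
  rw [h1, Set.ncard_coe_finset]
  have h2 : (Finset.univ.filter fun a => I.PositiveIndex a).card =
      (Finset.univ.filter fun a => ¬ I.PositiveIndex a).card := by
    refine Finset.card_bij' (fun a _ => I.conjIndex a) (fun a _ => I.conjIndex a) ?_ ?_ ?_ ?_
    · intro a ha
      simp only [Finset.mem_filter, Finset.mem_univ, true_and] at ha ⊢
      rw [positiveIndex_conjIndex]
      tauto
    · intro a ha
      simp only [Finset.mem_filter, Finset.mem_univ, true_and] at ha ⊢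
      rwa [positiveIndex_conjIndex]
    · intro a _
      exact I.conjIndex_conjIndex a
    · intro a _
      exact I.conjIndex_conjIndex a
  have h3 := Finset.card_filter_add_card_filter_not (s := (Finset.univ : Finset (Fin n × Bool)))
    (fun a => I.PositiveIndex a)
  rw [Finset.card_univ, Fintype.card_prod, Fintype.card_fin, Fintype.card_bool] at h3
  omega

theorem finite_positives : I.positives.Finite := I.finite_intervals.subset fun _ h => h.1

open Classical in
/-- The positive one of an interval and its conjugate. -/
def _root_.SDInterval.rep (A : SDInterval) : SDInterval := if A.Positive then A else A.conj

theorem _root_.SDInterval.ne_unit_of_not_positive {A : SDInterval} (h : ¬ A.Positive) :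
    A ≠ SDInterval.unit := by
  rintro rfl
  exact h positive_unit

theorem rep_mem {A : SDInterval} (hA : A ∈ I.intervals) : A.rep ∈ I.positives := by
  by_cases h : A.Positive
  · rw [rep, if_pos h]
    exact ⟨hA, h⟩
  · rw [rep, if_neg h]
    have := ne_unit_of_not_positive h
    exact ⟨I.conj_mem hA this, (positive_conj this).2 h⟩

theorem _root_.SDInterval.rep_of_positive {A : SDInterval} (h : A.Positive) : A.rep = A := if_pos h

theorem _root_.SDInterval.rep_conj {A : SDInterval} (h : A ≠ SDInterval.unit) :
    A.conj.rep = A.rep := by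
  by_cases hp : A.Positive
  · rw [rep, rep, if_pos hp, if_neg (by rw [positive_conj h]; tauto), conj_conj h]
  · rw [rep, rep, if_neg hp, if_pos ((positive_conj h).2 hp)]

theorem _root_.SDInterval.len_rep (A : SDInterval) : A.rep.len = A.len := by
  by_cases h : A.Positive
  · rw [rep, if_pos h]
  · rw [rep, if_neg h, len_conj (ne_unit_of_not_positive h)]

theorem _root_.SDInterval.rep_eq_or (A : SDInterval) :
    A.rep = A ∨ (A ≠ SDInterval.unit ∧ A.rep = A.conj) := by
  by_cases h : A.Positive
  · exact Or.inl (rep_of_positive h)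
  · exact Or.inr ⟨ne_unit_of_not_positive h, if_neg h⟩

theorem posY_eq (A : SDInterval) : I.posY A = {B | B ∈ I.positives ∧ B.LenLE A.rep}.ncard := by
  simp only [posY, positives, rep, Set.mem_ofPred_eq, and_assoc]

theorem posY_lt {A B : SDInterval} (hB : B ∈ I.intervals) (h : A.rep.LenLE B.rep)
    (hne : A.rep ≠ B.rep) : I.posY A < I.posY B := by
  rw [posY_eq, posY_eq]
  refine Set.ncard_lt_ncard ?_ (I.finite_positives.subset fun _ h => h.1)
  have hs : {C | C ∈ I.positives ∧ C.LenLE A.rep} ⊆ {C | C ∈ I.positives ∧ C.LenLE B.rep} :=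
    fun C hC => ⟨hC.1, hC.2.trans h⟩
  rw [Set.ssubset_iff_of_subset hs]
  exact ⟨B.rep, ⟨I.rep_mem hB, .refl _⟩, fun h' => hne (h.antisymm h'.2)⟩

theorem posY_eq_iff {A B : SDInterval} (hA : A ∈ I.intervals) (hB : B ∈ I.intervals) :
    I.posY A = I.posY B ↔ A.rep = B.rep := by
  constructor
  · intro h
    by_contra hne
    rcases LenLE.total A.rep B.rep with h' | h'
    · exact absurd h (I.posY_lt hB h' hne).ne
    · exact absurd h (I.posY_lt hA h' (Ne.symm hne)).ne'
  · intro h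
    rw [posY_eq, posY_eq, h]

theorem posY_mem {A : SDInterval} (hA : A ∈ I.intervals) : I.posY A ∈ Set.Icc 1 n := by
  rw [posY_eq]
  constructor
  · rw [Nat.one_le_iff_ne_zero, Ne, Set.ncard_eq_zero (I.finite_positives.subset fun _ h => h.1)]
    exact Set.Nonempty.ne_empty ⟨A.rep, I.rep_mem hA, .refl _⟩
  · exact (Set.ncard_le_ncard (fun _ h => h.1) I.finite_positives).trans I.ncard_positives.le

theorem posY_unit : I.posY SDInterval.unit = n := by
  rw [posY_eq, rep_of_positive positive_unit]
  refine Eq.trans ?_ I.ncard_positives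
  congr 1
  ext B
  simp only [Set.mem_ofPred_eq, and_iff_left_iff_imp]
  exact fun _ => lenLE_unit B

/-- The `n` positive intervals have different ranks in `1, …, n`, so every rank occurs. -/
theorem exists_posY {y : ℕ} (hy : y ∈ Set.Icc 1 n) : ∃ A ∈ I.intervals, I.posY A = y := by
  have h1 : I.posY '' I.positives = Set.Icc 1 n := by
    refine Set.eq_of_subset_of_ncard_le ?_ ?_ (Set.finite_Icc 1 n)
    · rintro _ ⟨A, hA, rfl⟩
      exact I.posY_mem hA.1
    · rw [Set.InjOn.ncard_image, I.ncard_positives, ← Finset.coe_Icc, Set.ncard_coe_finset]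
      · simp
      · intro A hA B hB h
        have := (I.posY_eq_iff hA.1 hB.1).1 h
        rwa [rep_of_positive hA.2, rep_of_positive hB.2] at this
  rw [← h1] at hy
  obtain ⟨A, hA, rfl⟩ := hy
  exact ⟨A, hA.1, rfl⟩

/-- Rows are ranks of positive representatives, and an interval shares its representative only with
its conjugate; `[0, 1]` is matched with the left strand instead. -/
theorem posY_interval_eq_iff (a b : Fin n × Bool) :
    I.posY (I.interval a) = I.posY (I.interval b) ↔ b = a ∨ b = I.conjIndex a := by
  rw [I.posY_eq_iff (I.interval_mem a) (I.interval_mem b)]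
  constructor
  · intro h
    by_cases ha : I.interval a = SDInterval.unit
    · have hb : I.interval b = SDInterval.unit := by
        rw [← len_eq_one_iff, ← len_rep, ← h, ha, len_rep, len_unit]
      rcases I.interval_eq_unit_iff.1 ha with rfl | rfl <;>
        rcases I.interval_eq_unit_iff.1 hb with rfl | rfl
      · exact Or.inl rfl
      · exact Or.inr rfl
      · exact Or.inr (I.conjIndex_conjIndex _).symm
      · exact Or.inl rfl
    · have hb : I.interval b ≠ SDInterval.unit := by
        intro hb
        apply ha
        rw [← len_eq_one_iff, ← len_rep, h, hb, len_rep, len_unit]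
      have key : I.interval b = I.interval a ∨ I.interval b = conj (I.interval a) := by
        rcases rep_eq_or (I.interval a) with e | ⟨-, e⟩ <;>
          rcases rep_eq_or (I.interval b) with e' | ⟨-, e'⟩ <;> rw [e, e'] at h
        · exact Or.inl h.symm
        · right
          rw [h, conj_conj hb]
        · exact Or.inr h.symm
        · left
          rw [← conj_conj hb, ← h, conj_conj ha]
      rcases key with e | e
      · exact Or.inl (I.interval_inj (I.ne_root hb) (I.ne_root ha) e)
      · right
        rw [I.conjIndex_of_ne ha]
        exact (I.index_eq (I.ne_root hb) e).symm
  · rintro (rfl | rfl)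
    · rfl
    · by_cases ha : I.interval a = SDInterval.unit
      · rw [ha, I.interval_conjIndex_eq_unit_iff.2 ha]
      · rw [I.interval_conjIndex ha, rep_conj ha]

/-- Midpoint order is column order, and the shift by one leaves the first column to the left strand.
-/
theorem posX_interval {a : Fin n × Bool} (ha : a ≠ I.root) : I.posX (I.interval a) = col a := by
  have e : {B | B ∈ I.intervals ∧ B.mid ≤ (I.interval a).mid} =
      I.interval '' {b | b ≠ I.root ∧ col b ≤ col a} := by
    ext B
    rw [I.mid_interval ha]
    constructor
    · rintro ⟨h1, h2⟩
      refine ⟨I.index B, ⟨I.index_ne h1, ?_⟩, I.interval_index h1⟩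
      rw [← I.point_index h1] at h2
      rw [← not_lt, ← I.point_lt_iff]
      exact not_lt.2 h2
    · rintro ⟨b, ⟨h1, h2⟩, rfl⟩
      refine ⟨I.interval_mem b, ?_⟩
      rw [I.mid_interval h1, ← not_lt, I.point_lt_iff]
      exact not_lt.2 h2
  have hroot : col I.root = 1 := rfl
  have e2 : col '' {b | b ≠ I.root ∧ col b ≤ col a} = Set.Icc 2 (col a) := by
    ext x
    constructor
    · rintro ⟨b, ⟨h1, h2⟩, rfl⟩
      have := (col_mem b).1
      have h3 : col b ≠ 1 := fun h => h1 (col_injective (h.trans hroot.symm))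
      exact ⟨by omega, h2⟩
    · rintro ⟨h1, h2⟩
      have := (col_mem a).2
      obtain ⟨b, rfl⟩ := exists_col (n := n) (x := x) ⟨by omega, by omega⟩
      refine ⟨b, ⟨?_, h2⟩, rfl⟩
      rintro rfl
      rw [hroot] at h1
      omega
  rw [posX, e, Set.InjOn.ncard_image fun a ha b hb h => I.interval_inj ha.1 hb.1 h,
    ← Set.ncard_image_of_injective _ col_injective, e2, ← Finset.coe_Icc, Set.ncard_coe_finset,
    Nat.card_Icc]
  have := (col_mem a).1
  have h3 : col a ≠ 1 := fun h => ha (col_injective (h.trans hroot.symm))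
  omega

end SDPartition

/-! ### The tree diagram of a partition and the Thompson link -/

namespace SDPartition

open SDInterval

variable {n : ℕ} (I : SDPartition n)

open Classical in
/-- The height at which a column of the tree diagram ends. -/
def height (a : Fin n × Bool) : ℝ := if a = I.root then 3 else 1 + (I.interval a).len

open Classical in
/-- The position of the vertex of the tree above a column. -/
def vertexX (a : Fin n × Bool) : ℝ :=
  -- The apex at the root is placed over the midpoint of the segment from `(0, 3)` to `(1/2, 2)`,
  -- which explains `1/4` here and `5/2` in `vertexY`.
  if I.interval a = SDInterval.unit then 1 / 4 else (parent (I.interval a)).mid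

open Classical in
def vertexY (a : Fin n × Bool) : ℝ :=
  if I.interval a = SDInterval.unit then 5 / 2 else 1 + (parent (I.interval a)).len

theorem height_root : I.height I.root = 3 := if_pos rfl
theorem height_of_ne {a : Fin n × Bool} (h : a ≠ I.root) : I.height a = 1 + (I.interval a).len :=
  if_neg h

theorem height_ge (a : Fin n × Bool) : 1 + (I.interval a).len ≤ I.height a := by
  by_cases h : a = I.root
  · rw [h, height_root]
    linarith [(I.interval I.root).len_le_one]
  · rw [I.height_of_ne h]

theorem vertexY_of_eq {a : Fin n × Bool} (h : I.interval a = SDInterval.unit) :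
    I.vertexY a = 5 / 2 := if_pos h
theorem vertexY_of_ne {a : Fin n × Bool} (h : I.interval a ≠ SDInterval.unit) :
    I.vertexY a = 1 + (parent (I.interval a)).len := if_neg h
theorem vertexX_of_eq {a : Fin n × Bool} (h : I.interval a = SDInterval.unit) :
    I.vertexX a = 1 / 4 := if_pos h
theorem vertexX_of_ne {a : Fin n × Bool} (h : I.interval a ≠ SDInterval.unit) :
    I.vertexX a = (parent (I.interval a)).mid := if_neg h

theorem vertexY_ge (a : Fin n × Bool) : 1 + 2 * (I.interval a).len ≤ I.vertexY a ∨
    I.vertexY a = 5 / 2 := by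
  by_cases h : I.interval a = SDInterval.unit
  · exact Or.inr (I.vertexY_of_eq h)
  · rw [I.vertexY_of_ne h, len_parent h]
    exact Or.inl le_rfl

/-- Rows, heights and apex heights all increase with the length, the parent being twice as long.
This is the vertical alternative of `sep`. -/
theorem len_interval_lt {a b : Fin n × Bool} (h : (I.interval a).len < (I.interval b).len) :
    I.posY (I.interval a) < I.posY (I.interval b) ∧ I.height a < I.height b ∧
      I.vertexY a < I.vertexY b := by
  have hu : I.interval a ≠ SDInterval.unit := fun e => by
    rw [e, len_unit] at h
    exact absurd (I.interval b).len_le_one (not_le.2 h)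
  refine ⟨I.posY_lt (I.interval_mem b) (Or.inl (by rwa [len_rep, len_rep])) fun e => ?_, ?_, ?_⟩
  · have := congrArg SDInterval.len e
    rw [len_rep, len_rep] at this
    exact h.ne this
  · rw [I.height_of_ne (I.ne_root hu)]
    linarith [I.height_ge b]
  · rw [I.vertexY_of_ne hu, len_parent hu]
    have := len_le_half hu
    rcases I.vertexY_ge b with h' | h' <;> linarith

/-- Parents of equal length with different midpoints do not overlap, so their halves are in the same
order. -/
theorem mid_lt_of_parent {A B : SDInterval} (hA : A ≠ SDInterval.unit) (hB : B ≠ SDInterval.unit)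
    (hl : A.len = B.len) (h : (parent A).mid < (parent B).mid) : A.mid < B.mid := by
  have e : (parent A).1.1 = (parent B).1.1 := by
    rw [← len_eq_iff, len_parent hA, len_parent hB, hl]
  have el := len_eq_iff.2 e
  have : (parent A).hi ≤ (parent B).lo := by
    rcases (parent A).grid_lo e.ge with h' | h'
    · have h3 : ∀ C : SDInterval, C.mid = C.lo + C.len / 2 := fun C => by
        simp only [mid, len]; ring
      rw [h3, h3, el] at h
      linarith
    · exact h'
  have h1 := le_parent_hi hA
  have h2 := parent_lo_le hB
  linarith [A.mid_lt_hi, B.lo_lt_mid]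

theorem separated {a b : Fin n × Bool} (hu : I.interval a ≠ SDInterval.unit)
    (hu' : I.interval b ≠ SDInterval.unit) (hl : (I.interval a).len = (I.interval b).len)
    (h : (parent (I.interval a)).mid < (parent (I.interval b)).mid) : col a < col b ∧
      (col (I.index (parent (I.interval a))) : ℝ) < (col (I.index (parent (I.interval b))) : ℝ) ∧
      I.vertexX a < I.vertexX b := by
  refine ⟨?_, ?_, by rwa [I.vertexX_of_ne hu, I.vertexX_of_ne hu']⟩
  · rw [← I.point_lt_iff, ← I.mid_interval (I.ne_root hu), ← I.mid_interval (I.ne_root hu')]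
    exact mid_lt_of_parent hu hu' hl h
  · rw [Nat.cast_lt, ← I.point_lt_iff, I.point_index (I.parent_mem (I.interval_mem a) hu),
      I.point_index (I.parent_mem (I.interval_mem b) hu')]
    exact h

/-- The half grid diagram of a partition, with the tree diagram of the partition. -/
def halfDiagram : HalfDiagram n where
  row a := I.posY (I.interval a)
  conj := I.conjIndex
  root := I.root
  x := I.point
  h := I.height
  -- In the grid picture the apex is over the column of the parent. By truncated subtraction `[0,
  -- 1]` is its own parent, so the apex at the root starts over the column of `[0, 1]`.
  ξ₀ a := col (I.index (parent (I.interval a)))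
  ξ := I.vertexX
  g := I.vertexY
  conj_ne := I.conjIndex_ne
  row_eq_iff := I.posY_interval_eq_iff
  row_mem a := I.posY_mem (I.interval_mem a)
  row_surj y hy := by
    obtain ⟨A, hA, rfl⟩ := I.exists_posY hy
    exact ⟨I.index A, by rw [I.interval_index hA]⟩
  x_lt _ _ h := I.point_lt h
  one_lt_h a := by linarith [I.height_ge a, (I.interval a).len_pos]
  one_lt_g a := by
    rcases I.vertexY_ge a with h | h
    · linarith [(I.interval a).len_pos]
    · rw [h]; norm_num
  ξ₀_conj a := by
    by_cases h : I.interval a = SDInterval.unit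
    · rw [h, I.interval_conjIndex_eq_unit_iff.2 h]
    · rw [I.parent_conjIndex h]
  ξ_conj a := by
    by_cases h : I.interval a = SDInterval.unit
    · rw [I.vertexX_of_eq h, I.vertexX_of_eq (I.interval_conjIndex_eq_unit_iff.2 h)]
    · rw [I.vertexX_of_ne h, I.vertexX_of_ne (mt I.interval_conjIndex_eq_unit_iff.1 h),
        I.parent_conjIndex h]
  g_conj a := by
    by_cases h : I.interval a = SDInterval.unit
    · rw [I.vertexY_of_eq h, I.vertexY_of_eq (I.interval_conjIndex_eq_unit_iff.2 h)]
    · rw [I.vertexY_of_ne h, I.vertexY_of_ne (mt I.interval_conjIndex_eq_unit_iff.1 h),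
        I.parent_conjIndex h]
  sep a b hab hc := by
    -- Different lengths are separated vertically, equal lengths horizontally by the midpoints of
    -- the parents. Equal parents would make the intervals equal or conjugate.
    rcases lt_trichotomy (I.interval a).len (I.interval b).len with hl | hl | hl
    · exact Or.inr (Or.inr (Or.inl (I.len_interval_lt hl)))
    · have hu : I.interval a ≠ SDInterval.unit := by
        intro e
        have e' : I.interval b = SDInterval.unit := by
          rw [← len_eq_one_iff, ← hl, e, len_unit]
        rcases I.interval_eq_unit_iff.1 e with rfl | rfl <;>
          rcases I.interval_eq_unit_iff.1 e' with rfl | rfl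
        · exact hab rfl
        · exact hc rfl
        · exact hc (I.conjIndex_conjIndex _).symm
        · exact hab rfl
      have hu' : I.interval b ≠ SDInterval.unit := fun e => by
        rw [e, len_unit, len_eq_one_iff] at hl
        exact hu hl
      have hp : parent (I.interval a) ≠ parent (I.interval b) := by
        intro e
        rcases eq_or_eq_conj hu hu' e with e | e
        · exact hab (I.interval_inj (I.ne_root hu) (I.ne_root hu') e.symm)
        · apply hc
          rw [I.conjIndex_of_ne hu]
          exact (I.index_eq (I.ne_root hu') e).symm
      rcases lt_trichotomy (parent (I.interval a)).mid (parent (I.interval b)).mid with h | h | h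
      · exact Or.inl (I.separated hu hu' hl h)
      · exact absurd (mid_injective h) hp
      · exact Or.inr (Or.inl (I.separated hu' hu hl.symm h))
    · exact Or.inr (Or.inr (Or.inr (I.len_interval_lt hl)))
  x_root := I.point_root
  h_root := I.height_root
  x_conj_root := by
    rw [conjIndex_root, I.point_index I.unit_mem, mid_unit]
  h_conj_root := by
    rw [I.height_of_ne (I.conjIndex_ne _), I.interval_conjIndex_root, len_unit]
    norm_num
  ξ_root := I.vertexX_of_eq I.interval_root
  g_root := I.vertexY_of_eq I.interval_root
  h_lt_two a h h' := by
    have hu : I.interval a ≠ SDInterval.unit := fun e =>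
      (I.interval_eq_unit_iff.1 e).elim h h'
    rw [I.height_of_ne h]
    linarith [len_le_half hu]
  g_le_two a h h' := by
    have hu : I.interval a ≠ SDInterval.unit := fun e =>
      (I.interval_eq_unit_iff.1 e).elim h h'
    rw [I.vertexY_of_ne hu]
    linarith [(parent (I.interval a)).len_le_one]

theorem mem_halfGrid {x y : ℕ} : (x, y) ∈ I.halfGrid.X ∪ I.halfGrid.O ↔
    ∃ a, x = col a ∧ y = I.posY (I.interval a) := by
  constructor
  · rintro (⟨A, hA, -, h⟩ | ⟨⟨⟩⟩ | ⟨A, hA, -, h⟩)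
    · obtain ⟨rfl, rfl⟩ := Prod.mk.inj h
      refine ⟨I.index A, ?_, by rw [I.interval_index hA]⟩
      rw [← I.posX_interval (I.index_ne hA), I.interval_index hA]
    · exact ⟨I.root, rfl, by rw [interval_root, posY_unit]⟩
    · obtain ⟨rfl, rfl⟩ := Prod.mk.inj h
      refine ⟨I.index A, ?_, by rw [I.interval_index hA]⟩
      rw [← I.posX_interval (I.index_ne hA), I.interval_index hA]
  · rintro ⟨a, rfl, rfl⟩
    by_cases ha : a = I.root
    · refine Or.inr (Or.inl ?_)
      rw [ha, interval_root, posY_unit]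
      rfl
    · rw [← I.posX_interval ha]
      by_cases hp : (I.interval a).Positive
      · exact Or.inl ⟨_, I.interval_mem a, hp, rfl⟩
      · exact Or.inr (Or.inr ⟨_, I.interval_mem a, hp, rfl⟩)

variable (J : SDPartition n)

/-- The two half diagrams of a pair of partitions. -/
def halves : Bool → HalfDiagram n
  | true => I.halfDiagram
  | false => J.halfDiagram

theorem stack_eq : stack n I.halfGrid J.halfGrid = Set.range (HalfDiagram.mark (I.halves J)) := by
  ext p
  constructor
  · rintro (⟨x, y, h, rfl⟩ | ⟨x, y, h, rfl⟩)
    · obtain ⟨a, rfl, rfl⟩ := I.mem_halfGrid.1 h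
      exact ⟨(true, a), rfl⟩
    · obtain ⟨a, rfl, rfl⟩ := J.mem_halfGrid.1 h
      exact ⟨(false, a), rfl⟩
  · rintro ⟨⟨b, a⟩, rfl⟩
    cases b
    · exact Or.inr ⟨_, _, J.mem_halfGrid.2 ⟨a, rfl, rfl⟩, rfl⟩
    · exact Or.inl ⟨_, _, I.mem_halfGrid.2 ⟨a, rfl, rfl⟩, rfl⟩

theorem lower_interval {a : Fin n × Bool} (ha : a ≠ I.root) :
    (I.interval a).lower = (I.point a, I.height a, 0) := by
  rw [lower, I.mid_interval ha, I.height_of_ne ha]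

theorem lower_unit : SDInterval.unit.lower = (1 / 2, 2, 0) := by
  rw [lower, mid_unit, len_unit]
  norm_num

/-- With height `3` at the root index, the left strand becomes one of the legs, which matches the
shape of `HalfDiagram.treeLink`. -/
theorem mem_tangle {e : Sym2 Pt} : e ∈ tangle I ↔
    (∃ a, e = s((I.point a, I.height a, 0), (I.point a, 1, 0))) ∨
    (∃ a, a ≠ I.root ∧ a ≠ I.conjIndex I.root ∧
      e = s((I.vertexX a, I.vertexY a, 1), (I.point a, I.height a, 0))) ∨
    e = s((0, 3, 0), (1 / 2, 2, 0)) := by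
  constructor
  · rintro ((⟨A, hA, rfl⟩ | ⟨A, hA, B, hB, hAB, rfl⟩) | rfl | rfl)
    · left
      have h := I.index_ne hA
      refine ⟨I.index A, ?_⟩
      rw [← I.lower_interval h, I.interval_index hA, I.point_index hA]
    · right; left
      obtain ⟨h, rfl⟩ := isHalfOf_iff.1 hAB
      have hr := I.index_ne hA
      have e := I.interval_index hA
      refine ⟨I.index A, hr, fun h' => ?_, ?_⟩
      · exact h (by rw [← e, h', I.interval_conjIndex_root])
      · rw [← I.lower_interval hr, I.vertexX_of_ne (by rwa [e]), I.vertexY_of_ne (by rwa [e]), e]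
        rfl
    · right; right
      rw [lower_unit]
    · left
      exact ⟨I.root, by rw [I.point_root, I.height_root]⟩
  · rintro (⟨a, rfl⟩ | ⟨a, h, h', rfl⟩ | rfl)
    · by_cases h : a = I.root
      · rw [h, I.point_root, I.height_root]
        exact Or.inr (Or.inr rfl)
      · refine Or.inl (Or.inl ⟨I.interval a, I.interval_mem a, ?_⟩)
        rw [I.lower_interval h, I.mid_interval h]
    · have hu : I.interval a ≠ SDInterval.unit := fun e =>
        (I.interval_eq_unit_iff.1 e).elim h h'
      refine Or.inl (Or.inr ⟨I.interval a, I.interval_mem a, _,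
        I.parent_mem (I.interval_mem a) hu, isHalfOf_iff.2 ⟨hu, rfl⟩, ?_⟩)
      rw [I.lower_interval h, I.vertexX_of_ne hu, I.vertexY_of_ne hu]
      rfl
    · refine Or.inr (Or.inl ?_)
      rw [lower_unit]

theorem thompsonLink_eq : thompsonLink I J = HalfDiagram.treeLink (I.halves J) := by
  ext e
  constructor
  · rintro (((h | ⟨e, h, rfl⟩) | ⟨i, rfl⟩) | ⟨i, rfl⟩)
    · rcases I.mem_tangle.1 h with ⟨a, rfl⟩ | ⟨a, h1, h2, rfl⟩ | rfl
      · exact Or.inl (Or.inl (Or.inl ⟨true, a, by simp [sg, halves, halfDiagram]⟩))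
      · exact Or.inl (Or.inl (Or.inr ⟨true, a, h1, h2, by simp [sg, halves, halfDiagram]⟩))
      · exact Or.inl (Or.inr ⟨true, by simp [sg]⟩)
    · rcases J.mem_tangle.1 h with ⟨a, rfl⟩ | ⟨a, h1, h2, rfl⟩ | rfl
      · exact Or.inl (Or.inl (Or.inl ⟨false, a, by simp [sg, halves, halfDiagram]⟩))
      · exact Or.inl (Or.inl (Or.inr ⟨false, a, h1, h2, by simp [sg, halves, halfDiagram]⟩))
      · exact Or.inl (Or.inr ⟨false, by simp [sg]⟩)
    · exact Or.inr ⟨(i, false), rfl⟩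
    · exact Or.inr ⟨(i, true), rfl⟩
  · rintro (((⟨b, a, rfl⟩ | ⟨b, a, ha, ha', rfl⟩) | ⟨b, rfl⟩) | ⟨⟨i, s⟩, rfl⟩)
    · cases b
      · exact Or.inl (Or.inl (Or.inr ⟨_, J.mem_tangle.2 (Or.inl ⟨a, rfl⟩),
          by simp [sg, halves, halfDiagram]⟩))
      · refine Or.inl (Or.inl (Or.inl (I.mem_tangle.2 (Or.inl ⟨a, ?_⟩))))
        simp [sg, halves, halfDiagram]
    · cases b
      · exact Or.inl (Or.inl (Or.inr ⟨_, J.mem_tangle.2 (Or.inr (Or.inl ⟨a, ha, ha', rfl⟩)),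
          by simp [sg, halves, halfDiagram]⟩))
      · refine Or.inl (Or.inl (Or.inl (I.mem_tangle.2 (Or.inr (Or.inl ⟨a, ha, ha', ?_⟩)))))
        simp [sg, halves, halfDiagram]
    · cases b
      · exact Or.inl (Or.inl (Or.inr ⟨_, J.mem_tangle.2 (Or.inr (Or.inr rfl)), by simp [sg]⟩))
      · refine Or.inl (Or.inl (Or.inl (I.mem_tangle.2 (Or.inr (Or.inr ?_)))))
        simp [sg]
    · cases s
      · exact Or.inl (Or.inr ⟨i, rfl⟩)
      · exact Or.inr ⟨i, rfl⟩

theorem isGridDiagram_stack : IsGridDiagram (2 * n) (stack n I.halfGrid J.halfGrid) := by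
  rw [stack_eq]
  exact HalfDiagram.isGridDiagram _

theorem linkEquiv_thompsonLink :
    LinkEquiv (gridLink (stack n I.halfGrid J.halfGrid)) (thompsonLink I J) := by
  rw [stack_eq, thompsonLink_eq]
  obtain ⟨f, hf⟩ := (HalfDiagram.isGridDiagram (I.halves J)).exists_frame
  exact HalfDiagram.equiv_treeLink hf

end SDPartition

/-! ### The inequalities between the invariants -/

theorem gridNumber_le_two_mul_thompsonIndex (L : Set (Sym2 Pt)) :
    gridNumber L ≤ 2 * thompsonIndex L := by
  rcases Set.eq_empty_or_nonempty {k : ℕ∞ | ∃ g ∈ thompsonF, ∃ (n : ℕ) (I J : SDPartition n),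
    IsReducedPair I J g ∧ LinkEquiv L (thompsonLink I J) ∧ k = n} with h | h
  -- If no element of `F` gives the link, the index is `⊤` and nothing has to be shown; otherwise
  -- the infimum is attained.
  · rw [thompsonIndex, h, sInf_empty]
    simp
  · obtain ⟨g, -, n, I, J, -, h2, h3⟩ := csInf_mem h
    refine sInf_le ⟨2 * n, _, I.isGridDiagram_stack J,
      h2.trans (I.linkEquiv_thompsonLink J).symm, ?_⟩
    rw [thompsonIndex, h3]
    push_cast
    rfl

/-- Carry the orientation along the equivalence to the grid link. The grid number ignores
orientations, so the bound holds for each of them. -/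
theorem two_mul_braidIndex_le_gridNumber {D : Set (Pt × Pt)} (hD : IsOrientedLink D) :
    2 * braidIndex D ≤ gridNumber (forget D) := by
  refine le_sInf ?_
  rintro k ⟨m, G, hG, h, rfl⟩
  obtain ⟨D', h1, h2, h3⟩ := h.lift.1 D hD rfl
  have h4 : braidIndex D ≤ braidIndex D' := by
    refine le_sInf ?_
    rintro k ⟨D'', c, h, hb, rfl⟩
    exact sInf_le ⟨D'', c, h3.trans h, hb, rfl⟩
  exact (mul_le_mul_right h4 2).trans (hG.two_mul_braidIndex_le h1 h2)

end

theorem mainTheorem7 :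
    (∀ (n : ℕ) (I J : SDPartition n),
      IsGridDiagram (2 * n) (stack n I.halfGrid J.halfGrid) ∧
      LinkEquiv (gridLink (stack n I.halfGrid J.halfGrid)) (thompsonLink I J)) ∧
    (∀ L : Set (Sym2 Pt), IsLink L →
      gridNumber L ≤ 2 * thompsonIndex L ∧
      ∀ D : Set (Pt × Pt), IsOrientedLink D → forget D = L →
        bridgeNumber L ≤ braidIndex D ∧
        (braidIndex D : ℝ≥0∞) ≤ (gridNumber L : ℝ≥0∞) / 2 ∧
        (gridNumber L : ℝ≥0∞) / 2 ≤ (thompsonIndex L : ℝ≥0∞)) := by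
  refine ⟨fun n I J => ⟨I.isGridDiagram_stack J, I.linkEquiv_thompsonLink J⟩, fun L _ =>
    ⟨gridNumber_le_two_mul_thompsonIndex L, ?_⟩⟩
  rintro D hD rfl
  refine ⟨bridgeNumber_le_braidIndex hD, ?_, ?_⟩
  -- Clearing the denominator reduces the claim to an inequality in `ℕ∞`, infinite values included.
  · rw [ENNReal.le_div_iff_mul_le (by simp) (by simp), mul_comm]
    exact_mod_cast ENat.toENNReal_mono (two_mul_braidIndex_le_gridNumber hD)
  · refine ENNReal.div_le_of_le_mul' ?_
    exact_mod_cast ENat.toENNReal_mono (gridNumber_le_two_mul_thompsonIndex (forget D))
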